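/- Let $\Sigma$ be a smooth $n$-manifold, $\pi : T^*\Sigma \to \Sigma$ its cotangent bundle with symplectic form $\omega=\sum dy_i\wedge dx^i$, and let $H : T^*\Sigma\to\mathbb R$ be a convex hamiltonian, i.e. $H$ is smooth and its restriction to each fibre $T_x^*\Sigma$ has positive definite Hessian; its hamiltonian vector field is $\dot x^i=\partial H/\partial y_i$, $\dot y_i=-\partial H/\partial x^i$. Let $M\subset T^*\Sigma$ be an embedded submanifold and $f : M\to B$ a surjective submersion onto a manifold (for instance a fibre bundle map; $B$ may be a point) whose fibres are compact lagrangian submanifolds of $T^*\Sigma$. For $\theta\in M$ put $r(\theta)=\ker d_\theta f$ and $s(\theta)=\ker d_\theta\pi$; these are lagrangian subspaces of $T_\theta(T^*\Sigma)$. The relative Maslov cycle is $$\mathfrak m_\zeta=\{\theta\in M : r(\theta)\cap s(\theta)\neq 0\}.$$ Let $J$ be any continuous $\omega$-compatible complex structure on the bundle $T(T^*\Sigma)|_M$ (such structures exist), with hermitian form $\langle u,v\rangle=\omega(Ju,v)+i\,\omega(u,v)$, and let $\delta : M\to U(1)$ be $\det^2$ of $r$ relative to $s$: $\delta(\theta)=\det(\langle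 l_i,s_j\rangle)^2$ for orthonormal bases $(l_i)$ of $r(\theta)$ and $(s_j)$ of $s(\theta)$. Let $F=f^{-1}(b)$ be a fibre that is invariant under the hamiltonian flow of $H$, let $\varphi|F$ be the restricted flow, and let $\Omega(\varphi|F)$ be its non-wandering set: the points $x\in F$ such that every neighbourhood $U$ of $x$ in $F$ satisfies $\varphi_t(U)\cap U\ne\emptyset$ for some $t>1$. Suppose that $$\mathfrak m_\zeta\cap \Omega(\varphi|F)\neq\emptyset .$$ Then $\mathfrak m_\zeta\cap F$ is a non-torsion codimension-1 cycle on $F$, in the following sense. There is a unique class $d\in H^1(M;\mathbb Z)$ (the primary difference of $r$ and $s$) whose value on every loop $\gamma$ in $M$ is the degree of $\delta\circ\gamma$. Its restriction $d|_F\in H^1(F;\mathbb Z)$, whose Poincaré dual is the class of the codimension-1 cycle $\mathfrak m_\zeta\cap F$, is carried by $\mathfrak m_\zeta\cap F$, i.e. it is represented by a singular cocycle that vanishes on all singular simplices in $F\setminus\mathfrak m_\zeta$, and $d|_F$ is not a torsion element of $H^1(F;\mathbb Z)$. -/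

import Mathlib

open Set Filter Topology Manifold
open scoped ContDiff

noncomputable section

/-! ### Singular cohomology in degree one with integer coefficients -/

/-- Singular `k`-simplices of `X`. -/
abbrev SingularSimplex (k : ℕ) (X : Type*) [TopologicalSpace X] : Type _ :=
  C(stdSimplex ℝ (Fin (k + 1)), X)

/-- The inclusion of the `i`-th face (opposite to the `i`-th vertex) of the standard simplex. -/
def faceInclusion (k : ℕ) (i : Fin (k + 2)) :
    C(stdSimplex ℝ (Fin (k + 1)), stdSimplex ℝ (Fin (k + 2))) :=
  ⟨stdSimplex.map i.succAbove, stdSimplex.continuous_map _⟩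

/-- The coboundary `(δ c)(σ) = ∑ i, (-1)^i c(∂_i σ)` of singular cochains. -/
def singularCoboundary (k : ℕ) (X : Type*) [TopologicalSpace X] :
    (SingularSimplex k X → ℤ) →+ (SingularSimplex (k + 1) X → ℤ) where
  toFun c σ := ∑ i : Fin (k + 2), (-1) ^ (i : ℕ) * c (σ.comp (faceInclusion k i))
  map_zero' := by funext σ; simp
  map_add' c c' := by
    funext σ
    simp [mul_add, Finset.sum_add_distrib]

/-- Singular `1`-cocycles. -/
abbrev SingularCocycle (X : Type*) [TopologicalSpace X] : AddSubgroup (SingularSimplex 1 X → ℤ) :=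
  (singularCoboundary 1 X).ker

/-- Singular `1`-coboundaries, as a subgroup of the group of `1`-cocycles. -/
abbrev SingularBoundary (X : Type*) [TopologicalSpace X] : AddSubgroup (SingularCocycle X) :=
  (singularCoboundary 0 X).range.addSubgroupOf (SingularCocycle X)

/-- The singular cohomology group `H¹(X; ℤ)`. -/
abbrev SingularH1 (X : Type*) [TopologicalSpace X] : Type _ :=
  SingularCocycle X ⧸ SingularBoundary X

/-- Pull-back of cochains. -/
def cochainPullback (k : ℕ) {X Y : Type*} [TopologicalSpace X] [TopologicalSpace Y] (g : C(X, Y)) :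
    (SingularSimplex k Y → ℤ) →+ (SingularSimplex k X → ℤ) where
  toFun c σ := c (g.comp σ)
  map_zero' := rfl
  map_add' _ _ := rfl

theorem singularCoboundary_cochainPullback (k : ℕ) {X Y : Type*} [TopologicalSpace X]
    [TopologicalSpace Y] (g : C(X, Y)) (c : SingularSimplex k Y → ℤ) :
    singularCoboundary k X (cochainPullback k g c)
      = cochainPullback (k + 1) g (singularCoboundary k Y c) := rfl

/-- Pull-back of `1`-cocycles. -/
def cocyclePullback {X Y : Type*} [TopologicalSpace X] [TopologicalSpace Y] (g : C(X, Y)) :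
    SingularCocycle Y →+ SingularCocycle X :=
  ((cochainPullback 1 g).comp (SingularCocycle Y).subtype).codRestrict (SingularCocycle X) (by
    rintro ⟨c, hc⟩
    rw [AddMonoidHom.mem_ker] at hc ⊢
    change singularCoboundary 1 X (cochainPullback 1 g c) = 0
    rw [singularCoboundary_cochainPullback, hc, map_zero])

/-- The homomorphism `g^* : H¹(Y; ℤ) → H¹(X; ℤ)` induced by a continuous map `g : X → Y`. -/
def SingularH1.pullback {X Y : Type*} [TopologicalSpace X] [TopologicalSpace Y] (g : C(X, Y)) :
    SingularH1 Y →+ SingularH1 X :=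
  QuotientAddGroup.map _ _ (cocyclePullback g) (by
    rintro ⟨c, hc⟩ ⟨b, hb⟩
    exact ⟨cochainPullback 0 g b, by
      rw [singularCoboundary_cochainPullback, hb]; rfl⟩)

/-- A singular `1`-simplex whose two end points agree, i.e. a loop. -/
def IsLoop {X : Type*} [TopologicalSpace X] (σ : SingularSimplex 1 X) : Prop :=
  σ (stdSimplex.vertex 0) = σ (stdSimplex.vertex 1)

/-- The class `d` takes the value `k` on the `1`-cycle given by the loop `σ` (the value does not
depend on the cocycle that represents `d`). -/
def SingularH1.HasValue {X : Type*} [TopologicalSpace X] (d : SingularH1 X)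
    (σ : SingularSimplex 1 X) (k : ℤ) : Prop :=
  ∃ c : SingularCocycle X, QuotientAddGroup.mk c = d ∧ (c : SingularSimplex 1 X → ℤ) σ = k

/-- The class `d ∈ H¹(X; ℤ)` is carried by `Z ⊆ X`: it has a representing cocycle that vanishes on
all singular simplices of `X ∖ Z`, i.e. it lies in the image of `H¹(X, X ∖ Z; ℤ) → H¹(X; ℤ)`. -/
def SingularH1.IsCarriedBy {X : Type*} [TopologicalSpace X] (d : SingularH1 X) (Z : Set X) :
    Prop :=
  ∃ c : SingularCocycle X, QuotientAddGroup.mk c = d ∧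
    ∀ σ : SingularSimplex 1 X, (∀ x, σ x ∉ Z) → (c : SingularSimplex 1 X → ℤ) σ = 0

/-- `u`, a function with values in the unit circle of `ℂ` along a closed curve, is continuous and
has degree `k`: it lifts to a continuous angle that increases by `k` full turns. -/
def HasDegree (u : stdSimplex ℝ (Fin 2) → ℂ) (k : ℤ) : Prop :=
  ∃ a : C(stdSimplex ℝ (Fin 2), ℝ),
    (∀ x, u x = Complex.exp (2 * Real.pi * (a x : ℂ) * Complex.I)) ∧
      a (stdSimplex.vertex 1) - a (stdSimplex.vertex 0) = k

/-! ### Non-wandering points -/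

/-- The non-wandering set of a flow: every neighbourhood `U` of the point satisfies
`φ_t(U) ∩ U ≠ ∅` for some `t > 1`. -/
def nonWanderingSet {X : Type*} [TopologicalSpace X] (φ : Flow ℝ X) : Set X :=
  {x | ∀ U ∈ 𝓝 x, ∃ t : ℝ, 1 < t ∧ ((φ t '' U) ∩ U).Nonempty}

/-! ### The cotangent bundle -/

/-- `ℝⁿ`. -/
abbrev Eucl (n : ℕ) : Type := EuclideanSpace ℝ (Fin n)

/-- The cotangent bundle `T^*Q` of an `n`-manifold `Q`. -/
abbrev CotangentBundle (n : ℕ) (Q : Type*) [TopologicalSpace Q] [ChartedSpace (Eucl n) Q] :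
    Type _ :=
  Bundle.TotalSpace (Eucl n →L[ℝ] ℝ)
    (fun x : Q => TangentSpace (𝓡 n) x →L[ℝ] Bundle.Trivial Q ℝ x)

/-- The model with corners of `T^*Q`. The preferred chart of `T^*Q` at `θ` consists of the
coordinates `x` of the preferred chart of `Q` at `π(θ)` and of the induced fibre coordinates `y`;
tangent vectors at `θ` are pairs `(ẋ, ẏ)` with respect to these coordinates. -/
abbrev cotangentModel (n : ℕ) :
    ModelWithCorners ℝ (Eucl n × (Eucl n →L[ℝ] ℝ)) (ModelProd (Eucl n) (Eucl n →L[ℝ] ℝ)) :=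
  (𝓡 n).prod 𝓘(ℝ, Eucl n →L[ℝ] ℝ)

section Cotangent

variable {n : ℕ} {Q : Type*} [TopologicalSpace Q] [ChartedSpace (Eucl n) Q]
  [IsManifold (𝓡 n) ∞ Q]

/-- The foot-point projection `π : T^*Q → Q`. -/
def footpoint (θ : CotangentBundle n Q) : Q := θ.proj

/-- The vertical subspace `ker d_θ π`. -/
def verticalSpace (θ : CotangentBundle n Q) : Submodule ℝ (TangentSpace (cotangentModel n) θ) :=
  (mfderiv (cotangentModel n) (𝓡 n) (footpoint (n := n) (Q := Q)) θ).ker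

/-- The canonical symplectic form `ω = ∑ dy_i ∧ dx^i`. -/
def canonicalForm {θ : CotangentBundle n Q} (u v : TangentSpace (cotangentModel n) θ) : ℝ :=
  let u' : Eucl n × (Eucl n →L[ℝ] ℝ) := u
  let v' : Eucl n × (Eucl n →L[ℝ] ℝ) := v
  u'.2 v'.1 - v'.2 u'.1

/-- The hamiltonian vector field `ẋ^i = ∂H/∂y_i`, `ẏ_i = -∂H/∂x^i`. -/
def hamiltonianVectorField (H : CotangentBundle n Q → ℝ) (θ : CotangentBundle n Q) :
    TangentSpace (cotangentModel n) θ :=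
  let dH : Eucl n × (Eucl n →L[ℝ] ℝ) →L[ℝ] ℝ := mfderiv (cotangentModel n) 𝓘(ℝ, ℝ) H θ
  let X : Eucl n × (Eucl n →L[ℝ] ℝ) :=
    (WithLp.toLp 2 fun i => dH (0, EuclideanSpace.proj i),
      -(dH.comp (ContinuousLinearMap.inl ℝ (Eucl n) (Eucl n →L[ℝ] ℝ))))
  X

/-- `H` is a convex hamiltonian: it is smooth and its restriction to every fibre of `T^*Q` has
positive definite Hessian. -/
def IsConvexHamiltonian (H : CotangentBundle n Q → ℝ) : Prop :=
  ContMDiff (cotangentModel n) 𝓘(ℝ, ℝ) ∞ H ∧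
    ∀ (x : Q) (p q : TangentSpace (𝓡 n) x →L[ℝ] Bundle.Trivial Q ℝ x), q ≠ 0 →
      0 < iteratedDeriv 2 (fun t : ℝ => H ⟨x, p + t • q⟩) 0

/-- Lagrangian subspaces of `T_θ(T^*Q)`. -/
def IsLagrangian {θ : CotangentBundle n Q} (L : Submodule ℝ (TangentSpace (cotangentModel n) θ)) :
    Prop :=
  Module.finrank ℝ L = n ∧ ∀ u ∈ L, ∀ v ∈ L, canonicalForm u v = 0

/-! ### Relative Maslov cocycle and cycle -/

/-- The hermitian form `g + i ω` with `g(u, v) = ω(J u, v)` that a compatible complex structure `J`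
determines; on `ℂⁿ = {x + i y}` it is `∑ u_i \bar v_i`. -/
def hermitianForm {θ : CotangentBundle n Q}
    (J : TangentSpace (cotangentModel n) θ →L[ℝ] TangentSpace (cotangentModel n) θ)
    (u v : TangentSpace (cotangentModel n) θ) : ℂ :=
  ⟨canonicalForm (J u) v, canonicalForm u v⟩

/-- The value of `det²` on the lagrangian subspace `L` relative to the lagrangian subspace `S`:
if `l` and `s` are orthonormal bases of `L` and `S` and `u` is the unitary map with `u s_j = l_j`,
then it is `(det u)² = det(⟨l_i, s_j⟩)²`. For arbitrary bases the determinant changes by a non-zero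
real factor, which the normalization removes. -/
def detSq {θ : CotangentBundle n Q}
    (J : TangentSpace (cotangentModel n) θ →L[ℝ] TangentSpace (cotangentModel n) θ)
    (L S : Submodule ℝ (TangentSpace (cotangentModel n) θ)) : ℂ :=
  open Classical in
  if h : Nonempty (Module.Basis (Fin n) ℝ L) ∧ Nonempty (Module.Basis (Fin n) ℝ S) then
    let D : ℂ := (Matrix.of fun i j : Fin n =>
      hermitianForm J (Classical.choice h.1 i : TangentSpace (cotangentModel n) θ)
        (Classical.choice h.2 j : TangentSpace (cotangentModel n) θ)).det
    D ^ 2 / (‖D‖ : ℂ) ^ 2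
  else 1

variable (m k : ℕ) {M : Type*} [TopologicalSpace M] [ChartedSpace (Eucl m) M]
  {B : Type*} [TopologicalSpace B] [ChartedSpace (Eucl k) B]

/-- `J` is a continuous complex structure on the symplectic vector bundle `T(T^*Q)|M`
that is compatible with the symplectic form (`M` is mapped to `T^*Q` by `ι`). -/
structure IsCompatibleComplexStructure (ι : M → CotangentBundle n Q)
    (J : ∀ z : M, TangentSpace (cotangentModel n) (ι z) →L[ℝ] TangentSpace (cotangentModel n) (ι z)) :
    Prop where
  continuous : Continuous fun z : M =>
    (⟨ι z, J z⟩ : Bundle.TotalSpace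
      ((Eucl n × (Eucl n →L[ℝ] ℝ)) →L[ℝ] (Eucl n × (Eucl n →L[ℝ] ℝ)))
      (fun θ : CotangentBundle n Q =>
        TangentSpace (cotangentModel n) θ →L[ℝ] TangentSpace (cotangentModel n) θ))
  sq : ∀ z u, J z (J z u) = -u
  symplectic : ∀ z u v, canonicalForm (J z u) (J z v) = canonicalForm u v
  positive : ∀ z u, u ≠ 0 → 0 < canonicalForm (J z u) u

/-- The section `r(z) = ker d_z f`, regarded as a subspace of `T(T^*Q)`: the tangent space at `z` to
the fibre of `f` through `z`. -/
def fibreSection (ι : M → CotangentBundle n Q) (f : M → B) (z : M) :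
    Submodule ℝ (TangentSpace (cotangentModel n) (ι z)) :=
  (mfderiv (𝓡 m) (𝓡 k) f z).ker.map
    (mfderiv (𝓡 m) (cotangentModel n) ι z : TangentSpace (𝓡 m) z →ₗ[ℝ] _)

/-- The relative Maslov cycle: the set of points of `M` where `ker df` and `ker dπ` have a
non-trivial intersection. -/
def relativeMaslovCycle (ι : M → CotangentBundle n Q) (f : M → B) : Set M :=
  {z | fibreSection m k ι f z ⊓ verticalSpace (ι z) ≠ ⊥}

/-- `d ∈ H¹(M; ℤ)` is the primary difference of `r = ker df` and the vertical section `s`: its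
value on every loop is the degree of `det²` of `r` relative to `s` along the loop. -/
def IsPrimaryDifference (ι : M → CotangentBundle n Q) (f : M → B)
    (J : ∀ z : M, TangentSpace (cotangentModel n) (ι z) →L[ℝ] TangentSpace (cotangentModel n) (ι z))
    (d : SingularH1 M) : Prop :=
  ∀ σ : SingularSimplex 1 M, IsLoop σ → ∃ j : ℤ, d.HasValue σ j ∧
    HasDegree (fun x => detSq (J (σ x)) (fibreSection m k ι f (σ x)) (verticalSpace (ι (σ x)))) j

/-- `M`, embedded by `ι` in `T^*Q`, is fibred by `f : M → B` into compact lagrangian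
submanifolds. -/
structure IsLagrangianFibration (ι : M → CotangentBundle n Q) (f : M → B) : Prop where
  embedding : IsSmoothEmbedding (𝓡 m) (cotangentModel n) ∞ ι
  submersion : IsSubmersion (𝓡 m) (𝓡 k) ∞ f
  surjective : Function.Surjective f
  compact : ∀ b, IsCompact (f ⁻¹' {b})
  lagrangian : ∀ z, IsLagrangian (fibreSection m k ι f z)

/-- `φ` is the restriction `φ|F` of the hamiltonian flow of `H` to the invariant fibre
`F = f⁻¹(b)`: a flow on `F` all of whose orbits are solution curves of the hamiltonian system. -/
def IsRestrictedHamiltonianFlow (H : CotangentBundle n Q → ℝ) (ι : M → CotangentBundle n Q)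
    (f : M → B) (b : B) (φ : Flow ℝ (f ⁻¹' {b} : Set M)) : Prop :=
  ∀ z : (f ⁻¹' {b} : Set M), IsMIntegralCurve (I := cotangentModel n)
    (fun t : ℝ => ι (φ t z : M)) (hamiltonianVectorField H)

end Cotangent

end

/-!
Write `δ : M → U(1)` for `det²` of `r = ker df` relative to the vertical section `s = ker dπ`.

*The class.* In symplectic coordinates a lagrangian subspace has a frame `(X | Y)`, compatible
complex structures are the points `Z` of the Siegel upper half space `Im Z > 0`, and `δ` is `det²`
of `Y - X Z`. Off the relative Maslov cycle `X` is invertible, so that up to a real factor this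
determinant is `det (Z - X⁻¹ Y)`, where `Z - X⁻¹ Y` lies again in the Siegel upper half space. As
that space is convex and `det` does not vanish on it, `δ` has off the cycle a canonical continuous
angle (`frameAngle`), and this angle does not depend on the coordinates (`lagAngle_eq`,
`maslovAngle`). For a path `σ` in `M`, the change of a continuous angle of `δ ∘ σ` minus the change
of `maslovAngle` is an integer, and these integers form a cocycle (`windingCocycle`). On loops it is
the degree of `δ`, and it vanishes on the paths that avoid the cycle. As classes in `H¹` are
determined by their values on loops (`SingularH1.ext_of_hasValue`), its class is the primary
difference, and it is carried by the cycle.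

*Orbits.* Let `a` be a continuous angle of `δ` along an orbit in the invariant fibre. Then `a -
maslovAngle` is integer valued, and locally constant off the cycle. In a chart of `T^*Q` and a chart
of `M` adapted to the fibres, the orbit carries a lagrangian frame `(X(t), Y(t))`, and
differentiating the identities `dH = 0` and `ω = 0` along the fibre shows that for `v X = 0` the
crossing form `(v X') · (v Y)` is the Hessian of `H` on the vertical vector `v Y`, which is positive
by convexity (`crossing_pos`). Hence crossings are isolated, and every crossing lowers `a -
maslovAngle` (`frameAngle_jump`, `orbit_jump`), whatever the dimension of the intersection is.

*Recurrence.* Let `θ` be a non-wandering point on the cycle. Shortly before `θ` its orbit is off the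
cycle, and the point reached there is again non-wandering. A nearby orbit loses at least one turn
while it passes `θ`, never regains it (`eventually_orbit_lt`), and comes back to a small ball of the
fibre off the cycle, in which it is closed up by an arc on which the cocycle vanishes. So the class
is negative on a loop in the fibre (`exists_windingCochain_lt`) and is not torsion.
-/

noncomputable section

/-! ### Angles and their continuous lifts -/

/-- The point of the unit circle of `ℂ` whose angle is `x` full turns. -/
def turn (x : ℝ) : ℂ := Complex.exp (2 * Real.pi * (x : ℂ) * Complex.I)

theorem turn_eq_circleExp (x : ℝ) : turn x = (Circle.exp (2 * Real.pi * x) : ℂ) := by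
  simp [turn, Circle.coe_exp]

theorem turn_zero : turn 0 = 1 := by simp [turn]

theorem turn_add (x y : ℝ) : turn (x + y) = turn x * turn y := by
  rw [turn, turn, turn, ← Complex.exp_add]
  congr 1
  push_cast
  ring

theorem turn_sub (x y : ℝ) : turn (x - y) = turn x / turn y := by
  rw [turn, turn, turn, ← Complex.exp_sub]
  congr 1
  push_cast
  ring

theorem turn_ne_zero (x : ℝ) : turn x ≠ 0 := Complex.exp_ne_zero _

theorem turn_eq_turn_iff {x y : ℝ} : turn x = turn y ↔ ∃ m : ℤ, x - y = m := by
  rw [turn_eq_circleExp, turn_eq_circleExp, Circle.coe_inj, Circle.exp_eq_exp]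
  refine exists_congr fun m => ?_
  constructor
  · intro h
    have h2 : 2 * Real.pi * (x - y - m) = 0 := by linarith
    rcases mul_eq_zero.1 h2 with h3 | h3
    · exact absurd h3 (by positivity)
    · linarith
  · intro h
    rw [show x = y + m by linarith]
    ring

theorem exists_turn_eq {w : ℂ} (hw : ‖w‖ = 1) : ∃ x, turn x = w := by
  obtain ⟨t, ht⟩ := Circle.exp_surjective (⟨w, by simpa [Submonoid.unitSphere] using hw⟩ : Circle)
  refine ⟨t / (2 * Real.pi), ?_⟩
  rw [turn_eq_circleExp, mul_div_cancel₀ _ (by positivity), ht]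

/-- Continuous angles are unique up to a constant: fibres of `turn` are discrete. -/
theorem eq_of_turn_eq_const {X : Type*} [TopologicalSpace X] [PreconnectedSpace X] {c : X → ℝ}
    (hc : Continuous c) {w : ℂ} (hw : ∀ x, turn (c x) = w) (x y : X) : c x = c y := by
  have hint : ∀ z, ∃ m : ℤ, c z - c x = m := fun z =>
    turn_eq_turn_iff.1 ((hw z).trans (hw x).symm)
  choose m hm using hint
  have hmc : Continuous m := by
    rw [Int.isClosedEmbedding_coe_real.isEmbedding.continuous_iff]
    refine Continuous.congr (f := fun z => c z - c x) (by fun_prop) hm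
  have h : m x = m y := PreconnectedSpace.constant (Y := ℤ) ‹_› hmc
  have h1 := hm x
  have h2 := hm y
  rw [← h, ← h1] at h2
  linarith

/-- Two continuous angles of the same function differ by a constant. -/
theorem sub_eq_sub_of_turn_eq {X : Type*} [TopologicalSpace X] [PreconnectedSpace X] {a b : X → ℝ}
    (ha : Continuous a) (hb : Continuous b) (h : ∀ x, turn (a x) = turn (b x)) (x y : X) :
    a x - b x = a y - b y :=
  eq_of_turn_eq_const (c := fun x => a x - b x) (ha.sub hb) (w := 1)
    (fun z => by rw [turn_sub, h, div_self (turn_ne_zero _)]) x y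

/-- Angles lift along homotopies. -/
theorem exists_angle_homotopy {A : Type*} [TopologicalSpace A] {u : unitInterval × A → ℂ}
    (hu : Continuous u) (hu1 : ∀ p, ‖u p‖ = 1) {a₀ : A → ℝ} (ha₀ : Continuous a₀)
    (h₀ : ∀ x, turn (a₀ x) = u (0, x)) :
    ∃ a : unitInterval × A → ℝ, Continuous a ∧ (∀ x, a (0, x) = a₀ x) ∧ ∀ p, turn (a p) = u p := by
  have hmem : ∀ p, u p ∈ Submonoid.unitSphere ℂ := fun p => mem_sphere_zero_iff_norm.2 (hu1 p)
  let U : C(unitInterval × A, Circle) := ⟨fun p => ⟨u p, hmem p⟩, hu.subtype_mk hmem⟩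
  let f : C(A, ℝ) := ⟨fun x => 2 * Real.pi * a₀ x, continuous_const.mul ha₀⟩
  have H0 : ∀ x, U (0, x) = Circle.exp (f x) := fun x => by
    apply Circle.ext
    exact (h₀ x).symm.trans (turn_eq_circleExp _)
  refine ⟨fun p => Circle.isCoveringMap_exp.liftHomotopy U f H0 p / (2 * Real.pi), by fun_prop,
    fun x => ?_, fun p => ?_⟩
  · simp only [IsCoveringMap.liftHomotopy_zero]
    exact mul_div_cancel_left₀ _ (by positivity)
  · rw [turn_eq_circleExp, mul_div_cancel₀ _ (by positivity)]
    exact congrArg Subtype.val (congrFun (Circle.isCoveringMap_exp.liftHomotopy_lifts U f H0) p)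

/-- Circle-valued functions on convex sets have continuous angles. -/
theorem exists_angle_of_convex {E : Type*} [AddCommGroup E] [Module ℝ E] [TopologicalSpace E]
    [ContinuousAdd E] [ContinuousSMul ℝ E] {S : Set E} (hS : Convex ℝ S) {u : S → ℂ}
    (hu : Continuous u) (hu1 : ∀ x, ‖u x‖ = 1) (x₀ : S) {r : ℝ} (hr : turn r = u x₀) :
    ∃ a : S → ℝ, Continuous a ∧ a x₀ = r ∧ ∀ x, turn (a x) = u x := by
  have hmem : ∀ p : unitInterval × S, (1 - (p.1 : ℝ)) • (x₀ : E) + (p.1 : ℝ) • (p.2 : E) ∈ S :=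
    fun p => hS x₀.2 p.2.2 (by linarith [p.1.2.2]) p.1.2.1 (by ring)
  let c : unitInterval × S → S := fun p => ⟨_, hmem p⟩
  have hc : Continuous c := Continuous.subtype_mk (by fun_prop) _
  have hc0 : ∀ x, c (0, x) = x₀ := fun x => Subtype.ext (by simp [c])
  have hc1 : ∀ x, c (1, x) = x := fun x => Subtype.ext (by simp [c])
  obtain ⟨a, ha, ha0, hau⟩ := exists_angle_homotopy (u := u ∘ c) (hu.comp hc) (fun p => hu1 _)
    (a₀ := fun _ => r) continuous_const (fun x => by simp [hc0, hr])
  refine ⟨fun x => a (1, x), by fun_prop, ?_, fun x => by simp [hau, hc1]⟩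
  -- along the constant path at `x₀` the angle does not change
  have h := eq_of_turn_eq_const (c := fun t : unitInterval => a (t, x₀)) (by fun_prop) (w := u x₀)
    (fun t => by
      have : c (t, x₀) = x₀ := Subtype.ext (by
        simp only [c, ← add_smul, sub_add_cancel, one_smul])
      simp [hau, this]) 1 0
  exact h.trans (ha0 x₀)

/-! ### Cocycles evaluated on paths and loops -/

theorem faceInclusion_one_apply (i : Fin 3) (s : stdSimplex ℝ (Fin 2)) (j : Fin 3) :
    faceInclusion 1 i s j = (if i.succAbove (0 : Fin 2) = j then s 0 else 0)
      + (if i.succAbove (1 : Fin 2) = j then s 1 else 0) := by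
  change FunOnFinite.linearMap ℝ ℝ i.succAbove s j = _
  rw [FunOnFinite.linearMap_apply_apply, Finset.sum_filter, Fin.sum_univ_two]

theorem faceInclusion_one_zero (s : stdSimplex ℝ (Fin 2)) :
    faceInclusion 1 0 s 1 = s 0 ∧ faceInclusion 1 0 s 2 = s 1 := by
  rw [faceInclusion_one_apply, faceInclusion_one_apply, if_pos (by decide), if_neg (by decide),
    if_neg (by decide), if_pos (by decide), add_zero, zero_add]
  exact ⟨rfl, rfl⟩

theorem faceInclusion_one_one (s : stdSimplex ℝ (Fin 2)) :
    faceInclusion 1 1 s 1 = 0 ∧ faceInclusion 1 1 s 2 = s 1 := by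
  rw [faceInclusion_one_apply, faceInclusion_one_apply, if_neg (by decide), if_neg (by decide),
    if_neg (by decide), if_pos (by decide), zero_add, zero_add]
  exact ⟨rfl, rfl⟩

theorem faceInclusion_one_two (s : stdSimplex ℝ (Fin 2)) :
    faceInclusion 1 2 s 1 = s 1 ∧ faceInclusion 1 2 s 2 = 0 := by
  rw [faceInclusion_one_apply, faceInclusion_one_apply, if_neg (by decide), if_pos (by decide),
    if_neg (by decide), if_neg (by decide), zero_add, zero_add]
  exact ⟨rfl, rfl⟩

theorem singularCoboundary_one_apply {X : Type*} [TopologicalSpace X] (c : SingularSimplex 1 X → ℤ)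
    (τ : SingularSimplex 2 X) :
    singularCoboundary 1 X c τ = c (τ.comp (faceInclusion 1 0)) - c (τ.comp (faceInclusion 1 1))
      + c (τ.comp (faceInclusion 1 2)) := by
  simp [singularCoboundary, Fin.sum_univ_three]
  ring

/-- The `0`-simplex at a point. -/
def pointSimplex {X : Type*} [TopologicalSpace X] (x : X) : SingularSimplex 0 X :=
  ContinuousMap.const _ x

theorem singularCoboundary_zero_apply {X : Type*} [TopologicalSpace X]
    (b : SingularSimplex 0 X → ℤ) (σ : SingularSimplex 1 X) :
    singularCoboundary 0 X b σ = b (pointSimplex (σ (stdSimplex.vertex 1)))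
      - b (pointSimplex (σ (stdSimplex.vertex 0))) := by
  have h : ∀ i : Fin 2, σ.comp (faceInclusion 0 i)
      = pointSimplex (σ (stdSimplex.vertex (i.succAbove 0))) := by
    intro i
    ext x
    obtain rfl : x = stdSimplex.vertex 0 := Subsingleton.elim _ _
    simp [pointSimplex, faceInclusion]
  simp [singularCoboundary, h, Fin.sum_univ_two]
  ring

/-- The path `[0, 1] → Δ¹`, extended to be constant outside `[0, 1]`. -/
def edgePoint (t : ℝ) : stdSimplex ℝ (Fin 2) :=
  stdSimplexHomeomorphUnitInterval.symm (projIcc 0 1 zero_le_one t)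

theorem continuous_edgePoint : Continuous edgePoint :=
  stdSimplexHomeomorphUnitInterval.symm.continuous.comp continuous_projIcc

theorem edgePoint_apply_one (s : stdSimplex ℝ (Fin 2)) : edgePoint (s 1) = s := by
  rw [edgePoint, Homeomorph.symm_apply_eq]
  exact projIcc_of_mem zero_le_one (x := s 1) ⟨s.2.1 1, stdSimplex.le_one s 1⟩

theorem edgePoint_of_le_zero {t : ℝ} (ht : t ≤ 0) : edgePoint t = stdSimplex.vertex 0 := by
  rw [edgePoint, projIcc_of_le_left _ ht, Homeomorph.symm_apply_eq]
  exact stdSimplexHomeomorphUnitInterval_zero.symm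

theorem edgePoint_of_one_le {t : ℝ} (ht : 1 ≤ t) : edgePoint t = stdSimplex.vertex 1 := by
  rw [edgePoint, projIcc_of_right_le _ ht, Homeomorph.symm_apply_eq]
  exact stdSimplexHomeomorphUnitInterval_one.symm

section Concat

variable {X : Type*} [TopologicalSpace X]

/-- Cocycles are additive under concatenation of paths. -/
theorem exists_concat (σ₁ σ₂ : SingularSimplex 1 X)
    (h : σ₁ (stdSimplex.vertex 1) = σ₂ (stdSimplex.vertex 0)) :
    ∃ σ : SingularSimplex 1 X, σ (stdSimplex.vertex 0) = σ₁ (stdSimplex.vertex 0) ∧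
      σ (stdSimplex.vertex 1) = σ₂ (stdSimplex.vertex 1) ∧
      ∀ c : SingularCocycle X, (c : SingularSimplex 1 X → ℤ) σ
        = (c : SingularSimplex 1 X → ℤ) σ₁ + (c : SingularSimplex 1 X → ℤ) σ₂ := by
  let q : ℝ → X := fun t => if t ≤ 1 / 2 then σ₁ (edgePoint (2 * t)) else σ₂ (edgePoint (2 * t - 1))
  have hq : Continuous q := by
    refine Continuous.if_le ?_ ?_ continuous_id continuous_const fun t ht => ?_
    · exact σ₁.continuous.comp (continuous_edgePoint.comp (by fun_prop))
    · exact σ₂.continuous.comp (continuous_edgePoint.comp (by fun_prop))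
    · subst ht
      rw [edgePoint_of_one_le (by norm_num), edgePoint_of_le_zero (by norm_num), h]
  let τ : SingularSimplex 2 X := ⟨fun s => q (s.1 1 / 2 + s.1 2), hq.comp (by
    have h1 : Continuous fun s : stdSimplex ℝ (Fin 3) => s.1 1 :=
      (continuous_apply 1).comp continuous_subtype_val
    have h2 : Continuous fun s : stdSimplex ℝ (Fin 3) => s.1 2 :=
      (continuous_apply 2).comp continuous_subtype_val
    exact (h1.div_const 2).add h2)⟩
  have hτ : ∀ s, τ s = q (s 1 / 2 + s 2) := fun s => rfl
  have e2 : τ.comp (faceInclusion 1 2) = σ₁ := by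
    ext s
    obtain ⟨h1, h2⟩ := faceInclusion_one_two s
    have hle : s 1 / 2 + 0 ≤ 1 / 2 := by linarith [stdSimplex.le_one s 1]
    rw [ContinuousMap.comp_apply, hτ, h1, h2]
    simp only [q, if_pos hle]
    rw [show 2 * (s 1 / 2 + 0) = s 1 by ring, edgePoint_apply_one]
  have e0 : τ.comp (faceInclusion 1 0) = σ₂ := by
    ext s
    obtain ⟨h1, h2⟩ := faceInclusion_one_zero s
    have hadd := stdSimplex.add_eq_one s
    rw [ContinuousMap.comp_apply, hτ, h1, h2]
    rcases (stdSimplex.zero_le s 1).eq_or_lt with h0 | h0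
    · have hs : s = stdSimplex.vertex 0 := by
        rw [← edgePoint_apply_one s, edgePoint_of_le_zero h0.symm.le]
      have ht : s 0 / 2 + s 1 = 1 / 2 := by linarith
      rw [ht]
      simp only [q, le_refl, if_true]
      rw [edgePoint_of_one_le (by norm_num), h, hs]
    · have hle : ¬ (s 0 / 2 + s 1 ≤ 1 / 2) := by linarith
      simp only [q, if_neg hle]
      rw [show 2 * (s 0 / 2 + s 1) - 1 = s 1 by linarith, edgePoint_apply_one]
  refine ⟨τ.comp (faceInclusion 1 1), ?_, ?_, fun c => ?_⟩
  · obtain ⟨h1, h2⟩ := faceInclusion_one_one (stdSimplex.vertex 0)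
    rw [ContinuousMap.comp_apply, hτ, h1, h2]
    simp [q, edgePoint_of_le_zero]
  · obtain ⟨h1, h2⟩ := faceInclusion_one_one (stdSimplex.vertex 1)
    rw [ContinuousMap.comp_apply, hτ, h1, h2]
    norm_num [q, edgePoint_of_one_le]
  · have hc : singularCoboundary 1 X c τ = 0 := congrFun (AddMonoidHom.mem_ker.1 c.2) τ
    rw [singularCoboundary_one_apply, e0, e2] at hc
    linarith

/-- The reversed path. -/
theorem exists_reverse (σ : SingularSimplex 1 X) :
    ∃ σ' : SingularSimplex 1 X, σ' (stdSimplex.vertex 0) = σ (stdSimplex.vertex 1) ∧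
      σ' (stdSimplex.vertex 1) = σ (stdSimplex.vertex 0) :=
  ⟨σ.comp ⟨stdSimplex.map (Equiv.swap 0 1), stdSimplex.continuous_map _⟩, by simp, by simp⟩

/-- A cocycle that vanishes on loops takes the same value on paths with the same end points. -/
theorem singularCocycle_eq_of_vanish_on_loops (c : SingularCocycle X)
    (hc : ∀ σ, IsLoop σ → (c : SingularSimplex 1 X → ℤ) σ = 0) {σ τ : SingularSimplex 1 X}
    (h0 : σ (stdSimplex.vertex 0) = τ (stdSimplex.vertex 0))
    (h1 : σ (stdSimplex.vertex 1) = τ (stdSimplex.vertex 1)) :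
    (c : SingularSimplex 1 X → ℤ) σ = (c : SingularSimplex 1 X → ℤ) τ := by
  obtain ⟨τ', h0', h1'⟩ := exists_reverse τ
  obtain ⟨ρ, hρ0, hρ1, hρ⟩ := exists_concat σ τ' (h1.trans h0'.symm)
  obtain ⟨ν, hν0, hν1, hν⟩ := exists_concat τ τ' h0'.symm
  have e1 := hc ρ (by rw [IsLoop, hρ0, hρ1, h1', h0])
  have e2 := hc ν (by rw [IsLoop, hν0, hν1, h1'])
  rw [hρ] at e1
  rw [hν] at e2
  linarith

/-- A cocycle that vanishes on loops is a coboundary: integrate it along paths from a base point in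
each path component. -/
theorem mem_singularBoundary_of_vanish_on_loops (c : SingularCocycle X)
    (hc : ∀ σ, IsLoop σ → (c : SingularSimplex 1 X → ℤ) σ = 0) : c ∈ SingularBoundary X := by
  classical
  let Conn : X → X → Prop := fun x y => ∃ σ : SingularSimplex 1 X,
    σ (stdSimplex.vertex 0) = x ∧ σ (stdSimplex.vertex 1) = y
  have hsymm : ∀ {x y}, Conn x y → Conn y x := by
    rintro x y ⟨σ, rfl, rfl⟩
    exact (exists_reverse σ)
  have htrans : ∀ {x y z}, Conn x y → Conn y z → Conn x z := by
    rintro x y z ⟨σ, rfl, rfl⟩ ⟨τ, h, rfl⟩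
    obtain ⟨ρ, h0, h1, -⟩ := exists_concat σ τ h.symm
    exact ⟨ρ, h0, h1⟩
  let R : Setoid X := ⟨Conn, fun x => ⟨ContinuousMap.const _ x, rfl, rfl⟩, hsymm, htrans⟩
  let base : X → X := fun x => (Quotient.mk R x).out
  have hbase : ∀ x, Conn (base x) x := fun x => Quotient.exact (s := R) (Quotient.out_eq _)
  choose p hp0 hp1 using hbase
  refine ⟨fun x => (c : SingularSimplex 1 X → ℤ) (p (x (stdSimplex.vertex 0))), ?_⟩
  funext σ
  rw [singularCoboundary_zero_apply]
  simp only [pointSimplex, ContinuousMap.const_apply]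
  obtain ⟨ρ, hρ0, hρ1, hρ⟩ := exists_concat (p (σ (stdSimplex.vertex 0))) σ (hp1 _)
  have hb : base (σ (stdSimplex.vertex 0)) = base (σ (stdSimplex.vertex 1)) :=
    congrArg Quotient.out (Quotient.sound (s := R) ⟨σ, rfl, rfl⟩)
  have h := singularCocycle_eq_of_vanish_on_loops c hc (σ := ρ) (τ := p (σ (stdSimplex.vertex 1)))
    (by rw [hρ0, hp0, hp0, hb]) (by rw [hρ1, hp1])
  rw [hρ c] at h
  change _ = (c : SingularSimplex 1 X → ℤ) σ
  linarith

/-- Coboundaries vanish on loops. -/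
theorem singularBoundary_apply_loop {c : SingularCocycle X} (hc : c ∈ SingularBoundary X)
    {σ : SingularSimplex 1 X} (hσ : IsLoop σ) : (c : SingularSimplex 1 X → ℤ) σ = 0 := by
  obtain ⟨b, hb⟩ := hc
  have h := congrFun hb σ
  rw [singularCoboundary_zero_apply, hσ, sub_self] at h
  exact h.symm

theorem SingularH1.HasValue.unique {d : SingularH1 X} {σ : SingularSimplex 1 X} (hσ : IsLoop σ)
    {i j : ℤ} (hi : d.HasValue σ i) (hj : d.HasValue σ j) : i = j := by
  obtain ⟨c, hc, rfl⟩ := hi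
  obtain ⟨c', hc', rfl⟩ := hj
  have h := singularBoundary_apply_loop (QuotientAddGroup.eq.1 (hc.trans hc'.symm)) hσ
  simp only [AddSubgroup.coe_add, AddSubgroup.coe_neg, Pi.add_apply, Pi.neg_apply] at h
  linarith

/-- Classes in `H¹` are determined by their values on loops. -/
theorem SingularH1.ext_of_hasValue {d d' : SingularH1 X}
    (h : ∀ σ, IsLoop σ → ∃ j, d.HasValue σ j ∧ d'.HasValue σ j) : d' = d := by
  obtain ⟨c, rfl⟩ := QuotientAddGroup.mk_surjective d
  obtain ⟨c', rfl⟩ := QuotientAddGroup.mk_surjective d'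
  refine QuotientAddGroup.eq.2 (mem_singularBoundary_of_vanish_on_loops _ fun σ hσ => ?_)
  obtain ⟨j, h1, h2⟩ := h σ hσ
  have e1 := h1.unique hσ ⟨c, rfl, rfl⟩
  have e2 := h2.unique hσ ⟨c', rfl, rfl⟩
  simp only [AddSubgroup.coe_add, AddSubgroup.coe_neg, Pi.add_apply, Pi.neg_apply]
  linarith

/-- A class is not torsion if it does not vanish on some closed curve made of two arcs. -/
theorem SingularH1.not_isOfFinAddOrder (c : SingularCocycle X) {σ₁ σ₂ : SingularSimplex 1 X}
    (h1 : σ₁ (stdSimplex.vertex 1) = σ₂ (stdSimplex.vertex 0))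
    (h2 : σ₂ (stdSimplex.vertex 1) = σ₁ (stdSimplex.vertex 0))
    (h : (c : SingularSimplex 1 X → ℤ) σ₁ + (c : SingularSimplex 1 X → ℤ) σ₂ ≠ 0) :
    ¬ IsOfFinAddOrder (QuotientAddGroup.mk c : SingularH1 X) := by
  rw [isOfFinAddOrder_iff_nsmul_eq_zero]
  rintro ⟨N, hN, h0⟩
  obtain ⟨σ, hσ0, hσ1, hσ⟩ := exists_concat σ₁ σ₂ h1
  have hloop : IsLoop σ := by rw [IsLoop, hσ0, hσ1, h2]
  have hmem : N • c ∈ SingularBoundary X := (QuotientAddGroup.eq_zero_iff _).1 h0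
  have h3 := singularBoundary_apply_loop hmem hloop
  rw [hσ] at h3
  have : ((N • c : SingularCocycle X) : SingularSimplex 1 X → ℤ) σ₁
      + ((N • c : SingularCocycle X) : SingularSimplex 1 X → ℤ) σ₂
      = N * ((c : SingularSimplex 1 X → ℤ) σ₁ + (c : SingularSimplex 1 X → ℤ) σ₂) := by
    simp [mul_add]
  rw [this] at h3
  rcases mul_eq_zero.1 h3 with h4 | h4
  · exact hN.ne' (by exact_mod_cast h4)
  · exact h h4

theorem HasDegree.unique {u : stdSimplex ℝ (Fin 2) → ℂ} {i j : ℤ} (hi : HasDegree u i)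
    (hj : HasDegree u j) : i = j := by
  obtain ⟨a, ha, hai⟩ := hi
  obtain ⟨b, hb, hbj⟩ := hj
  have : PreconnectedSpace (stdSimplex ℝ (Fin 2)) :=
    Subtype.preconnectedSpace (convex_stdSimplex ℝ (Fin 2)).isPreconnected
  have h := sub_eq_sub_of_turn_eq a.continuous b.continuous (fun x => (ha x).symm.trans (hb x))
    (stdSimplex.vertex 1) (stdSimplex.vertex 0)
  have : (i : ℝ) = j := by linarith
  exact_mod_cast this

end Concat

/-! ### The degree cocycle of a circle-valued function -/

section Winding

variable {X : Type*} [TopologicalSpace X]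

instance (k : ℕ) : PreconnectedSpace (stdSimplex ℝ (Fin k)) :=
  Subtype.preconnectedSpace (convex_stdSimplex ℝ (Fin k)).isPreconnected

theorem exists_angle_simplex {u : X → ℂ} (hu : Continuous u) (hu1 : ∀ x, ‖u x‖ = 1) {k : ℕ}
    (σ : SingularSimplex k X) :
    ∃ a : stdSimplex ℝ (Fin (k + 1)) → ℝ, Continuous a ∧ ∀ x, turn (a x) = u (σ x) := by
  obtain ⟨r, hr⟩ := exists_turn_eq (hu1 (σ (stdSimplex.vertex 0)))
  obtain ⟨a, ha, -, hau⟩ := exists_angle_of_convex (convex_stdSimplex ℝ (Fin (k + 1)))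
    (u := fun x => u (σ x)) (by fun_prop) (fun x => hu1 _) (stdSimplex.vertex 0) hr
  exact ⟨a, ha, hau⟩

/-- The change of a continuous angle of `u` along a path, minus the change of the (possibly
discontinuous) angle `α`: an integer that counts the jumps of `α`. -/
def windingCochain (u : X → ℂ) (α : X → ℝ) (σ : SingularSimplex 1 X) : ℤ :=
  open Classical in
  if h : ∃ a : stdSimplex ℝ (Fin 2) → ℝ, Continuous a ∧ ∀ x, turn (a x) = u (σ x) then
    round ((h.choose (stdSimplex.vertex 1) - h.choose (stdSimplex.vertex 0))
      - (α (σ (stdSimplex.vertex 1)) - α (σ (stdSimplex.vertex 0))))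
  else 0

theorem windingCochain_eq {u : X → ℂ} {α : X → ℝ} (hα : ∀ x, turn (α x) = u x)
    {σ : SingularSimplex 1 X} {a : stdSimplex ℝ (Fin 2) → ℝ} (ha : Continuous a)
    (hau : ∀ x, turn (a x) = u (σ x)) :
    (windingCochain u α σ : ℝ) = (a (stdSimplex.vertex 1) - a (stdSimplex.vertex 0))
      - (α (σ (stdSimplex.vertex 1)) - α (σ (stdSimplex.vertex 0))) := by
  have h : ∃ a : stdSimplex ℝ (Fin 2) → ℝ, Continuous a ∧ ∀ x, turn (a x) = u (σ x) := ⟨a, ha, hau⟩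
  have e := sub_eq_sub_of_turn_eq h.choose_spec.1 ha
    (fun x => (h.choose_spec.2 x).trans (hau x).symm) (stdSimplex.vertex 1) (stdSimplex.vertex 0)
  obtain ⟨i, hi⟩ := turn_eq_turn_iff.1 ((hau (stdSimplex.vertex 1)).trans (hα _).symm)
  obtain ⟨j, hj⟩ := turn_eq_turn_iff.1 ((hau (stdSimplex.vertex 0)).trans (hα _).symm)
  have e2 : (h.choose (stdSimplex.vertex 1) - h.choose (stdSimplex.vertex 0))
      - (α (σ (stdSimplex.vertex 1)) - α (σ (stdSimplex.vertex 0))) = ((i - j : ℤ) : ℝ) := by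
    push_cast
    linarith
  rw [windingCochain, dif_pos h, e2, round_intCast]
  push_cast
  linarith

variable {u : X → ℂ} (hu : Continuous u) (hu1 : ∀ x, ‖u x‖ = 1) {α : X → ℝ}
  (hα : ∀ x, turn (α x) = u x)

/-- The winding cochain is closed, since continuous angles exist along `2`-simplices. -/
def windingCocycle : SingularCocycle X :=
  ⟨windingCochain u α, by
    rw [AddMonoidHom.mem_ker]
    funext τ
    obtain ⟨a, ha, hau⟩ := exists_angle_simplex hu hu1 τ
    have h : ∀ i, (windingCochain u α (τ.comp (faceInclusion 1 i)) : ℝ) = _ := fun i =>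
      windingCochain_eq hα (σ := τ.comp (faceInclusion 1 i)) (a := a ∘ faceInclusion 1 i)
        (by fun_prop) (fun x => hau _)
    rw [singularCoboundary_one_apply]
    have : ((windingCochain u α (τ.comp (faceInclusion 1 0))
        - windingCochain u α (τ.comp (faceInclusion 1 1))
        + windingCochain u α (τ.comp (faceInclusion 1 2)) : ℤ) : ℝ) = 0 := by
      push_cast
      rw [h, h, h]
      simp only [faceInclusion, Function.comp_apply, ContinuousMap.comp_apply,
        ContinuousMap.coe_mk, stdSimplex.map_vertex]
      have e00 : (0 : Fin 3).succAbove (0 : Fin 2) = 1 := rfl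
      have e01 : (0 : Fin 3).succAbove (1 : Fin 2) = 2 := rfl
      have e10 : (1 : Fin 3).succAbove (0 : Fin 2) = 0 := rfl
      have e11 : (1 : Fin 3).succAbove (1 : Fin 2) = 2 := rfl
      have e20 : (2 : Fin 3).succAbove (0 : Fin 2) = 0 := rfl
      have e21 : (2 : Fin 3).succAbove (1 : Fin 2) = 1 := rfl
      rw [e00, e01, e10, e11, e20, e21]
      ring
    exact_mod_cast this⟩

/-- On loops the winding cocycle is the degree. -/
theorem hasDegree_windingCochain {σ : SingularSimplex 1 X} (hσ : IsLoop σ) (hu : Continuous u)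
    (hu1 : ∀ x, ‖u x‖ = 1) (hα : ∀ x, turn (α x) = u x) :
    HasDegree (fun x => u (σ x)) (windingCochain u α σ) := by
  obtain ⟨a, ha, hau⟩ := exists_angle_simplex hu hu1 σ
  refine ⟨⟨a, ha⟩, fun x => (hau x).symm, ?_⟩
  rw [windingCochain_eq hα ha hau, hσ, sub_self, sub_zero]
  rfl

/-- The winding cochain vanishes on paths along which `α` is continuous. -/
theorem windingCochain_eq_zero (hα : ∀ x, turn (α x) = u x) {Z : Set X} (hZ : ContinuousOn α Zᶜ)
    {σ : SingularSimplex 1 X} (hσ : ∀ x, σ x ∉ Z) : windingCochain u α σ = 0 := by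
  have h := windingCochain_eq hα (σ := σ) (a := fun x => α (σ x))
    (hZ.comp_continuous σ.continuous hσ) (fun x => hα _)
  rw [sub_self] at h
  exact_mod_cast h

end Winding

/-! ### The angle of `det²` on the Siegel upper half space -/

/-- The square of the phase of a complex number. -/
def phaseSq (D : ℂ) : ℂ := D ^ 2 / (‖D‖ : ℂ) ^ 2

theorem phaseSq_mul (D D' : ℂ) : phaseSq (D * D') = phaseSq D * phaseSq D' := by
  simp only [phaseSq, norm_mul, Complex.ofReal_mul]
  rw [mul_pow, mul_pow, mul_div_mul_comm]

theorem phaseSq_ofReal {r : ℝ} (hr : r ≠ 0) : phaseSq (r : ℂ) = 1 := by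
  rw [phaseSq, Complex.norm_real, ← Complex.ofReal_pow, ← Complex.ofReal_pow, Real.norm_eq_abs,
    sq_abs, div_self]
  exact_mod_cast pow_ne_zero 2 hr

theorem norm_phaseSq {D : ℂ} (hD : D ≠ 0) : ‖phaseSq D‖ = 1 := by
  have : ‖D‖ ≠ 0 := norm_ne_zero_iff.2 hD
  rw [phaseSq, norm_div, norm_pow, norm_pow, Complex.norm_real, norm_norm, div_self]
  positivity

theorem ContinuousAt.phaseSq {X : Type*} [TopologicalSpace X] {D : X → ℂ} {x : X}
    (hD : ContinuousAt D x) (h : D x ≠ 0) : ContinuousAt (fun y => phaseSq (D y)) x := by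
  have : (‖D x‖ : ℂ) ^ 2 ≠ 0 := by simpa using h
  unfold _root_.phaseSq
  exact (hD.pow 2).div ((Complex.continuous_ofReal.continuousAt.comp hD.norm).pow 2) this

theorem Continuous.phaseSq {X : Type*} [TopologicalSpace X] {D : X → ℂ}
    (hD : Continuous D) (h : ∀ x, D x ≠ 0) : Continuous (fun y => phaseSq (D y)) :=
  continuous_iff_continuousAt.2 fun x => hD.continuousAt.phaseSq (h x)

theorem phaseSq_I_pow (n : ℕ) : phaseSq (Complex.I ^ n) = turn (n / 2) := by
  have h1 : turn (1 / 2) = -1 := by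
    rw [turn, ← Complex.exp_pi_mul_I]
    congr 1
    push_cast
    ring
  induction n with
  | zero => simp [phaseSq, turn_zero]
  | succ n ih =>
    rw [pow_succ, phaseSq_mul, ih,
      show ((n + 1 : ℕ) : ℝ) / 2 = (n : ℝ) / 2 + 1 / 2 by push_cast; ring, turn_add, h1]
    congr 1
    simp [phaseSq]

section Siegel

variable {n : ℕ}

theorem isSymm_of_posDef {B : Matrix (Fin n) (Fin n) ℝ} (hB : B.PosDef) : B.IsSymm := by
  have h := hB.isHermitian
  rwa [Matrix.IsHermitian, Matrix.conjTranspose_eq_transpose_of_trivial] at h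

/-- The complex matrix with real part `A` and imaginary part `B`. -/
def complexMat (A B : Matrix (Fin n) (Fin n) ℝ) : Matrix (Fin n) (Fin n) ℂ :=
  A.map Complex.ofReal + Complex.I • B.map Complex.ofReal

theorem complexMat_apply (A B : Matrix (Fin n) (Fin n) ℝ) (i j : Fin n) :
    complexMat A B i j = ⟨A i j, B i j⟩ := by
  apply Complex.ext <;> simp [complexMat]

theorem continuous_complexMat {X : Type*} [TopologicalSpace X]
    {A B : X → Matrix (Fin n) (Fin n) ℝ} (hA : Continuous A) (hB : Continuous B) :
    Continuous fun x => complexMat (A x) (B x) := by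
  have hA' := hA.matrix_map Complex.continuous_ofReal
  have hB' := hB.matrix_map Complex.continuous_ofReal
  unfold complexMat
  fun_prop

theorem map_ofReal_mul (A B : Matrix (Fin n) (Fin n) ℝ) :
    (A * B).map Complex.ofReal = A.map Complex.ofReal * B.map Complex.ofReal :=
  Matrix.map_mul (f := Complex.ofRealHom)

theorem map_ofReal_one : (1 : Matrix (Fin n) (Fin n) ℝ).map Complex.ofReal = 1 :=
  Matrix.map_one _ Complex.ofReal_zero Complex.ofReal_one

theorem det_map_ofReal (A : Matrix (Fin n) (Fin n) ℝ) :
    (A.map Complex.ofReal).det = (A.det : ℂ) :=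
  (RingHom.map_det Complex.ofRealHom A).symm

theorem map_mul_complexMat (C A B : Matrix (Fin n) (Fin n) ℝ) :
    C.map Complex.ofReal * complexMat A B = complexMat (C * A) (C * B) := by
  rw [complexMat, complexMat, mul_add, mul_smul_comm, map_ofReal_mul, map_ofReal_mul]

theorem complexMat_mul_map (C A B : Matrix (Fin n) (Fin n) ℝ) :
    complexMat A B * C.map Complex.ofReal = complexMat (A * C) (B * C) := by
  rw [complexMat, complexMat, add_mul, smul_mul_assoc, map_ofReal_mul, map_ofReal_mul]

/-- Multiplying by a real matrix of non-zero determinant does not change the phase of `det²`. -/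
theorem phaseSq_det_map_mul {C : Matrix (Fin n) (Fin n) ℝ} (hC : C.det ≠ 0)
    (Z : Matrix (Fin n) (Fin n) ℂ) : phaseSq (C.map Complex.ofReal * Z).det = phaseSq Z.det := by
  rw [Matrix.det_mul, phaseSq_mul, det_map_ofReal, phaseSq_ofReal hC, one_mul]

theorem phaseSq_det_mul_map {C : Matrix (Fin n) (Fin n) ℝ} (hC : C.det ≠ 0)
    (Z : Matrix (Fin n) (Fin n) ℂ) : phaseSq (Z * C.map Complex.ofReal).det = phaseSq Z.det := by
  rw [Matrix.det_mul, phaseSq_mul, det_map_ofReal, phaseSq_ofReal hC, mul_one]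

variable (n) in
/-- The Siegel upper half space: complex symmetric matrices with positive definite imaginary
part. -/
def siegel : Set (Matrix (Fin n) (Fin n) ℂ) :=
  {Z | Z.IsSymm ∧ (Z.map Complex.im).PosDef}

theorem complexMat_mem_siegel {A B : Matrix (Fin n) (Fin n) ℝ} (hA : A.IsSymm) (hB : B.PosDef) :
    complexMat A B ∈ siegel n := by
  have hB' := isSymm_of_posDef hB
  refine ⟨?_, ?_⟩
  · ext i j
    rw [Matrix.transpose_apply, complexMat_apply, complexMat_apply, hA.apply, hB'.apply]
  · convert hB using 1
    ext i j
    simp [complexMat_apply]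

theorem eq_complexMat_of_mem_siegel {Z : Matrix (Fin n) (Fin n) ℂ} (hZ : Z ∈ siegel n) :
    Z = complexMat (Z.map Complex.re) (Z.map Complex.im) ∧ (Z.map Complex.re).IsSymm := by
  refine ⟨?_, ?_⟩
  · ext i j
    rw [complexMat_apply]
    rfl
  · ext i j
    simp only [Matrix.transpose_apply, Matrix.map_apply]
    rw [hZ.1.apply]

theorem convex_siegel : Convex ℝ (siegel n) := by
  intro Z hZ W hW a b ha hb hab
  refine ⟨?_, ?_⟩
  · ext i j
    simp only [Matrix.transpose_apply, Matrix.add_apply, Matrix.smul_apply]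
    rw [hZ.1.apply, hW.1.apply]
  · have : (a • Z + b • W).map Complex.im = a • Z.map Complex.im + b • W.map Complex.im := by
      ext i j
      simp
    rw [this]
    rcases ha.eq_or_lt with rfl | ha
    · rw [zero_smul, zero_add]
      exact hW.2.smul (by linarith)
    · exact (hZ.2.smul ha).add_posSemidef (hW.2.posSemidef.smul hb)

instance : PreconnectedSpace (siegel n) :=
  Subtype.preconnectedSpace convex_siegel.isPreconnected

/-- Adding a real symmetric matrix preserves the Siegel upper half space. -/
theorem sub_map_mem_siegel {Z : Matrix (Fin n) (Fin n) ℂ} (hZ : Z ∈ siegel n)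
    {T : Matrix (Fin n) (Fin n) ℝ} (hT : T.IsSymm) : Z - T.map Complex.ofReal ∈ siegel n := by
  refine ⟨?_, ?_⟩
  · ext i j
    simp only [Matrix.transpose_apply, Matrix.sub_apply, Matrix.map_apply]
    rw [hZ.1.apply, hT.apply]
  · convert hZ.2 using 1
    ext i j
    simp

theorem congr_mem_siegel {Z : Matrix (Fin n) (Fin n) ℂ} (hZ : Z ∈ siegel n)
    {C : Matrix (Fin n) (Fin n) ℝ} (hC : C.det ≠ 0) :
    (C.map Complex.ofReal).transpose * Z * C.map Complex.ofReal ∈ siegel n := by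
  obtain ⟨h1, h2⟩ := eq_complexMat_of_mem_siegel hZ
  have e : (C.map Complex.ofReal).transpose = C.transpose.map Complex.ofReal := rfl
  rw [h1, e, map_mul_complexMat, complexMat_mul_map]
  refine complexMat_mem_siegel ?_ ?_
  · rw [Matrix.IsSymm, Matrix.transpose_mul, Matrix.transpose_mul, Matrix.transpose_transpose, h2,
      Matrix.mul_assoc]
  · have h3 := hZ.2.conjTranspose_mul_mul_same (B := C)
      (Matrix.mulVec_injective_iff_isUnit.2 ((Matrix.isUnit_iff_isUnit_det _).2 hC.isUnit))
    rwa [Matrix.conjTranspose_eq_transpose_of_trivial] at h3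

theorem det_ne_zero_of_mem_siegel {Z : Matrix (Fin n) (Fin n) ℂ} (hZ : Z ∈ siegel n) :
    Z.det ≠ 0 := by
  intro h0
  obtain ⟨x, hx, hZx⟩ := Matrix.exists_mulVec_eq_zero_iff.2 h0
  set A := Z.map Complex.re with hA
  set B := Z.map Complex.im with hB
  let a : Fin n → ℝ := fun j => (x j).re
  let b : Fin n → ℝ := fun j => (x j).im
  have hre : A.mulVec a = B.mulVec b := by
    ext i
    have h := congrArg Complex.re (congrFun hZx i)
    simp only [Matrix.mulVec, dotProduct, Complex.re_sum, Complex.mul_re, Finset.sum_sub_distrib,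
      Pi.zero_apply, Complex.zero_re] at h
    exact sub_eq_zero.1 h
  have him : A.mulVec b + B.mulVec a = 0 := by
    ext i
    have h := congrArg Complex.im (congrFun hZx i)
    simp only [Matrix.mulVec, dotProduct, Complex.im_sum, Complex.mul_im, Finset.sum_add_distrib,
      Pi.zero_apply, Complex.zero_im] at h
    exact h
  have hsymm : dotProduct b (A.mulVec a) = dotProduct a (A.mulVec b) := by
    rw [Matrix.dotProduct_mulVec, ← Matrix.mulVec_transpose,
      (eq_complexMat_of_mem_siegel hZ).2, dotProduct_comm]
  have hsum : dotProduct a (B.mulVec a) + dotProduct b (B.mulVec b) = 0 := by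
    have h1 := congrArg (dotProduct a) him
    rw [dotProduct_add, dotProduct_zero, ← hsymm, hre] at h1
    linarith
  have hnn : ∀ v, 0 ≤ dotProduct v (B.mulVec v) := fun v => by
    simpa using hZ.2.posSemidef.dotProduct_mulVec_nonneg v
  have hz : ∀ v, dotProduct v (B.mulVec v) = 0 → v = 0 := fun v hv => by
    by_contra hne
    have := hZ.2.dotProduct_mulVec_pos hne
    simp only [star_trivial] at this
    exact this.ne' hv
  have ha := hz a (by linarith [hnn a, hnn b])
  have hb := hz b (by linarith [hnn a, hnn b])
  exact hx (funext fun j => Complex.ext (congrFun ha j) (congrFun hb j))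

theorem complexMat_smul_one_mem_siegel {A : Matrix (Fin n) (Fin n) ℝ} (hA : A.IsSymm) :
    complexMat A 1 ∈ siegel n :=
  complexMat_mem_siegel hA Matrix.PosDef.one

theorem det_complexMat_zero (B : Matrix (Fin n) (Fin n) ℝ) :
    (complexMat 0 B).det = Complex.I ^ n * B.det := by
  have : complexMat 0 B = Complex.I • B.map Complex.ofReal := by
    ext i j
    simp [complexMat]
  rw [this, Matrix.det_smul, det_map_ofReal, Fintype.card_fin]

theorem exists_siegelAngle (n : ℕ) : ∃ L : Matrix (Fin n) (Fin n) ℂ → ℝ,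
    ContinuousOn L (siegel n) ∧ L (complexMat 0 1) = n / 2 ∧
      ∀ Z ∈ siegel n, turn (L Z) = phaseSq Z.det := by
  have hi : complexMat 0 1 ∈ siegel n := complexMat_smul_one_mem_siegel Matrix.isSymm_zero
  obtain ⟨a, ha, ha0, hau⟩ := exists_angle_of_convex convex_siegel
    (u := fun Z : siegel n => phaseSq (Z : Matrix (Fin n) (Fin n) ℂ).det)
    (Continuous.phaseSq (Continuous.matrix_det continuous_subtype_val)
      fun Z => det_ne_zero_of_mem_siegel Z.2)
    (fun Z => norm_phaseSq (det_ne_zero_of_mem_siegel Z.2)) ⟨_, hi⟩ (r := n / 2) (by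
      simp only
      rw [det_complexMat_zero, Matrix.det_one, Complex.ofReal_one, mul_one, phaseSq_I_pow])
  classical
  refine ⟨fun Z => if h : Z ∈ siegel n then a ⟨Z, h⟩ else 0, ?_, by simp [hi, ha0], fun Z hZ => by
    simp [hZ, hau]⟩
  rw [continuousOn_iff_continuous_domRestrict]
  convert ha using 1
  ext Z
  simp

/-- The continuous angle of `det²` on the Siegel upper half space whose value at `i` is `n / 2`. -/
def siegelAngle (Z : Matrix (Fin n) (Fin n) ℂ) : ℝ := (exists_siegelAngle n).choose Z

theorem continuousOn_siegelAngle : ContinuousOn (siegelAngle (n := n)) (siegel n) :=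
  (exists_siegelAngle n).choose_spec.1

theorem siegelAngle_I : siegelAngle (n := n) (complexMat 0 1) = n / 2 :=
  (exists_siegelAngle n).choose_spec.2.1

theorem turn_siegelAngle {Z : Matrix (Fin n) (Fin n) ℂ} (hZ : Z ∈ siegel n) :
    turn (siegelAngle Z) = phaseSq Z.det :=
  (exists_siegelAngle n).choose_spec.2.2 Z hZ

theorem continuous_siegelAngle_comp {X : Type*} [TopologicalSpace X]
    {Z : X → Matrix (Fin n) (Fin n) ℂ} (hZ : Continuous Z) (h : ∀ x, Z x ∈ siegel n) :
    Continuous fun x => siegelAngle (Z x) :=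
  continuousOn_siegelAngle.comp_continuous hZ h

/-- On purely imaginary matrices the angle is constant. -/
theorem siegelAngle_complexMat_zero {B : Matrix (Fin n) (Fin n) ℝ} (hB : B.PosDef) :
    siegelAngle (complexMat 0 B) = n / 2 := by
  let P : unitInterval → Matrix (Fin n) (Fin n) ℝ := fun t => (1 - (t : ℝ)) • 1 + (t : ℝ) • B
  have hP : ∀ t, (P t).PosDef := fun t => by
    rcases t.2.1.eq_or_lt with h | h
    · simp only [P, ← h]
      simpa using Matrix.PosDef.one
    · exact Matrix.PosDef.posSemidef_add
        (Matrix.PosDef.one.posSemidef.smul (a := 1 - (t : ℝ)) (by linarith [t.2.2])) (hB.smul h)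
  have hmem : ∀ t, complexMat 0 (P t) ∈ siegel n := fun t =>
    complexMat_mem_siegel Matrix.isSymm_zero (hP t)
  have h := eq_of_turn_eq_const (c := fun t => siegelAngle (complexMat 0 (P t)))
    (continuous_siegelAngle_comp (continuous_complexMat continuous_const (by fun_prop)) hmem)
    (w := phaseSq (Complex.I ^ n)) (fun t => by
      rw [turn_siegelAngle (hmem t), det_complexMat_zero, phaseSq_mul,
        phaseSq_ofReal (hP t).det_pos.ne', mul_one]) 1 0
  simpa [P, siegelAngle_I] using h

/-- The angle is invariant under the congruence action of the real general linear group. -/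
theorem siegelAngle_congr {C : Matrix (Fin n) (Fin n) ℝ} (hC : C.det ≠ 0)
    {Z : Matrix (Fin n) (Fin n) ℂ} (hZ : Z ∈ siegel n) :
    siegelAngle ((C.map Complex.ofReal).transpose * Z * C.map Complex.ofReal) = siegelAngle Z := by
  have e : (C.map Complex.ofReal).transpose = C.transpose.map Complex.ofReal := rfl
  have hCt : C.transpose.det ≠ 0 := by rwa [Matrix.det_transpose]
  have hi : complexMat 0 1 ∈ siegel n := complexMat_smul_one_mem_siegel Matrix.isSymm_zero
  have h := sub_eq_sub_of_turn_eq
    (a := fun Z : siegel n =>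
      siegelAngle ((C.map Complex.ofReal).transpose * Z.1 * C.map Complex.ofReal))
    (b := fun Z : siegel n => siegelAngle Z.1)
    (continuous_siegelAngle_comp (by fun_prop) fun Z => congr_mem_siegel Z.2 hC)
    (continuous_siegelAngle_comp (by fun_prop) fun Z => Z.2) (fun Z => by
      rw [turn_siegelAngle (congr_mem_siegel Z.2 hC), turn_siegelAngle Z.2,
        phaseSq_det_mul_map hC, e, phaseSq_det_map_mul hCt]) ⟨Z, hZ⟩ ⟨_, hi⟩
  have hCC : (C.transpose * C).PosDef := by
    have h3 := (Matrix.PosDef.one (n := Fin n) (R := ℝ)).conjTranspose_mul_mul_same (B := C)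
      (Matrix.mulVec_injective_iff_isUnit.2 ((Matrix.isUnit_iff_isUnit_det _).2 hC.isUnit))
    rwa [Matrix.conjTranspose_eq_transpose_of_trivial, mul_one] at h3
  simp only at h
  rw [siegelAngle_I, e, map_mul_complexMat, complexMat_mul_map, mul_zero, zero_mul, mul_one,
    siegelAngle_complexMat_zero hCC, sub_self] at h
  rw [e]
  linarith

/-- For real diagonal `q` the angle at `q + i` is the sum of the arguments of the numbers `q j + i`,
each measured in half turns and determined by continuity from `q = 0`. -/
theorem siegelAngle_diagonal (q : Fin n → ℝ) :
    siegelAngle (complexMat (Matrix.diagonal q) 1)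
      = ∑ j, (1 / 2 - Real.arctan (q j) / Real.pi) := by
  have hmem : ∀ t : unitInterval, complexMat (Matrix.diagonal fun j => (t : ℝ) * q j) 1 ∈ siegel n :=
    fun t => complexMat_smul_one_mem_siegel (Matrix.isSymm_diagonal _)
  have hturn : ∀ x : ℝ, turn (1 / 2 - Real.arctan x / Real.pi) = phaseSq (⟨x, 1⟩ : ℂ) := by
    intro x
    -- `x + i` is a positive multiple of `i exp (-i arctan x)`
    have h1 : (⟨x, 1⟩ : ℂ) = (Real.sqrt (1 + x ^ 2) : ℝ) *
        (Complex.I * Complex.exp (-(Real.arctan x : ℂ) * Complex.I)) := by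
      have hs : Real.sqrt (1 + x ^ 2) ≠ 0 := by positivity
      rw [Complex.exp_mul_I, Complex.cos_neg, Complex.sin_neg, ← Complex.ofReal_cos,
        ← Complex.ofReal_sin, Real.cos_arctan, Real.sin_arctan]
      apply Complex.ext
      · simp
        field_simp
      · simp
        field_simp
    rw [h1, phaseSq_mul, phaseSq_ofReal (by positivity), one_mul, phaseSq]
    have hn : ‖Complex.I * Complex.exp (-(Real.arctan x : ℂ) * Complex.I)‖ = 1 := by
      rw [norm_mul, Complex.norm_I, one_mul, ← Complex.ofReal_neg, Complex.norm_exp_ofReal_mul_I]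
    rw [hn, mul_pow, Complex.I_sq, ← Complex.exp_nat_mul, turn]
    rw [← Complex.exp_pi_mul_I, Complex.ofReal_one, one_pow, div_one, ← Complex.exp_add]
    congr 1
    have : (Real.pi : ℂ) ≠ 0 := by exact_mod_cast Real.pi_ne_zero
    push_cast
    field_simp
    ring
  have hprod : ∀ r : Fin n → ℝ, turn (∑ j, (1 / 2 - Real.arctan (r j) / Real.pi))
      = phaseSq (complexMat (Matrix.diagonal r) 1).det := by
    intro r
    have hd : complexMat (Matrix.diagonal r) 1 = Matrix.diagonal fun j => (⟨r j, 1⟩ : ℂ) := by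
      ext i j
      rw [complexMat_apply]
      by_cases hij : i = j
      · subst hij
        simp
      · simp [hij]
        rfl
    rw [hd, Matrix.det_diagonal]
    have : ∀ s : Finset (Fin n), turn (∑ j ∈ s, (1 / 2 - Real.arctan (r j) / Real.pi))
        = phaseSq (∏ j ∈ s, (⟨r j, 1⟩ : ℂ)) := by
      intro s
      classical
      induction s using Finset.induction_on with
      | empty => simp [turn_zero, phaseSq]
      | insert j s hj ih =>
        rw [Finset.sum_insert hj, Finset.prod_insert hj, turn_add, phaseSq_mul, ih, hturn]
    exact this _
  have h := sub_eq_sub_of_turn_eq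
    (a := fun t : unitInterval => siegelAngle (complexMat (Matrix.diagonal fun j => (t : ℝ) * q j) 1))
    (b := fun t : unitInterval => ∑ j, (1 / 2 - Real.arctan ((t : ℝ) * q j) / Real.pi))
    (continuous_siegelAngle_comp (continuous_complexMat (by fun_prop) continuous_const) hmem)
    (by fun_prop) (fun t => by rw [turn_siegelAngle (hmem t), hprod]) 1 0
  have h0 : (Matrix.diagonal fun _ : Fin n => (0 : ℝ)) = 0 := Matrix.diagonal_zero
  simp only [Set.Icc.coe_one, Set.Icc.coe_zero, one_mul, zero_mul, h0, siegelAngle_I,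
    Real.arctan_zero, zero_div, sub_zero, Finset.sum_const, Finset.card_univ, Fintype.card_fin,
    nsmul_eq_mul] at h
  linarith

/-- The number `-#{positive eigenvalues of Q}` of an invertible symmetric matrix `Q`, as a
difference of angles of `Q + i` and of its image under the involution `Z ↦ -Z⁻¹`. -/
def indexAngle (Q : Matrix (Fin n) (Fin n) ℝ) : ℝ :=
  siegelAngle (complexMat Q 1) - siegelAngle (complexMat (-Q⁻¹) 1) - n / 2

theorem exists_diagonalization {Q : Matrix (Fin n) (Fin n) ℝ} (hQ : Q.IsSymm) :
    ∃ (C : Matrix (Fin n) (Fin n) ℝ) (q : Fin n → ℝ), C * C.transpose = 1 ∧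
      Q = C * Matrix.diagonal q * C.transpose := by
  have hH : Q.IsHermitian := by
    rw [Matrix.IsHermitian, Matrix.conjTranspose_eq_transpose_of_trivial]
    exact hQ
  refine ⟨hH.eigenvectorUnitary, hH.eigenvalues, ?_, ?_⟩
  · have := Unitary.mul_star_self_of_mem hH.eigenvectorUnitary.2
    rwa [Matrix.star_eq_conjTranspose, Matrix.conjTranspose_eq_transpose_of_trivial] at this
  · have := hH.spectral_theorem
    rw [Unitary.conjStarAlgAut_apply, Matrix.star_eq_conjTranspose,
      Matrix.conjTranspose_eq_transpose_of_trivial] at this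
    exact this

/-- In a diagonalization of `Q` this is the identity `arctan x + arctan x⁻¹ = ± π / 2`. -/
theorem indexAngle_eq {Q C : Matrix (Fin n) (Fin n) ℝ} {q : Fin n → ℝ} (hC : C * C.transpose = 1)
    (hQ : Q = C * Matrix.diagonal q * C.transpose) (hdet : Q.det ≠ 0) :
    (∀ j, q j ≠ 0) ∧ indexAngle Q = ∑ j, if 0 < q j then (-1 : ℝ) else 0 := by
  have hC' : C.transpose * C = 1 := mul_eq_one_comm.1 hC
  have hdC : C.transpose.det ≠ 0 := fun h => by
    have := congrArg Matrix.det hC'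
    rw [Matrix.det_mul, h, zero_mul, Matrix.det_one] at this
    exact zero_ne_one this
  have hq : ∀ j, q j ≠ 0 := by
    rw [hQ, Matrix.det_mul, Matrix.det_mul, Matrix.det_diagonal] at hdet
    intro j hj
    rw [Finset.prod_eq_zero (Finset.mem_univ j) hj] at hdet
    simp at hdet
  refine ⟨hq, ?_⟩
  have hinv : -Q⁻¹ = C * Matrix.diagonal (fun j => -(q j)⁻¹) * C.transpose := by
    have : Q⁻¹ = C * Matrix.diagonal (fun j => (q j)⁻¹) * C.transpose := by
      refine Matrix.inv_eq_right_inv ?_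
      rw [hQ]
      calc C * Matrix.diagonal q * C.transpose
            * (C * Matrix.diagonal (fun j => (q j)⁻¹) * C.transpose)
          = C * Matrix.diagonal q * (C.transpose * C)
            * Matrix.diagonal (fun j => (q j)⁻¹) * C.transpose := by
            simp only [Matrix.mul_assoc]
        _ = 1 := by
            rw [hC', mul_one, Matrix.mul_assoc C, Matrix.diagonal_mul_diagonal]
            simp [hq, hC]
    rw [this, ← Matrix.diagonal_neg, mul_neg, neg_mul]
  have hang : ∀ r : Fin n → ℝ, siegelAngle (complexMat (C * Matrix.diagonal r * C.transpose) 1)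
      = ∑ j, (1 / 2 - Real.arctan (r j) / Real.pi) := fun r => by
    rw [← siegelAngle_diagonal, ← siegelAngle_congr hdC
      (complexMat_smul_one_mem_siegel (Matrix.isSymm_diagonal r))]
    have e : (C.transpose.map Complex.ofReal).transpose = C.map Complex.ofReal := rfl
    rw [e, map_mul_complexMat, complexMat_mul_map, mul_one, hC]
  rw [indexAngle, hinv, hang, hQ, hang]
  have hn : (n : ℝ) / 2 = ∑ _j : Fin n, (1 / 2 : ℝ) := by simp; ring
  rw [hn, ← Finset.sum_sub_distrib, ← Finset.sum_sub_distrib]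
  refine Finset.sum_congr rfl fun j _ => ?_
  have hpi : Real.pi ≠ 0 := Real.pi_ne_zero
  rw [Real.arctan_neg]
  split_ifs with h
  · rw [Real.arctan_inv_of_pos h]
    field_simp
    ring
  · rw [Real.arctan_inv_of_neg (lt_of_le_of_ne (not_lt.1 h) (hq j))]
    field_simp
    ring

theorem indexAngle_of_posDef {Q : Matrix (Fin n) (Fin n) ℝ} (hQ : Q.PosDef) :
    indexAngle Q = -n := by
  have hs := isSymm_of_posDef hQ
  obtain ⟨C, q, hC, hCq⟩ := exists_diagonalization hs
  have hC' : C.transpose * C = 1 := mul_eq_one_comm.1 hC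
  have hpos : ∀ j, 0 < q j := by
    have h3 := hQ.conjTranspose_mul_mul_same (B := C)
      (Matrix.mulVec_injective_iff_isUnit.2 (IsUnit.of_mul_eq_one _ hC))
    rw [Matrix.conjTranspose_eq_transpose_of_trivial, hCq] at h3
    have e : C.transpose * (C * Matrix.diagonal q * C.transpose) * C = Matrix.diagonal q := by
      calc _ = (C.transpose * C) * Matrix.diagonal q * (C.transpose * C) := by
            simp only [Matrix.mul_assoc]
        _ = _ := by rw [hC', one_mul, mul_one]
    rw [e] at h3
    exact Matrix.posDef_diagonal_iff.1 h3
  rw [(indexAngle_eq hC hCq hQ.det_pos.ne').2]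
  simp [hpos]

theorem lt_indexAngle_of_not_posDef {Q : Matrix (Fin n) (Fin n) ℝ} (hs : Q.IsSymm)
    (hdet : Q.det ≠ 0) (hQ : ¬ Q.PosDef) : -n < indexAngle Q := by
  obtain ⟨C, q, hC, hCq⟩ := exists_diagonalization hs
  obtain ⟨hq, h⟩ := indexAngle_eq hC hCq hdet
  have hex : ∃ j, ¬ 0 < q j := by
    by_contra hcon
    push Not at hcon
    apply hQ
    have h3 := (Matrix.posDef_diagonal_iff.2 hcon).conjTranspose_mul_mul_same (B := C.transpose)
      (Matrix.mulVec_injective_iff_isUnit.2 (IsUnit.of_mul_eq_one _ (mul_eq_one_comm.1 hC)))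
    rw [Matrix.conjTranspose_eq_transpose_of_trivial, Matrix.transpose_transpose, ← hCq] at h3
    exact h3
  obtain ⟨j, hj⟩ := hex
  have hn : -(n : ℝ) = ∑ _j : Fin n, (-1 : ℝ) := by simp
  rw [h, hn]
  refine Finset.sum_lt_sum (fun i _ => by split_ifs <;> norm_num) ⟨j, Finset.mem_univ _, ?_⟩
  rw [if_neg hj]
  norm_num

end Siegel

/-! ### Lagrangian frames as pairs of matrices -/

section Frames

variable {n : ℕ}

/-- The rows of `(X | Y)` are a basis of a lagrangian subspace of `ℝⁿ × ℝⁿ`, the first factor being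
the base direction and the second one the fibre direction. -/
structure IsLagrangianFrame (X Y : Matrix (Fin n) (Fin n) ℝ) : Prop where
  symm : X * Y.transpose = Y * X.transpose
  indep : ∀ v, Matrix.vecMul v X = 0 → Matrix.vecMul v Y = 0 → v = 0

/-- The matrix `Y - X Z`; its determinant is, up to a positive factor, the determinant of the
hermitian products of the frame with the vertical one, for the complex structure given by `Z`. -/
def frameMat (X Y : Matrix (Fin n) (Fin n) ℝ) (Z : Matrix (Fin n) (Fin n) ℂ) :
    Matrix (Fin n) (Fin n) ℂ :=
  Y.map Complex.ofReal - X.map Complex.ofReal * Z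

/-- For a frame `(X | Y)` that is transversal to the vertical space, the angle of `det²`
given by the Siegel upper half space. -/
def frameAngle (X Y : Matrix (Fin n) (Fin n) ℝ) (Z : Matrix (Fin n) (Fin n) ℂ) : ℝ :=
  siegelAngle (Z - (X⁻¹ * Y).map Complex.ofReal)

theorem dotProduct_vecMul_vecMul (v w : Fin n → ℝ) (A B : Matrix (Fin n) (Fin n) ℝ) :
    dotProduct (Matrix.vecMul v A) (Matrix.vecMul w B)
      = dotProduct v ((A * B.transpose).mulVec w) := by
  rw [← Matrix.mulVec_transpose B w, Matrix.dotProduct_mulVec, Matrix.vecMul_vecMul,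
    ← Matrix.dotProduct_mulVec]

theorem IsLagrangianFrame.det_frameMat_ne_zero {X Y : Matrix (Fin n) (Fin n) ℝ}
    (h : IsLagrangianFrame X Y) {Z : Matrix (Fin n) (Fin n) ℂ} (hZ : Z ∈ siegel n) :
    (frameMat X Y Z).det ≠ 0 := by
  intro h0
  obtain ⟨w, hw, hwZ⟩ := Matrix.exists_vecMul_eq_zero_iff.2 h0
  set K := Z.map Complex.re with hK
  set G := Z.map Complex.im with hG
  have hKs : K.IsSymm := (eq_complexMat_of_mem_siegel hZ).2
  have hGs : G.IsSymm := isSymm_of_posDef hZ.2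
  let a : Fin n → ℝ := fun j => (w j).re
  let b : Fin n → ℝ := fun j => (w j).im
  have hcomp : ∀ A : Matrix (Fin n) (Fin n) ℝ, Matrix.vecMul w (A.map Complex.ofReal)
      = fun j => (⟨Matrix.vecMul a A j, Matrix.vecMul b A j⟩ : ℂ) := by
    intro A
    ext j
    apply Complex.ext <;> simp [Matrix.vecMul, dotProduct, a, b]
  have heq : ∀ j, (⟨Matrix.vecMul a Y j, Matrix.vecMul b Y j⟩ : ℂ)
      = ∑ i, (⟨Matrix.vecMul a X i, Matrix.vecMul b X i⟩ : ℂ) * Z i j := by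
    intro j
    have h1 := congrFun hwZ j
    rw [frameMat, Matrix.vecMul_sub, ← Matrix.vecMul_vecMul, hcomp, hcomp, Pi.sub_apply,
      Pi.zero_apply, sub_eq_zero] at h1
    exact h1
  set p1 := Matrix.vecMul a X with hp1
  set p2 := Matrix.vecMul b X with hp2
  have e1 : Matrix.vecMul a Y = Matrix.vecMul p1 K - Matrix.vecMul p2 G := by
    ext j
    have h1 := congrArg Complex.re (heq j)
    simpa [Matrix.vecMul, dotProduct, Complex.re_sum, Complex.mul_re, Finset.sum_sub_distrib,
      hK, hG] using h1
  have e2 : Matrix.vecMul b Y = Matrix.vecMul p1 G + Matrix.vecMul p2 K := by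
    ext j
    have h1 := congrArg Complex.im (heq j)
    simpa [Matrix.vecMul, dotProduct, Complex.im_sum, Complex.mul_im, Finset.sum_add_distrib,
      hK, hG] using h1
  have hsymm : dotProduct (Matrix.vecMul b Y) p1 = dotProduct (Matrix.vecMul a Y) p2 := by
    rw [hp1, hp2, dotProduct_comm (Matrix.vecMul b Y), dotProduct_vecMul_vecMul,
      dotProduct_vecMul_vecMul, h.symm]
  have hsK : dotProduct (Matrix.vecMul p2 K) p1 = dotProduct (Matrix.vecMul p1 K) p2 := by
    rw [← Matrix.dotProduct_mulVec, dotProduct_comm, ← Matrix.vecMul_transpose, hKs.eq]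
  rw [e1, e2, add_dotProduct, sub_dotProduct, hsK] at hsymm
  have hnn : ∀ v, 0 ≤ dotProduct (Matrix.vecMul v G) v := fun v => by
    rw [← Matrix.dotProduct_mulVec]
    simpa using hZ.2.posSemidef.dotProduct_mulVec_nonneg v
  have hz : ∀ v, dotProduct (Matrix.vecMul v G) v = 0 → v = 0 := fun v hv => by
    by_contra hne
    have := hZ.2.dotProduct_mulVec_pos hne
    rw [star_trivial, Matrix.dotProduct_mulVec] at this
    exact this.ne' hv
  have z1 := hz p1 (by linarith [hnn p1, hnn p2])
  have z2 := hz p2 (by linarith [hnn p1, hnn p2])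
  rw [z1, z2, Matrix.zero_vecMul, Matrix.zero_vecMul] at e1 e2
  have ha := h.indep a z1 (by rw [e1, sub_zero])
  have hb := h.indep b z2 (by rw [e2, add_zero])
  exact hw (funext fun j => Complex.ext (congrFun ha j) (congrFun hb j))

theorem isSymm_inv_mul {X Y : Matrix (Fin n) (Fin n) ℝ} (h : X * Y.transpose = Y * X.transpose)
    (hX : X.det ≠ 0) : (X⁻¹ * Y).IsSymm := by
  have hu : IsUnit X.det := hX.isUnit
  have hut : IsUnit X.transpose.det := by rwa [Matrix.det_transpose]
  rw [Matrix.IsSymm, Matrix.transpose_mul, Matrix.transpose_nonsing_inv]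
  calc Y.transpose * X.transpose⁻¹ = X⁻¹ * (X * Y.transpose) * X.transpose⁻¹ := by
        rw [← Matrix.mul_assoc, Matrix.nonsing_inv_mul _ hu, Matrix.one_mul]
    _ = X⁻¹ * Y := by
        rw [h, Matrix.mul_assoc, Matrix.mul_assoc, Matrix.mul_nonsing_inv _ hut, Matrix.mul_one]

theorem IsLagrangianFrame.sub_mem_siegel {X Y : Matrix (Fin n) (Fin n) ℝ}
    (h : IsLagrangianFrame X Y) (hX : X.det ≠ 0) {Z : Matrix (Fin n) (Fin n) ℂ}
    (hZ : Z ∈ siegel n) : Z - (X⁻¹ * Y).map Complex.ofReal ∈ siegel n :=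
  sub_map_mem_siegel hZ (isSymm_inv_mul h.symm hX)

theorem frameMat_eq_mul {X Y : Matrix (Fin n) (Fin n) ℝ} (hX : X.det ≠ 0)
    (Z : Matrix (Fin n) (Fin n) ℂ) :
    frameMat X Y Z = (-X).map Complex.ofReal * (Z - (X⁻¹ * Y).map Complex.ofReal) := by
  have hneg : (-X).map Complex.ofReal = -(X.map Complex.ofReal) := by
    ext i j
    simp
  rw [mul_sub, ← map_ofReal_mul, ← Matrix.mul_assoc, neg_mul, Matrix.mul_nonsing_inv _ hX.isUnit,
    neg_mul, Matrix.one_mul, hneg, neg_mul, frameMat]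
  have hneg' : (-Y).map Complex.ofReal = -(Y.map Complex.ofReal) := by
    ext i j
    simp
  rw [hneg']
  abel

theorem IsLagrangianFrame.turn_frameAngle {X Y : Matrix (Fin n) (Fin n) ℝ}
    (h : IsLagrangianFrame X Y) (hX : X.det ≠ 0) {Z : Matrix (Fin n) (Fin n) ℂ}
    (hZ : Z ∈ siegel n) : turn (frameAngle X Y Z) = phaseSq (frameMat X Y Z).det := by
  have hX' : (-X).det ≠ 0 := by
    rw [Matrix.det_neg]
    exact mul_ne_zero (pow_ne_zero _ (by norm_num)) hX
  rw [frameAngle, turn_siegelAngle (h.sub_mem_siegel hX hZ), frameMat_eq_mul hX,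
    phaseSq_det_map_mul hX']

/-! ### The Maslov index along a path of frames -/

/-- The complex structure for which the horizontal space is the graph of `-κ`. -/
def siegelPoint (n : ℕ) (κ : ℝ) : Matrix (Fin n) (Fin n) ℂ :=
  complexMat (-κ • (1 : Matrix (Fin n) (Fin n) ℝ)) 1

theorem siegelPoint_mem (κ : ℝ) : siegelPoint n κ ∈ siegel n :=
  complexMat_smul_one_mem_siegel (by simp [Matrix.IsSymm, Matrix.transpose_smul])

theorem frameMat_siegelPoint (X Y : Matrix (Fin n) (Fin n) ℝ) (κ : ℝ) :
    frameMat X Y (siegelPoint n κ) = complexMat (Y + κ • X) (-X) := by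
  rw [siegelPoint, frameMat, map_mul_complexMat]
  ext i j
  rw [Matrix.sub_apply, complexMat_apply, complexMat_apply]
  apply Complex.ext <;> simp

/-- In the chart of frames `(X | Y)` with `M = Y + κ X` invertible, `Q = M⁻¹ X` gives a continuous
angle of `det²`. -/
theorem turn_siegelAngle_sub {X Y : Matrix (Fin n) (Fin n) ℝ} {κ : ℝ}
    (h : X * Y.transpose = Y * X.transpose) (hM : (Y + κ • X).det ≠ 0) :
    ((Y + κ • X)⁻¹ * X).IsSymm ∧
      turn (siegelAngle (complexMat ((Y + κ • X)⁻¹ * X) 1) - n / 2)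
        = phaseSq (frameMat X Y (siegelPoint n κ)).det := by
  set M := Y + κ • X with hMdef
  set Q := M⁻¹ * X with hQdef
  have hQs : Q.IsSymm := by
    refine isSymm_inv_mul ?_ hM
    rw [hMdef, Matrix.add_mul, Matrix.transpose_add, Matrix.mul_add, h, Matrix.transpose_smul,
      Matrix.mul_smul, Matrix.smul_mul]
  have hX : X = M * Q := by
    rw [hQdef, ← Matrix.mul_assoc, Matrix.mul_nonsing_inv _ hM.isUnit, Matrix.one_mul]
  refine ⟨hQs, ?_⟩
  have e : complexMat 1 (-Q) = (-Complex.I) • complexMat Q 1 := by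
    ext i j
    rw [Matrix.smul_apply, complexMat_apply, complexMat_apply]
    apply Complex.ext <;> simp
  have e2 : complexMat M (-X) = M.map Complex.ofReal * complexMat 1 (-Q) := by
    rw [map_mul_complexMat, mul_one, mul_neg, ← hX]
  rw [frameMat_siegelPoint, ← hMdef, e2, phaseSq_det_map_mul hM, e, Matrix.det_smul,
    Fintype.card_fin, phaseSq_mul, ← turn_siegelAngle (complexMat_smul_one_mem_siegel hQs),
    neg_pow, phaseSq_mul, phaseSq_I_pow]
  have h1 : phaseSq ((-1) ^ n) = 1 := by
    have : ((-1 : ℂ)) ^ n = (((-1 : ℝ) ^ n : ℝ) : ℂ) := by push_cast; rfl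
    rw [this, phaseSq_ofReal (pow_ne_zero _ (by norm_num))]
  rw [h1, one_mul, ← turn_add, turn_eq_turn_iff]
  exact ⟨-n, by push_cast; ring⟩

/-- Along a connected family of frames in one chart, the difference between a continuous angle of
`det²` and the angle `frameAngle` is, up to a constant, the number of positive eigenvalues
of the coordinate `Q` with the sign reversed. This does not depend on the complex
structures `Z`, which are deformed to a constant one. -/
theorem exists_sub_frameAngle_eq {A : Type*} [TopologicalSpace A] [PreconnectedSpace A]
    {X Y : A → Matrix (Fin n) (Fin n) ℝ} {Z : A → Matrix (Fin n) (Fin n) ℂ} {a : A → ℝ}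
    (hX : Continuous X) (hY : Continuous Y) (hZ : Continuous Z) (ha : Continuous a)
    (hfr : ∀ t, IsLagrangianFrame (X t) (Y t)) (hZs : ∀ t, Z t ∈ siegel n)
    (hau : ∀ t, turn (a t) = phaseSq (frameMat (X t) (Y t) (Z t)).det) {κ : ℝ}
    (hκ : ∀ t, (Y t + κ • X t).det ≠ 0) :
    ∃ c, ∀ t, (X t).det ≠ 0 →
      a t - frameAngle (X t) (Y t) (Z t) = c + indexAngle ((Y t + κ • X t)⁻¹ * X t) := by
  rcases isEmpty_or_nonempty A with hA | ⟨⟨t₀⟩⟩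
  · exact ⟨0, fun t => (hA.false t).elim⟩
  let W : unitInterval × A → Matrix (Fin n) (Fin n) ℂ := fun p =>
    (1 - (p.1 : ℝ)) • Z p.2 + (p.1 : ℝ) • siegelPoint n κ
  have hWc : Continuous W := by fun_prop
  have hW : ∀ p, W p ∈ siegel n := fun p =>
    convex_siegel (hZs p.2) (siegelPoint_mem κ) (by linarith [p.1.2.2]) p.1.2.1 (by ring)
  have hW0 : ∀ t, W (0, t) = Z t := fun t => by simp [W]
  have hW1 : ∀ t, W (1, t) = siegelPoint n κ := fun t => by simp [W]
  have hXc : Continuous fun p : unitInterval × A => (X p.2).map Complex.ofReal :=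
    (hX.comp continuous_snd).matrix_map Complex.continuous_ofReal
  have hYc : Continuous fun p : unitInterval × A => (Y p.2).map Complex.ofReal :=
    (hY.comp continuous_snd).matrix_map Complex.continuous_ofReal
  have hdet : ∀ p : unitInterval × A, (frameMat (X p.2) (Y p.2) (W p)).det ≠ 0 := fun p =>
    (hfr p.2).det_frameMat_ne_zero (hW p)
  obtain ⟨F, hF, hF0, hFu⟩ := exists_angle_homotopy
    (u := fun p => phaseSq (frameMat (X p.2) (Y p.2) (W p)).det)
    (Continuous.phaseSq (Continuous.matrix_det (hYc.sub (hXc.matrix_mul hWc))) hdet)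
    (fun p => norm_phaseSq (hdet p)) ha (fun t => by simp only [hW0, hau])
  let Q : A → Matrix (Fin n) (Fin n) ℝ := fun t => (Y t + κ • X t)⁻¹ * X t
  have hMc : Continuous fun t => Y t + κ • X t := by fun_prop
  have hQc : Continuous Q := by
    have : Continuous fun t => (Y t + κ • X t)⁻¹ := by
      rw [continuous_iff_continuousAt]
      intro t
      refine (continuousAt_matrix_inv _ ?_).comp hMc.continuousAt
      exact NormedRing.inverse_continuousAt (hκ t).isUnit.unit
    exact this.matrix_mul hX
  have hQ := fun t => turn_siegelAngle_sub (hfr t).symm (hκ t)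
  have hconst := sub_eq_sub_of_turn_eq (a := fun t => F (1, t))
    (b := fun t => siegelAngle (complexMat (Q t) 1) - n / 2) (by fun_prop)
    ((continuous_siegelAngle_comp (continuous_complexMat hQc continuous_const)
      fun t => complexMat_smul_one_mem_siegel (hQ t).1).sub continuous_const)
    (fun t => by simp only [hFu, hW1, (hQ t).2, Q])
  refine ⟨F (1, t₀) - (siegelAngle (complexMat (Q t₀) 1) - n / 2), fun t ht => ?_⟩
  have hsub : ∀ s : unitInterval, W (s, t) - ((X t)⁻¹ * Y t).map Complex.ofReal ∈ siegel n :=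
    fun s => (hfr t).sub_mem_siegel ht (hW _)
  have hend := sub_eq_sub_of_turn_eq (a := fun s : unitInterval => F (s, t))
    (b := fun s => frameAngle (X t) (Y t) (W (s, t))) (by fun_prop)
    (continuous_siegelAngle_comp (by fun_prop) hsub)
    (fun s => by simp only [hFu, (hfr t).turn_frameAngle ht (hW _)]) 0 1
  simp only [hF0, hW0, hW1] at hend
  have hQinv : siegelPoint n κ - ((X t)⁻¹ * Y t).map Complex.ofReal = complexMat (-(Q t)⁻¹) 1 := by
    have : (Q t)⁻¹ = (X t)⁻¹ * Y t + κ • 1 := by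
      rw [Matrix.mul_inv_rev, Matrix.nonsing_inv_nonsing_inv _ (hκ t).isUnit, Matrix.mul_add,
        Matrix.mul_smul, Matrix.nonsing_inv_mul _ ht.isUnit]
    rw [this]
    ext i j
    rw [Matrix.sub_apply, siegelPoint, complexMat_apply, complexMat_apply]
    apply Complex.ext
    · simp
      ring
    · simp
  have h2 := hconst t t₀
  rw [hend, frameAngle, hQinv, indexAngle]
  simp only [Q] at h2 ⊢
  linarith

end Frames

/-! ### Crossings of the vertical space -/

section Crossing

variable {n : ℕ}

/-- Every square matrix has a (von Neumann) generalized inverse. -/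
theorem exists_generalized_inverse (A : Matrix (Fin n) (Fin n) ℝ) :
    ∃ G : Matrix (Fin n) (Fin n) ℝ, A * G * A = A := by
  let f := Matrix.toLin' A
  obtain ⟨g, hg⟩ := f.rangeRestrict.exists_rightInverse_of_surjective f.range_rangeRestrict
  obtain ⟨G, hG⟩ := g.exists_extend
  refine ⟨LinearMap.toMatrix' G, Matrix.toLin'.injective ?_⟩
  rw [Matrix.toLin'_mul, Matrix.toLin'_mul, Matrix.toLin'_toMatrix']
  ext1 x
  have h1 : G (f (Pi.single x 1)) = g (f.rangeRestrict (Pi.single x 1)) := by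
    rw [← hG]
    rfl
  have h2 := LinearMap.congr_fun hg (f.rangeRestrict (Pi.single x 1))
  ext1
  simp only [LinearMap.comp_apply, LinearMap.coe_single]
  change f (G (f (Pi.single x 1))) = f (Pi.single x 1)
  rw [h1]
  exact congrArg Subtype.val h2

theorem exists_abs_dotProduct_mulVec_le (S : Matrix (Fin n) (Fin n) ℝ) :
    ∃ c, ∀ w, |dotProduct w (S.mulVec w)| ≤ c * dotProduct w w := by
  refine ⟨∑ i, ∑ j, |S i j|, fun w => ?_⟩
  have hsq : ∀ i, w i ^ 2 ≤ dotProduct w w := fun i => by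
    rw [dotProduct, sq]
    exact Finset.single_le_sum (f := fun i => w i * w i) (fun i _ => mul_self_nonneg _)
      (Finset.mem_univ i)
  have e : dotProduct w (S.mulVec w) = ∑ i, ∑ j, w i * (S i j * w j) := by
    simp [dotProduct, Matrix.mulVec, Finset.mul_sum]
  rw [e, Finset.sum_mul]
  refine (Finset.abs_sum_le_sum_abs _ _).trans (Finset.sum_le_sum fun i _ => ?_)
  rw [Finset.sum_mul]
  refine (Finset.abs_sum_le_sum_abs _ _).trans (Finset.sum_le_sum fun j _ => ?_)
  have h1 : |w i * (S i j * w j)| = |S i j| * (|w i| * |w j|) := by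
    rw [abs_mul, abs_mul]
    ring
  rw [h1]
  refine mul_le_mul_of_nonneg_left ?_ (abs_nonneg _)
  have h2 := hsq i
  have h3 := hsq j
  nlinarith [sq_nonneg (|w i| - |w j|), sq_abs (w i), sq_abs (w j)]

/-- For `κ` large enough, the graph of `-κ` is transversal to the frame, and the quadratic form
`X (Y + κ X)ᵀ` is non-negative with kernel the intersection with the vertical space. -/
theorem IsLagrangianFrame.exists_shift {X Y : Matrix (Fin n) (Fin n) ℝ}
    (h : IsLagrangianFrame X Y) :
    ∃ κ : ℝ, (Y + κ • X).det ≠ 0 ∧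
      (∀ v, 0 ≤ dotProduct v ((X * (Y + κ • X).transpose).mulVec v)) ∧
      ∀ v, dotProduct v ((X * (Y + κ • X).transpose).mulVec v) = 0 → Matrix.vecMul v X = 0 := by
  obtain ⟨G, hG⟩ := exists_generalized_inverse X.transpose
  set S := Y.transpose * G with hS
  have hA : X * Y.transpose = X * S * X.transpose := by
    calc X * Y.transpose = Y * (X.transpose * G * X.transpose) := by rw [hG, h.symm]
      _ = X * S * X.transpose := by
        rw [← Matrix.mul_assoc, ← Matrix.mul_assoc, ← h.symm, hS]
        simp only [Matrix.mul_assoc]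
  obtain ⟨c, hc⟩ := exists_abs_dotProduct_mulVec_le S
  have key : ∀ v, dotProduct (Matrix.vecMul v X) (Matrix.vecMul v X)
      ≤ dotProduct v ((X * (Y + (c + 1) • X).transpose).mulVec v) := by
    intro v
    have h1 : dotProduct v ((X * Y.transpose).mulVec v)
        = dotProduct (Matrix.vecMul v X) (S.mulVec (Matrix.vecMul v X)) := by
      rw [hA, Matrix.dotProduct_mulVec, ← Matrix.vecMul_vecMul, ← Matrix.vecMul_vecMul,
        ← Matrix.dotProduct_mulVec, ← Matrix.dotProduct_mulVec, Matrix.mulVec_transpose]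
    have h2 : dotProduct v ((X * X.transpose).mulVec v)
        = dotProduct (Matrix.vecMul v X) (Matrix.vecMul v X) :=
      (dotProduct_vecMul_vecMul v v X X).symm
    rw [Matrix.transpose_add, Matrix.transpose_smul, Matrix.mul_add, Matrix.mul_smul,
      Matrix.add_mulVec, Matrix.smul_mulVec, dotProduct_add, dotProduct_smul, smul_eq_mul, h1, h2]
    have h3 := neg_abs_le (dotProduct (Matrix.vecMul v X) (S.mulVec (Matrix.vecMul v X)))
    have h4 := hc (Matrix.vecMul v X)
    linarith
  have hnn : ∀ w : Fin n → ℝ, 0 ≤ dotProduct w w := fun w =>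
    Finset.sum_nonneg fun i _ => mul_self_nonneg _
  have hker : ∀ v, dotProduct v ((X * (Y + (c + 1) • X).transpose).mulVec v) = 0 →
      Matrix.vecMul v X = 0 := fun v hv =>
    dotProduct_self_eq_zero.1 (le_antisymm ((key v).trans hv.le) (hnn _))
  refine ⟨c + 1, fun h0 => ?_, fun v => (hnn _).trans (key v), hker⟩
  obtain ⟨v, hv, hvM⟩ := Matrix.exists_vecMul_eq_zero_iff.2 h0
  have hX : Matrix.vecMul v X = 0 := hker v (by
    rw [← dotProduct_vecMul_vecMul, hvM, dotProduct_zero])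
  refine hv (h.indep v hX ?_)
  rwa [Matrix.vecMul_add, Matrix.vecMul_smul, hX, smul_zero, add_zero] at hvM

theorem _root_.IsCompact.eventually_forall_of_eventually_prod {α β : Type*} [TopologicalSpace β]
    {K : Set β} (hK : IsCompact K) {l : Filter α} {P : α → β → Prop}
    (h : ∀ y ∈ K, ∀ᶠ p : α × β in l ×ˢ 𝓝 y, P p.1 p.2) : ∀ᶠ t in l, ∀ y ∈ K, P t y := by
  refine hK.induction_on (p := fun S => ∀ᶠ t in l, ∀ y ∈ S, P t y) (by simp)
    (fun S T hST hT => hT.mono fun t ht y hy => ht y (hST hy))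
    (fun S T hS hT => (hS.and hT).mono fun t ht y hy => hy.elim (ht.1 y) (ht.2 y)) fun y hy => ?_
  obtain ⟨p, hp, q, hq, hpq⟩ := Filter.eventually_prod_iff.1 (h y hy)
  exact ⟨{z | q z}, mem_nhdsWithin_of_mem_nhds hq, hp.mono fun t ht z hz => hpq ht hz⟩

/-- A differentiable path of symmetric matrices which at `t₀` is positive semidefinite, with
derivative positive definite on the kernel, is positive definite right after `t₀`. Right before
`t₀` it is non-degenerate, and takes negative values if the kernel is not trivial. -/
theorem eventually_posDef_of_deriv {B : ℝ → Matrix (Fin n) (Fin n) ℝ}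
    {B' : Matrix (Fin n) (Fin n) ℝ} {t₀ : ℝ} (hB : ∀ i j, HasDerivAt (fun t => B t i j) (B' i j) t₀)
    (hs : (B t₀).IsSymm) (h0 : ∀ v, 0 ≤ dotProduct v ((B t₀).mulVec v))
    (hpos : ∀ v ≠ 0, dotProduct v ((B t₀).mulVec v) = 0 → 0 < dotProduct v (B'.mulVec v)) :
    (∀ᶠ t in 𝓝[>] t₀, ∀ v ≠ 0, 0 < dotProduct v ((B t).mulVec v)) ∧
    (∀ᶠ t in 𝓝[<] t₀, ∀ v ≠ 0, (B t).mulVec v ≠ 0) ∧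
    ∀ v ≠ 0, dotProduct v ((B t₀).mulVec v) = 0 →
      ∀ᶠ t in 𝓝[<] t₀, dotProduct v ((B t).mulVec v) < 0 := by
  -- on the unit sphere compactness makes pointwise estimates uniform
  let Sph : Set (Fin n → ℝ) := Metric.sphere 0 1
  have hcpt : IsCompact Sph := isCompact_sphere 0 1
  have hBc : Tendsto B (𝓝 t₀) (𝓝 (B t₀)) := by
    refine tendsto_pi_nhds.2 fun i => tendsto_pi_nhds.2 fun j => ?_
    exact (hB i j).continuousAt
  let D : ℝ → Matrix (Fin n) (Fin n) ℝ := fun t => (t - t₀)⁻¹ • (B t - B t₀)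
  have hD : Tendsto D (𝓝[≠] t₀) (𝓝 B') := by
    refine tendsto_pi_nhds.2 fun i => tendsto_pi_nhds.2 fun j => ?_
    exact (hasDerivAt_iff_tendsto_slope.1 (hB i j))
  have hBD : ∀ t, t ≠ t₀ → B t = B t₀ + (t - t₀) • D t := fun t ht => by
    simp only [D]
    rw [smul_smul, mul_inv_cancel₀ (sub_ne_zero.2 ht), one_smul]
    abel
  have hsym : ∀ v w, dotProduct v ((B t₀).mulVec w) = dotProduct w ((B t₀).mulVec v) := by
    intro v w
    rw [Matrix.dotProduct_mulVec, ← Matrix.mulVec_transpose, hs.eq, dotProduct_comm]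
  -- a semidefinite symmetric form degenerates only on its kernel
  have hkern : ∀ v, dotProduct v ((B t₀).mulVec v) = 0 → (B t₀).mulVec v = 0 := by
    intro v hv
    have hpsd : (B t₀).PosSemidef := Matrix.PosSemidef.of_dotProduct_mulVec_nonneg
      (by rw [Matrix.IsHermitian, Matrix.conjTranspose_eq_transpose_of_trivial]; exact hs)
      (fun x => by simpa using h0 x)
    exact (hpsd.dotProduct_mulVec_zero_iff v).1 (by simpa using hv)
  have hscale : ∀ v : Fin n → ℝ, v ≠ 0 → ‖v‖⁻¹ • v ∈ Sph := fun v hv => by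
    simp [Sph, norm_smul, hv]
  have hcont : ∀ {A : ℝ → Matrix (Fin n) (Fin n) ℝ} {A₀ : Matrix (Fin n) (Fin n) ℝ} {l : Filter ℝ}
      {x v : Fin n → ℝ}, Tendsto A l (𝓝 A₀) →
      Tendsto (fun p : ℝ × (Fin n → ℝ) => dotProduct x ((A p.1).mulVec p.2)) (l ×ˢ 𝓝 v)
        (𝓝 (dotProduct x (A₀.mulVec v))) := by
    intro A A₀ l x v hA
    have hc : Continuous fun p : Matrix (Fin n) (Fin n) ℝ × (Fin n → ℝ) =>
        dotProduct x (p.1.mulVec p.2) := by fun_prop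
    have h2 := (hA.comp tendsto_fst).prodMk_nhds (tendsto_snd (f := l) (g := 𝓝 v))
    have h3 := (hc.tendsto (A₀, v)).comp h2
    simpa only [Function.comp_def] using h3
  have hcont2 : ∀ {A : ℝ → Matrix (Fin n) (Fin n) ℝ} {A₀ : Matrix (Fin n) (Fin n) ℝ} {l : Filter ℝ}
      {v : Fin n → ℝ}, Tendsto A l (𝓝 A₀) →
      Tendsto (fun p : ℝ × (Fin n → ℝ) => dotProduct p.2 ((A p.1).mulVec p.2)) (l ×ˢ 𝓝 v)
        (𝓝 (dotProduct v (A₀.mulVec v))) := by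
    intro A A₀ l v hA
    have hc : Continuous fun p : Matrix (Fin n) (Fin n) ℝ × (Fin n → ℝ) =>
        dotProduct p.2 (p.1.mulVec p.2) := by fun_prop
    have h2 := (hA.comp tendsto_fst).prodMk_nhds (tendsto_snd (f := l) (g := 𝓝 v))
    have h3 := (hc.tendsto (A₀, v)).comp h2
    simpa only [Function.comp_def] using h3
  have hgt : 𝓝[>] t₀ ≤ 𝓝[≠] t₀ := nhdsWithin_mono _ fun t ht => ne_of_gt ht
  have hlt : 𝓝[<] t₀ ≤ 𝓝[≠] t₀ := nhdsWithin_mono _ fun t ht => ne_of_lt ht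
  refine ⟨?_, ?_, ?_⟩
  · have h1 : ∀ᶠ t in 𝓝[>] t₀, ∀ v ∈ Sph, 0 < dotProduct v ((B t).mulVec v) := by
      refine hcpt.eventually_forall_of_eventually_prod fun v hv => ?_
      have hv0 : v ≠ 0 := by
        rintro rfl
        simp [Sph] at hv
      rcases (h0 v).eq_or_lt with hz | hlt0
      · have h2 := (hcont2 (v := v) (hD.mono_left hgt)).eventually
          (lt_mem_nhds (hpos v hv0 hz.symm))
        have h3 : ∀ᶠ p : ℝ × (Fin n → ℝ) in 𝓝[>] t₀ ×ˢ 𝓝 v, t₀ < p.1 :=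
          tendsto_fst.eventually self_mem_nhdsWithin
        filter_upwards [h2, h3] with p hp1 hp2
        rw [hBD p.1 hp2.ne', Matrix.add_mulVec, Matrix.smul_mulVec, dotProduct_add,
          dotProduct_smul, smul_eq_mul]
        exact add_pos_of_nonneg_of_pos (h0 _) (mul_pos (sub_pos.2 hp2) hp1)
      · exact (hcont2 (v := v) (hBc.mono_left nhdsWithin_le_nhds)).eventually (lt_mem_nhds hlt0)
    filter_upwards [h1] with t ht v hv
    have h2 := ht _ (hscale v hv)
    rw [Matrix.mulVec_smul, dotProduct_smul, smul_dotProduct, smul_eq_mul, smul_eq_mul,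
      ← mul_assoc] at h2
    exact pos_of_mul_pos_right h2 (mul_self_nonneg _)
  · have h1 : ∀ᶠ t in 𝓝[<] t₀, ∀ v ∈ Sph, (B t).mulVec v ≠ 0 := by
      refine hcpt.eventually_forall_of_eventually_prod fun v hv => ?_
      have hv0 : v ≠ 0 := by
        rintro rfl
        simp [Sph] at hv
      by_cases hz : dotProduct v ((B t₀).mulVec v) = 0
      · have h2 := (hcont (x := v) (v := v) (hD.mono_left hlt)).eventually
          (lt_mem_nhds (hpos v hv0 hz))
        have h3 : ∀ᶠ p : ℝ × (Fin n → ℝ) in 𝓝[<] t₀ ×ˢ 𝓝 v, p.1 < t₀ :=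
          tendsto_fst.eventually self_mem_nhdsWithin
        filter_upwards [h2, h3] with p hp1 hp2 h4
        have h5 : dotProduct v ((B p.1).mulVec p.2) = 0 := by rw [h4, dotProduct_zero]
        rw [hBD p.1 hp2.ne, Matrix.add_mulVec, Matrix.smul_mulVec, dotProduct_add,
          dotProduct_smul, smul_eq_mul, hsym, hkern v hz, dotProduct_zero, zero_add] at h5
        rcases mul_eq_zero.1 h5 with h6 | h6
        · exact hp2.ne (sub_eq_zero.1 h6)
        · exact hp1.ne' h6
      · filter_upwards [(hcont2 (v := v) (hBc.mono_left nhdsWithin_le_nhds)).eventually_ne hz]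
          with p hp h4
        rw [h4, dotProduct_zero] at hp
        exact hp rfl
    filter_upwards [h1] with t ht v hv h2
    refine ht _ (hscale v hv) ?_
    rw [Matrix.mulVec_smul, h2, smul_zero]
  · intro v hv hz
    have hc : Tendsto (fun t => dotProduct v ((D t).mulVec v)) (𝓝[<] t₀)
        (𝓝 (dotProduct v (B'.mulVec v))) := by
      have hc : Continuous fun A : Matrix (Fin n) (Fin n) ℝ => dotProduct v (A.mulVec v) := by
        fun_prop
      exact (hc.tendsto B').comp (hD.mono_left hlt)
    filter_upwards [hc.eventually (lt_mem_nhds (hpos v hv hz)), self_mem_nhdsWithin] with t h1 h2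
    rw [hBD t (ne_of_lt h2), Matrix.add_mulVec, Matrix.smul_mulVec, dotProduct_add,
      dotProduct_smul, smul_eq_mul, hz, zero_add]
    exact mul_neg_of_neg_of_pos (sub_neg.2 h2) h1

/-- The jump of the Maslov angle at a crossing. If `det²` of a path of frames has the continuous
angle `a`, and the crossing form is positive at the crossing `t₀`, then the integer by which
`a` exceeds `frameAngle` is constant right after `t₀`, and larger right before `t₀`. -/
theorem frameAngle_jump {X Y : ℝ → Matrix (Fin n) (Fin n) ℝ} {Z : ℝ → Matrix (Fin n) (Fin n) ℂ}
    {a : ℝ → ℝ} {t₀ : ℝ} {s : Set ℝ} (hs : s ∈ 𝓝 t₀) (hX : ContinuousOn X s)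
    (hY : ContinuousOn Y s) (hZ : ContinuousOn Z s) (ha : ContinuousOn a s)
    (hfr : ∀ t ∈ s, IsLagrangianFrame (X t) (Y t)) (hZs : ∀ t ∈ s, Z t ∈ siegel n)
    (hau : ∀ t ∈ s, turn (a t) = phaseSq (frameMat (X t) (Y t) (Z t)).det)
    {X' Y' : Matrix (Fin n) (Fin n) ℝ} (hX' : ∀ i j, HasDerivAt (fun t => X t i j) (X' i j) t₀)
    (hY' : ∀ i j, HasDerivAt (fun t => Y t i j) (Y' i j) t₀)
    (hpos : ∀ v ≠ 0, Matrix.vecMul v (X t₀) = 0 →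
      0 < dotProduct (Matrix.vecMul v X') (Matrix.vecMul v (Y t₀)))
    (hcross : (X t₀).det = 0) :
    ∃ c, (∀ᶠ t in 𝓝[>] t₀, (X t).det ≠ 0 ∧ a t - frameAngle (X t) (Y t) (Z t) = c) ∧
      ∀ᶠ t in 𝓝[<] t₀, (X t).det ≠ 0 ∧ c < a t - frameAngle (X t) (Y t) (Z t) := by
  obtain ⟨κ, hκ0, hnn, hker⟩ := (hfr t₀ (mem_of_mem_nhds hs)).exists_shift
  have hMc : ContinuousOn (fun t => Y t + κ • X t) s := by fun_prop
  have hne : ∀ᶠ t in 𝓝 t₀, (Y t + κ • X t).det ≠ 0 :=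
    ((continuous_id.matrix_det.continuousAt.comp (hMc.continuousAt hs))).eventually_ne hκ0
  obtain ⟨ε, hε, hball⟩ := Metric.mem_nhds_iff.1 (inter_mem hs hne)
  have hA : PreconnectedSpace (Metric.ball t₀ ε) :=
    Subtype.preconnectedSpace (convex_ball t₀ ε).isPreconnected
  have hres : ∀ {β : Type} [TopologicalSpace β] {g : ℝ → β}, ContinuousOn g s →
      Continuous fun t : Metric.ball t₀ ε => g t := fun hg =>
    hg.comp_continuous continuous_subtype_val fun t => (hball t.2).1
  obtain ⟨c, hc⟩ := exists_sub_frameAngle_eq (A := Metric.ball t₀ ε) (hres hX) (hres hY) (hres hZ)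
    (hres ha) (fun t => hfr t (hball t.2).1) (fun t => hZs t (hball t.2).1)
    (fun t => hau t (hball t.2).1) (κ := κ) (fun t => (hball t.2).2)
  have hBs : ∀ t ∈ s, (X t * (Y t + κ • X t).transpose).IsSymm := fun t ht => by
    rw [Matrix.IsSymm, Matrix.transpose_mul, Matrix.transpose_transpose, Matrix.transpose_add,
      Matrix.transpose_smul, Matrix.mul_add, Matrix.add_mul, (hfr t ht).symm, Matrix.mul_smul,
      Matrix.smul_mul]
  have hderiv : ∀ i j, HasDerivAt (fun t => (X t * (Y t + κ • X t).transpose) i j)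
      ((X' * (Y t₀ + κ • X t₀).transpose + X t₀ * (Y' + κ • X').transpose) i j) t₀ := by
    intro i j
    simp only [Matrix.mul_apply, Matrix.transpose_apply, Matrix.add_apply, Matrix.smul_apply,
      smul_eq_mul]
    rw [← Finset.sum_add_distrib]
    refine HasDerivAt.fun_sum fun l _ => ?_
    exact (hX' i l).mul ((hY' j l).add ((hX' j l).const_mul κ))
  obtain ⟨h1, h2, h3⟩ := eventually_posDef_of_deriv hderiv (hBs t₀ (mem_of_mem_nhds hs)) hnn (by
    intro v hv hz
    have hvX := hker v hz
    rw [Matrix.add_mulVec, dotProduct_add, ← dotProduct_vecMul_vecMul,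
      ← dotProduct_vecMul_vecMul, hvX, zero_dotProduct, add_zero, Matrix.vecMul_add,
      Matrix.vecMul_smul, hvX, smul_zero, add_zero]
    exact hpos v hv hvX)
  have hdet : ∀ t, (∀ v ≠ 0, (X t * (Y t + κ • X t).transpose).mulVec v ≠ 0) → (X t).det ≠ 0 := by
    intro t ht h0
    have : (X t * (Y t + κ • X t).transpose).det = 0 := by rw [Matrix.det_mul, h0, zero_mul]
    obtain ⟨v, hv, hv2⟩ := Matrix.exists_mulVec_eq_zero_iff.2 this
    exact ht v hv hv2
  -- the coordinate `Q = M⁻¹ X` is congruent to `X Mᵀ`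
  have hpd : ∀ t ∈ Metric.ball t₀ ε, ((Y t + κ • X t)⁻¹ * X t).PosDef ↔
      ∀ v ≠ 0, 0 < dotProduct v ((X t * (Y t + κ • X t).transpose).mulVec v) := by
    intro t ht
    set M := Y t + κ • X t with hM
    have hMu : IsUnit M := (Matrix.isUnit_iff_isUnit_det _).2 (hball ht).2.isUnit
    have hX : X t = M * (M⁻¹ * X t) := by
      rw [← Matrix.mul_assoc, Matrix.mul_nonsing_inv _ (hball ht).2.isUnit, Matrix.one_mul]
    have h4 : (X t * M.transpose).PosDef ↔
        ∀ v ≠ 0, 0 < dotProduct v ((X t * M.transpose).mulVec v) := by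
      rw [Matrix.posDef_iff_dotProduct_mulVec]
      simp only [star_trivial]
      refine and_iff_right ?_
      rw [Matrix.IsHermitian, Matrix.conjTranspose_eq_transpose_of_trivial]
      exact hBs t (hball ht).1
    rw [← h4]
    have h5 := Matrix.IsUnit.posDef_star_right_conjugate_iff hMu (x := M⁻¹ * X t)
    rw [← h5, ← hX, Matrix.star_eq_conjTranspose, Matrix.conjTranspose_eq_transpose_of_trivial]
  have hb : Metric.ball t₀ ε ∈ 𝓝 t₀ := Metric.ball_mem_nhds t₀ hε
  refine ⟨c - n, ?_, ?_⟩
  · filter_upwards [h1, mem_nhdsWithin_of_mem_nhds hb] with t ht hbt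
    have hd := hdet t fun v hv h4 => by
      have := ht v hv
      rw [h4, dotProduct_zero] at this
      exact lt_irrefl _ this
    refine ⟨hd, ?_⟩
    rw [hc ⟨t, hbt⟩ hd, indexAngle_of_posDef ((hpd t hbt).2 ht)]
    ring
  · obtain ⟨v, hv, hvX⟩ := Matrix.exists_vecMul_eq_zero_iff.2 hcross
    have hv0 : dotProduct v ((X t₀ * (Y t₀ + κ • X t₀).transpose).mulVec v) = 0 := by
      rw [← dotProduct_vecMul_vecMul, hvX, zero_dotProduct]
    filter_upwards [h2, h3 v hv hv0, mem_nhdsWithin_of_mem_nhds hb] with t ht hneg hbt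
    have hd := hdet t ht
    refine ⟨hd, ?_⟩
    have hQs := (turn_siegelAngle_sub (hfr t (hball hbt).1).symm (hball hbt).2).1
    have hQd : ((Y t + κ • X t)⁻¹ * X t).det ≠ 0 := by
      rw [Matrix.det_mul]
      refine mul_ne_zero ?_ hd
      rw [Matrix.det_nonsing_inv, Ring.inverse_eq_inv']
      exact inv_ne_zero (hball hbt).2
    have hlt := lt_indexAngle_of_not_posDef hQs hQd fun hQ =>
      (((hpd t hbt).1 hQ) v hv).not_gt hneg
    rw [hc ⟨t, hbt⟩ hd]
    linarith

end Crossing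

/-! ### Gluing local monotonicity -/

/-- A real function that is antitone near every point is antitone. -/
theorem antitone_of_locally_antitone {g : ℝ → ℝ}
    (h : ∀ t, ∃ u ∈ 𝓝 t, AntitoneOn g u) : Antitone g := by
  intro a b hab
  -- subdivide `[a, b]` finely
  choose u hu hg using h
  have hcov : univ ⊆ ⋃ t, ((↑) : Set.Icc a b → ℝ) ⁻¹' interior (u t) := fun t _ =>
    Set.mem_iUnion.2 ⟨t, mem_interior_iff_mem_nhds.2 (hu t)⟩
  obtain ⟨t, ht0, htm, ⟨N, hN⟩, ht⟩ := exists_monotone_Icc_subset_open_cover_Icc hab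
    (fun t => isOpen_interior.preimage continuous_subtype_val) hcov
  have hle : ∀ k, g (t k) ≤ g a := by
    intro k
    induction k with
    | zero => rw [ht0]
    | succ k ih =>
      obtain ⟨i, hi⟩ := ht k
      have hk : (t k : ℝ) ≤ t (k + 1) := htm k.le_succ
      have h1 : (t k : ℝ) ∈ u i := interior_subset (hi (show t k ∈ _ from ⟨le_rfl, hk⟩))
      have h2 : (t (k + 1) : ℝ) ∈ u i := interior_subset (hi (show t (k + 1) ∈ _ from ⟨hk, le_rfl⟩))
      exact (hg i h1 h2 hk).trans ih
  have := hle N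
  rwa [hN N le_rfl] at this

/-! ### Linear symplectic geometry of the model space -/

/-- The model of the tangent spaces of a cotangent bundle: pairs `(ẋ, ẏ)`. -/
abbrev PhaseSpace (n : ℕ) : Type := Eucl n × (Eucl n →L[ℝ] ℝ)

section Linear

variable {n : ℕ}

/-- The symplectic form of the model space. -/
def stdForm (u v : PhaseSpace n) : ℝ := u.2 v.1 - v.2 u.1

theorem stdForm_swap (u v : PhaseSpace n) : stdForm u v = -stdForm v u := by
  simp [stdForm]

/-- Compatible linear complex structures on the model space. -/
structure IsCompatibleLinear (J : PhaseSpace n →L[ℝ] PhaseSpace n) : Prop where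
  sq : ∀ u, J (J u) = -u
  symplectic : ∀ u v, stdForm (J u) (J v) = stdForm u v
  positive : ∀ u, u ≠ 0 → 0 < stdForm (J u) u

variable (n) in
/-- The vertical subspace of the model space. -/
def vertical : Submodule ℝ (PhaseSpace n) where
  carrier := {u | u.1 = 0}
  add_mem' {u v} hu hv := by
    simp only [mem_ofPred_eq] at hu hv ⊢
    rw [Prod.fst_add, hu, hv, add_zero]
  zero_mem' := rfl
  smul_mem' c u hu := by
    simp only [mem_ofPred_eq] at hu ⊢
    rw [Prod.smul_fst, hu, smul_zero]

theorem mem_vertical {u : PhaseSpace n} : u ∈ vertical n ↔ u.1 = 0 := Iff.rfl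

/-- The base components of a family of vectors, as the rows of a matrix. -/
def baseMat (l : Fin n → PhaseSpace n) : Matrix (Fin n) (Fin n) ℝ :=
  Matrix.of fun i j => (l i).1 j

/-- The fibre components of a family of vectors, as the rows of a matrix. -/
def fibreMat (l : Fin n → PhaseSpace n) : Matrix (Fin n) (Fin n) ℝ :=
  Matrix.of fun i j => (l i).2 (EuclideanSpace.single j 1)

/-- The symplectic products of two families of vectors. -/
def formMat (l s : Fin n → PhaseSpace n) : Matrix (Fin n) (Fin n) ℝ :=
  Matrix.of fun i j => stdForm (l i) (s j)

/-- The hermitian products of two families of vectors. -/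
def hermMat (J : PhaseSpace n →L[ℝ] PhaseSpace n) (l s : Fin n → PhaseSpace n) :
    Matrix (Fin n) (Fin n) ℂ :=
  complexMat (formMat (fun i => J (l i)) s) (formMat l s)

variable (n) in
/-- The standard basis of the vertical subspace. -/
def vertFrame : Fin n → PhaseSpace n := fun j => (0, EuclideanSpace.proj j)

theorem clm_apply_eq_sum (φ : Eucl n →L[ℝ] ℝ) (x : Eucl n) :
    φ x = ∑ k, φ (EuclideanSpace.single k 1) * x k := by
  conv_lhs => rw [← (EuclideanSpace.basisFun (Fin n) ℝ).sum_repr x]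
  simp [map_sum, mul_comm]

theorem formMat_eq (l s : Fin n → PhaseSpace n) :
    formMat l s = fibreMat l * (baseMat s).transpose - baseMat l * (fibreMat s).transpose := by
  ext i j
  simp only [formMat, stdForm, Matrix.sub_apply, Matrix.mul_apply, Matrix.transpose_apply, baseMat,
    fibreMat, Matrix.of_apply]
  rw [clm_apply_eq_sum (l i).2, clm_apply_eq_sum (s j).2]
  congr 1
  exact Finset.sum_congr rfl fun k _ => mul_comm _ _

theorem baseMat_vertFrame : baseMat (vertFrame n) = 0 := by
  ext i j
  simp [baseMat, vertFrame]

theorem fibreMat_vertFrame : fibreMat (vertFrame n) = 1 := by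
  ext i j
  simp [fibreMat, vertFrame, Matrix.one_apply]

theorem formMat_vertFrame (l : Fin n → PhaseSpace n) : formMat l (vertFrame n) = -baseMat l := by
  rw [formMat_eq, baseMat_vertFrame, fibreMat_vertFrame, Matrix.transpose_zero, mul_zero,
    Matrix.transpose_one, mul_one, zero_sub]

theorem baseMat_sum (l : Fin n → PhaseSpace n) (v : Fin n → ℝ) (j : Fin n) :
    (∑ i, v i • l i).1 j = Matrix.vecMul v (baseMat l) j := by
  simp [Prod.fst_sum, Matrix.vecMul, dotProduct, baseMat]

theorem fibreMat_sum (l : Fin n → PhaseSpace n) (v : Fin n → ℝ) (j : Fin n) :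
    (∑ i, v i • l i).2 (EuclideanSpace.single j 1) = Matrix.vecMul v (fibreMat l) j := by
  simp [Prod.snd_sum, Matrix.vecMul, dotProduct, fibreMat]

theorem phaseSpace_ext {u v : PhaseSpace n} (h1 : ∀ j, u.1 j = v.1 j)
    (h2 : ∀ j, u.2 (EuclideanSpace.single j 1) = v.2 (EuclideanSpace.single j 1)) : u = v := by
  refine Prod.ext (PiLp.ext h1) (ContinuousLinearMap.ext fun x => ?_)
  rw [clm_apply_eq_sum, clm_apply_eq_sum v.2]
  simp only [h2]

theorem linearIndependent_vertFrame : LinearIndependent ℝ (vertFrame n) := by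
  rw [Fintype.linearIndependent_iff]
  intro v hv i
  have h := fibreMat_sum (vertFrame n) v i
  rw [hv, fibreMat_vertFrame, Matrix.vecMul_one] at h
  simpa using h.symm

theorem span_vertFrame : Submodule.span ℝ (range (vertFrame n)) = vertical n := by
  refine le_antisymm (Submodule.span_le.2 ?_) fun u hu => ?_
  · rintro _ ⟨j, rfl⟩
    rfl
  · have : u = ∑ j, u.2 (EuclideanSpace.single j 1) • vertFrame n j := by
      refine phaseSpace_ext (fun j => ?_) fun j => ?_
      · rw [baseMat_sum, baseMat_vertFrame, Matrix.vecMul_zero, mem_vertical.1 hu]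
        rfl
      · rw [fibreMat_sum, fibreMat_vertFrame, Matrix.vecMul_one]
    rw [this]
    exact Submodule.sum_mem _ fun j _ =>
      Submodule.smul_mem _ _ (Submodule.subset_span (mem_range_self j))

/-- A basis of an isotropic subspace of half the dimension is a lagrangian frame. -/
theorem isLagrangianFrame_of_isotropic {l : Fin n → PhaseSpace n} (hl : LinearIndependent ℝ l)
    (hiso : ∀ i j, stdForm (l i) (l j) = 0) : IsLagrangianFrame (baseMat l) (fibreMat l) := by
  refine ⟨?_, fun v h1 h2 => ?_⟩
  · have h : formMat l l = 0 := by
      ext i j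
      exact hiso i j
    rw [formMat_eq, sub_eq_zero] at h
    exact h.symm
  · have h0 : ∑ i, v i • l i = 0 := by
      refine phaseSpace_ext (fun j => ?_) fun j => ?_
      · rw [baseMat_sum, h1]
        rfl
      · rw [fibreMat_sum, h2]
        rfl
    exact funext (Fintype.linearIndependent_iff.1 hl v h0)

/-- The vertical components of the images of the vertical vectors under `J`. -/
def vertGram (J : PhaseSpace n →L[ℝ] PhaseSpace n) : Matrix (Fin n) (Fin n) ℝ :=
  formMat (fun i => J (vertFrame n i)) (vertFrame n)

/-- The point of the Siegel upper half space that describes the compatible complex structure `J`: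
`K + i Γ⁻¹`, where `J` maps the vertical space to the graph of `K` and `Γ` is the metric on the
vertical space. -/
def siegelOf (J : PhaseSpace n →L[ℝ] PhaseSpace n) : Matrix (Fin n) (Fin n) ℂ :=
  complexMat (-((vertGram J)⁻¹ * fibreMat fun i => J (vertFrame n i))) (vertGram J)⁻¹

variable {J : PhaseSpace n →L[ℝ] PhaseSpace n}

theorem IsCompatibleLinear.form_left (hJ : IsCompatibleLinear J) (u v : PhaseSpace n) :
    stdForm (J u) v = -stdForm u (J v) := by
  rw [← hJ.symplectic (J u) v, hJ.sq]
  simp [stdForm]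
  ring

theorem stdForm_sum_left (v : Fin n → ℝ) (l : Fin n → PhaseSpace n) (w : PhaseSpace n) :
    stdForm (∑ i, v i • l i) w = ∑ i, v i * stdForm (l i) w := by
  simp [stdForm, Prod.fst_sum, Prod.snd_sum, map_sum, mul_sub]

theorem stdForm_sum_right (v : Fin n → ℝ) (l : Fin n → PhaseSpace n) (w : PhaseSpace n) :
    stdForm w (∑ i, v i • l i) = ∑ i, v i * stdForm w (l i) := by
  simp [stdForm, Prod.fst_sum, Prod.snd_sum, map_sum, mul_sub]

theorem posDef_gram (hJ : IsCompatibleLinear J) {s : Fin n → PhaseSpace n}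
    (hs : LinearIndependent ℝ s) : (formMat (fun i => J (s i)) s).PosDef := by
  rw [Matrix.posDef_iff_dotProduct_mulVec]
  refine ⟨?_, fun v hv => ?_⟩
  · rw [Matrix.IsHermitian, Matrix.conjTranspose_eq_transpose_of_trivial]
    ext i j
    simp only [Matrix.transpose_apply, formMat, Matrix.of_apply]
    rw [hJ.form_left, stdForm_swap, neg_neg]
  · have hne : ∑ i, v i • s i ≠ 0 := fun h0 =>
      hv (funext (Fintype.linearIndependent_iff.1 hs v h0))
    have h := hJ.positive _ hne
    rw [map_sum] at h
    simp only [map_smul] at h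
    rw [stdForm_sum_left v (fun i => J (s i))] at h
    simp only [stdForm_sum_right] at h
    refine h.trans_eq ?_
    simp only [star_trivial, dotProduct, Matrix.mulVec, formMat, Matrix.of_apply, mul_comm]

theorem posDef_vertGram (hJ : IsCompatibleLinear J) : (vertGram J).PosDef :=
  posDef_gram hJ linearIndependent_vertFrame

theorem isSymm_vertGram_inv_mul (hJ : IsCompatibleLinear J) :
    ((vertGram J)⁻¹ * fibreMat fun i => J (vertFrame n i)).IsSymm := by
  refine isSymm_inv_mul ?_ (posDef_vertGram hJ).det_pos.ne'
  have h : formMat (fun i => J (vertFrame n i)) (fun i => J (vertFrame n i)) = 0 := by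
    ext i j
    simp only [formMat, Matrix.of_apply, hJ.symplectic]
    simp [stdForm, vertFrame]
  have hb : baseMat (fun i => J (vertFrame n i)) = -vertGram J := by
    rw [vertGram, formMat_vertFrame, neg_neg]
  rw [formMat_eq, sub_eq_zero, hb, Matrix.transpose_neg, mul_neg, neg_mul, neg_inj] at h
  exact h.symm

theorem siegelOf_mem (hJ : IsCompatibleLinear J) : siegelOf J ∈ siegel n :=
  complexMat_mem_siegel (isSymm_vertGram_inv_mul hJ).neg (posDef_vertGram hJ).inv

theorem hermMat_vertFrame (hJ : IsCompatibleLinear J) (l : Fin n → PhaseSpace n) :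
    hermMat J l (vertFrame n)
      = frameMat (baseMat l) (fibreMat l) (siegelOf J) * (vertGram J).map Complex.ofReal := by
  have hu : IsUnit (vertGram J).det := (posDef_vertGram hJ).det_pos.ne'.isUnit
  have hs : (vertGram J).IsSymm := isSymm_of_posDef (posDef_vertGram hJ)
  have hb : baseMat (fun i => J (vertFrame n i)) = -vertGram J := by
    rw [vertGram, formMat_vertFrame, neg_neg]
  have hP : formMat (fun i => J (l i)) (vertFrame n) = fibreMat l * vertGram J
      + baseMat l * (fibreMat fun i => J (vertFrame n i)).transpose := by
    have : formMat (fun i => J (l i)) (vertFrame n) = -formMat l fun i => J (vertFrame n i) := by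
      ext i j
      exact hJ.form_left _ _
    rw [this, formMat_eq, hb, Matrix.transpose_neg, mul_neg, hs.eq]
    abel
  have hK : ((vertGram J)⁻¹ * fibreMat fun i => J (vertFrame n i)) * vertGram J
      = (fibreMat fun i => J (vertFrame n i)).transpose := by
    rw [← (isSymm_vertGram_inv_mul hJ).eq, Matrix.transpose_mul, Matrix.transpose_nonsing_inv,
      hs.eq, Matrix.mul_assoc, Matrix.nonsing_inv_mul _ hu, mul_one]
  have h0 : (fibreMat l).map Complex.ofReal = complexMat (fibreMat l) 0 := by
    simp [complexMat]
  have hsub : ∀ A B C D : Matrix (Fin n) (Fin n) ℝ,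
      complexMat A B - complexMat C D = complexMat (A - C) (B - D) := by
    intro A B C D
    ext i j
    simp only [Matrix.sub_apply, complexMat_apply]
    rfl
  rw [hermMat, frameMat, siegelOf, map_mul_complexMat, h0, hsub, complexMat_mul_map, hP,
    formMat_vertFrame]
  congr 1
  · rw [mul_neg, sub_neg_eq_add, add_mul, Matrix.mul_assoc (baseMat l), hK]
  · rw [zero_sub, neg_mul, Matrix.mul_assoc, Matrix.nonsing_inv_mul _ hu, mul_one]

/-! ### Independence of the bases and of the symplectic coordinates -/

theorem formMat_combination_left (A : Matrix (Fin n) (Fin n) ℝ) (l s : Fin n → PhaseSpace n) :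
    formMat (fun i => ∑ k, A i k • l k) s = A * formMat l s := by
  ext i j
  simp [formMat, stdForm_sum_left, Matrix.mul_apply]

theorem formMat_combination_right (C : Matrix (Fin n) (Fin n) ℝ) (l s : Fin n → PhaseSpace n) :
    formMat l (fun i => ∑ k, C i k • s k) = formMat l s * C.transpose := by
  ext i j
  simp [formMat, stdForm_sum_right, Matrix.mul_apply, mul_comm]

theorem hermMat_combination (A C : Matrix (Fin n) (Fin n) ℝ) (l s : Fin n → PhaseSpace n) :
    hermMat J (fun i => ∑ k, A i k • l k) (fun i => ∑ k, C i k • s k)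
      = A.map Complex.ofReal * hermMat J l s * C.transpose.map Complex.ofReal := by
  rw [hermMat, hermMat, map_mul_complexMat, complexMat_mul_map, formMat_combination_right,
    formMat_combination_right, formMat_combination_left]
  simp only [map_sum, map_smul]
  rw [formMat_combination_left A (fun k => J (l k))]

/-- The matrix `R⁻¹ H Γ⁻¹`, where `H` and `R` are the hermitian and symplectic products of `l` and
`s`, and `Γ` is the Gram matrix of `s`. -/
def sigmaMat (J : PhaseSpace n →L[ℝ] PhaseSpace n) (l s : Fin n → PhaseSpace n) :
    Matrix (Fin n) (Fin n) ℂ :=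
  ((formMat l s)⁻¹).map Complex.ofReal * hermMat J l s
    * ((formMat (fun i => J (s i)) s)⁻¹).map Complex.ofReal

theorem sigmaMat_combination {A C : Matrix (Fin n) (Fin n) ℝ} (hA : A.det ≠ 0) (hC : C.det ≠ 0)
    (l s : Fin n → PhaseSpace n) :
    sigmaMat J (fun i => ∑ k, A i k • l k) (fun i => ∑ k, C i k • s k)
      = (C⁻¹.map Complex.ofReal).transpose * sigmaMat J l s * C⁻¹.map Complex.ofReal := by
  have hCt : IsUnit C.transpose.det := by
    rw [Matrix.det_transpose]
    exact hC.isUnit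
  have e1 : formMat (fun i => J (∑ k, C i k • s k)) (fun i => ∑ k, C i k • s k)
      = C * formMat (fun i => J (s i)) s * C.transpose := by
    simp only [map_sum, map_smul]
    rw [formMat_combination_right, formMat_combination_left C (fun k => J (s k))]
  have e2 : (C⁻¹.map Complex.ofReal).transpose = (C.transpose⁻¹).map Complex.ofReal := by
    rw [← Matrix.transpose_nonsing_inv]
    rfl
  have eA : (A⁻¹).map Complex.ofReal * A.map Complex.ofReal = 1 := by
    rw [← map_ofReal_mul, Matrix.nonsing_inv_mul _ hA.isUnit, map_ofReal_one]
  have eC : C.transpose.map Complex.ofReal * (C.transpose⁻¹).map Complex.ofReal = 1 := by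
    rw [← map_ofReal_mul, Matrix.mul_nonsing_inv _ hCt, map_ofReal_one]
  rw [sigmaMat, hermMat_combination, formMat_combination_right, formMat_combination_left, e1,
    Matrix.mul_inv_rev, Matrix.mul_inv_rev, Matrix.mul_inv_rev, Matrix.mul_inv_rev, map_ofReal_mul,
    map_ofReal_mul, map_ofReal_mul, map_ofReal_mul, e2, sigmaMat]
  calc _ = (C.transpose⁻¹).map Complex.ofReal * ((formMat l s)⁻¹).map Complex.ofReal
        * ((A⁻¹).map Complex.ofReal * A.map Complex.ofReal) * hermMat J l s
        * (C.transpose.map Complex.ofReal * (C.transpose⁻¹).map Complex.ofReal)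
        * ((formMat (fun i => J (s i)) s)⁻¹).map Complex.ofReal * (C⁻¹).map Complex.ofReal := by
        simp only [Matrix.mul_assoc]
    _ = _ := by
        rw [eA, eC]
        simp only [mul_one, Matrix.mul_assoc]

theorem sigmaMat_vertFrame (hJ : IsCompatibleLinear J) {l : Fin n → PhaseSpace n}
    (hl : (baseMat l).det ≠ 0) : sigmaMat J l (vertFrame n)
      = siegelOf J - ((baseMat l)⁻¹ * fibreMat l).map Complex.ofReal := by
  have hu : IsUnit (vertGram J).det := (posDef_vertGram hJ).det_pos.ne'.isUnit
  have hl' : IsUnit (-baseMat l).det := by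
    rw [Matrix.det_neg]
    exact (mul_ne_zero (pow_ne_zero _ (by norm_num)) hl).isUnit
  rw [sigmaMat, formMat_vertFrame, hermMat_vertFrame hJ, frameMat_eq_mul hl]
  change _ * (_ * _ * _) * ((vertGram J)⁻¹).map Complex.ofReal = _
  rw [Matrix.mul_assoc _ _ (((vertGram J)⁻¹).map Complex.ofReal), Matrix.mul_assoc _ _
    (((vertGram J)⁻¹).map Complex.ofReal), ← map_ofReal_mul, Matrix.mul_nonsing_inv _ hu,
    map_ofReal_one, mul_one, ← Matrix.mul_assoc, ← map_ofReal_mul, Matrix.nonsing_inv_mul _ hl',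
    map_ofReal_one, Matrix.one_mul]

/-- A frame of a subspace: a linearly independent family that spans it. -/
def IsFrame (L : Submodule ℝ (PhaseSpace n)) (l : Fin n → PhaseSpace n) : Prop :=
  LinearIndependent ℝ l ∧ Submodule.span ℝ (range l) = L

theorem isFrame_vertFrame : IsFrame (vertical n) (vertFrame n) :=
  ⟨linearIndependent_vertFrame, span_vertFrame⟩

theorem linearIndependent_coe_basis {V : Type*} [AddCommGroup V] [Module ℝ V]
    {L : Submodule ℝ V} (b : Module.Basis (Fin n) ℝ L) :
    LinearIndependent ℝ fun i => (b i : V) :=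
  b.linearIndependent.map' L.subtype L.ker_subtype

theorem span_coe_basis {V : Type*} [AddCommGroup V] [Module ℝ V]
    {L : Submodule ℝ V} (b : Module.Basis (Fin n) ℝ L) :
    Submodule.span ℝ (range fun i => (b i : V)) = L := by
  have h : (range fun i => (b i : V)) = L.subtype '' range b := by
    rw [← range_comp]
    rfl
  rw [h, Submodule.span_image, b.span_eq, Submodule.map_top, Submodule.range_subtype]

theorem isFrame_of_basis {L : Submodule ℝ (PhaseSpace n)} (b : Module.Basis (Fin n) ℝ L) :
    IsFrame L fun i => (b i : PhaseSpace n) :=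
  ⟨linearIndependent_coe_basis b, span_coe_basis b⟩

theorem IsFrame.exists_combination {L : Submodule ℝ (PhaseSpace n)} {l l' : Fin n → PhaseSpace n}
    (hl : IsFrame L l) (hl' : IsFrame L l') :
    ∃ A : Matrix (Fin n) (Fin n) ℝ, A.det ≠ 0 ∧ l' = fun i => ∑ k, A i k • l k := by
  have hmem : ∀ i, ∃ c : Fin n → ℝ, ∑ k, c k • l k = l' i := fun i => by
    rw [← Submodule.mem_span_range_iff_exists_fun, hl.2, ← hl'.2]
    exact Submodule.subset_span (mem_range_self i)
  choose A hA using hmem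
  refine ⟨Matrix.of A, fun h0 => ?_, funext fun i => (hA i).symm⟩
  obtain ⟨v, hv, hvA⟩ := Matrix.exists_vecMul_eq_zero_iff.2 h0
  refine hv (funext (Fintype.linearIndependent_iff.1 hl'.1 v ?_))
  have : ∑ i, v i • l' i = ∑ k, Matrix.vecMul v (Matrix.of A) k • l k := by
    simp only [← hA, Finset.smul_sum, smul_smul, Matrix.vecMul, dotProduct, Matrix.of_apply,
      Finset.sum_smul]
    exact Finset.sum_comm
  rw [this, hvA]
  simp

/-- The angle of `det²` of the lagrangian subspace `L` relative to the vertical subspace, computed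
on the Siegel upper half space if `L` is transversal to the vertical subspace. -/
def lagAngle (J : PhaseSpace n →L[ℝ] PhaseSpace n) (L : Submodule ℝ (PhaseSpace n)) : ℝ :=
  open Classical in
  if h : ∃ l, IsFrame L l then
    frameAngle (baseMat h.choose) (fibreMat h.choose) (siegelOf J)
  else 0

/-- Linear symplectic isomorphisms of the model space that preserve the vertical subspace. -/
structure IsVerticalSymplectic (Φ : PhaseSpace n ≃L[ℝ] PhaseSpace n) : Prop where
  form : ∀ u v, stdForm (Φ u) (Φ v) = stdForm u v
  vert : ∀ u, u.1 = 0 → (Φ u).1 = 0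

/-- The complex structure transported by `Φ`. -/
def transport (Φ : PhaseSpace n ≃L[ℝ] PhaseSpace n) (J : PhaseSpace n →L[ℝ] PhaseSpace n) :
    PhaseSpace n →L[ℝ] PhaseSpace n :=
  (Φ : PhaseSpace n →L[ℝ] PhaseSpace n).comp (J.comp (Φ.symm : PhaseSpace n →L[ℝ] PhaseSpace n))

theorem transport_apply (Φ : PhaseSpace n ≃L[ℝ] PhaseSpace n)
    (J : PhaseSpace n →L[ℝ] PhaseSpace n) (u : PhaseSpace n) :
    transport Φ J (Φ u) = Φ (J u) := by
  simp [transport]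

variable {Φ : PhaseSpace n ≃L[ℝ] PhaseSpace n} {L : Submodule ℝ (PhaseSpace n)}

theorem IsCompatibleLinear.transport (hJ : IsCompatibleLinear J) (hΦ : IsVerticalSymplectic Φ) :
    IsCompatibleLinear (transport Φ J) := by
  refine ⟨fun u => ?_, fun u v => ?_, fun u hu => ?_⟩
  · obtain ⟨u, rfl⟩ := Φ.surjective u
    rw [transport_apply, transport_apply, hJ.sq, map_neg]
  · obtain ⟨u, rfl⟩ := Φ.surjective u
    obtain ⟨v, rfl⟩ := Φ.surjective v
    rw [transport_apply, transport_apply, hΦ.form, hΦ.form, hJ.symplectic]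
  · obtain ⟨u, rfl⟩ := Φ.surjective u
    rw [transport_apply, hΦ.form]
    exact hJ.positive u fun h => hu (by rw [h, map_zero])

theorem IsVerticalSymplectic.formMat (hΦ : IsVerticalSymplectic Φ) (l s : Fin n → PhaseSpace n) :
    formMat (fun i => Φ (l i)) (fun i => Φ (s i)) = formMat l s := by
  ext i j
  exact hΦ.form _ _

theorem IsVerticalSymplectic.hermMat (hΦ : IsVerticalSymplectic Φ) (l s : Fin n → PhaseSpace n) :
    hermMat (_root_.transport Φ J) (fun i => Φ (l i)) (fun i => Φ (s i)) = hermMat J l s := by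
  rw [_root_.hermMat, _root_.hermMat, hΦ.formMat]
  simp only [transport_apply]
  rw [hΦ.formMat (fun i => J (l i))]

theorem IsFrame.map {l : Fin n → PhaseSpace n} (hl : IsFrame L l) :
    IsFrame (L.map (Φ : PhaseSpace n →ₗ[ℝ] PhaseSpace n)) fun i => Φ (l i) := by
  refine ⟨hl.1.map' (Φ : PhaseSpace n →ₗ[ℝ] PhaseSpace n) (LinearMap.ker_eq_bot.2 Φ.injective), ?_⟩
  rw [← hl.2, Submodule.map_span, ← range_comp]
  rfl

theorem IsFrame.of_map {l : Fin n → PhaseSpace n}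
    (hl : IsFrame (L.map (Φ : PhaseSpace n →ₗ[ℝ] PhaseSpace n)) l) :
    IsFrame L fun i => Φ.symm (l i) := by
  have h := hl.map (Φ := Φ.symm)
  rwa [← Submodule.map_comp, show (Φ.symm : PhaseSpace n →ₗ[ℝ] PhaseSpace n) ∘ₗ
    (Φ : PhaseSpace n →ₗ[ℝ] PhaseSpace n) = LinearMap.id from
    LinearMap.ext fun u => Φ.symm_apply_apply u, Submodule.map_id] at h

theorem IsVerticalSymplectic.map_vertical (hΦ : IsVerticalSymplectic Φ) :
    (vertical n).map (Φ : PhaseSpace n →ₗ[ℝ] PhaseSpace n) = vertical n := by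
  refine Submodule.eq_of_le_of_finrank_eq ?_ ?_
  · rintro _ ⟨u, hu, rfl⟩
    exact hΦ.vert u hu
  · exact LinearEquiv.finrank_map_eq Φ.toLinearEquiv (vertical n)

/-- Data of a frame in other symplectic coordinates, compared with a frame in the given ones. -/
theorem IsVerticalSymplectic.exists_combination (hΦ : IsVerticalSymplectic Φ)
    {l l' : Fin n → PhaseSpace n} (hl : IsFrame L l)
    (hl' : IsFrame (L.map (Φ : PhaseSpace n →ₗ[ℝ] PhaseSpace n)) l') {s : Fin n → PhaseSpace n}
    (hs : IsFrame (vertical n) s) :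
    ∃ A C : Matrix (Fin n) (Fin n) ℝ, A.det ≠ 0 ∧ C.det ≠ 0 ∧
      l' = (fun i => ∑ k, A i k • Φ (l k)) ∧ vertFrame n = fun i => ∑ k, C i k • Φ (s k) := by
  obtain ⟨A, hA, hl'A⟩ := (hl.map (Φ := Φ)).exists_combination hl'
  have h := hs.map (Φ := Φ)
  rw [hΦ.map_vertical] at h
  obtain ⟨C, hC, hCs⟩ := h.exists_combination isFrame_vertFrame
  exact ⟨A, C, hA, hC, hl'A, hCs⟩

/-- `det²` of `L` relative to the vertical space is computed by `frameMat` in any symplectic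
coordinates that preserve the vertical space. -/
theorem phaseSq_det_hermMat_eq (hJ : IsCompatibleLinear J) (hΦ : IsVerticalSymplectic Φ)
    {l l' : Fin n → PhaseSpace n} (hl : IsFrame L l)
    (hl' : IsFrame (L.map (Φ : PhaseSpace n →ₗ[ℝ] PhaseSpace n)) l') {s : Fin n → PhaseSpace n}
    (hs : IsFrame (vertical n) s) :
    phaseSq (hermMat J l s).det
      = phaseSq (frameMat (baseMat l') (fibreMat l') (siegelOf (transport Φ J))).det := by
  obtain ⟨A, C, hA, hC, hl'A, hCs⟩ := hΦ.exists_combination hl hl' hs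
  have hJ' := hJ.transport hΦ
  have h := hermMat_vertFrame hJ' l'
  have h2 : hermMat (transport Φ J) l' (vertFrame n)
      = A.map Complex.ofReal * hermMat J l s * C.transpose.map Complex.ofReal := by
    rw [hCs, hl'A, hermMat_combination A C (fun k => Φ (l k)) (fun k => Φ (s k)), hΦ.hermMat]
  have hCt : C.transpose.det ≠ 0 := by rwa [Matrix.det_transpose]
  rw [← phaseSq_det_map_mul hA, ← phaseSq_det_mul_map hCt, ← h2, h,
    phaseSq_det_mul_map (posDef_vertGram hJ').det_pos.ne']

theorem det_baseMat_eq_zero_iff {l : Fin n → PhaseSpace n} (hl : IsFrame L l) :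
    (baseMat l).det = 0 ↔ L ⊓ vertical n ≠ ⊥ := by
  rw [← Matrix.exists_vecMul_eq_zero_iff, Submodule.ne_bot_iff]
  constructor
  · rintro ⟨v, hv, hvX⟩
    refine ⟨∑ i, v i • l i, ⟨?_, ?_⟩, fun h0 =>
      hv (funext (Fintype.linearIndependent_iff.1 hl.1 v h0))⟩
    · rw [← hl.2]
      exact Submodule.sum_mem _ fun j _ =>
        Submodule.smul_mem _ _ (Submodule.subset_span (mem_range_self j))
    · refine PiLp.ext fun j => ?_
      rw [baseMat_sum, hvX]
      rfl
  · rintro ⟨u, ⟨hu1, hu2⟩, hu0⟩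
    have hu1' : u ∈ L := hu1
    rw [← hl.2, Submodule.mem_span_range_iff_exists_fun] at hu1'
    obtain ⟨v, rfl⟩ := hu1'
    refine ⟨v, fun h0 => hu0 (by simp [h0]), funext fun j => ?_⟩
    rw [← baseMat_sum, mem_vertical.1 hu2]
    rfl

theorem det_baseMat_eq_zero_iff_of_map (hΦ : IsVerticalSymplectic Φ) {l' : Fin n → PhaseSpace n}
    (hl' : IsFrame (L.map (Φ : PhaseSpace n →ₗ[ℝ] PhaseSpace n)) l') :
    (baseMat l').det = 0 ↔ L ⊓ vertical n ≠ ⊥ := by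
  have hinj : Function.Injective (Φ : PhaseSpace n →ₗ[ℝ] PhaseSpace n) := Φ.injective
  have h : L.map (Φ : PhaseSpace n →ₗ[ℝ] PhaseSpace n) ⊓ vertical n
      = (L ⊓ vertical n).map (Φ : PhaseSpace n →ₗ[ℝ] PhaseSpace n) := by
    rw [Submodule.map_inf _ hinj, hΦ.map_vertical]
  rw [det_baseMat_eq_zero_iff hl', h, ne_eq, ne_eq,
    ← LinearMap.le_ker_iff_map, LinearMap.ker_eq_bot.2 hinj, le_bot_iff]

/-- The angle of a transversal lagrangian subspace does not depend on the frame, nor on the symplectic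
coordinates as long as they preserve the vertical space. -/
theorem lagAngle_eq (hJ : IsCompatibleLinear J) (hΦ : IsVerticalSymplectic Φ)
    (hiso : ∀ u ∈ L, ∀ v ∈ L, stdForm u v = 0) {l' : Fin n → PhaseSpace n}
    (hl' : IsFrame (L.map (Φ : PhaseSpace n →ₗ[ℝ] PhaseSpace n)) l') (hdet : (baseMat l').det ≠ 0) :
    lagAngle J L = frameAngle (baseMat l') (fibreMat l') (siegelOf (transport Φ J)) := by
  have hex : ∃ l, IsFrame L l := ⟨_, hl'.of_map⟩
  rw [lagAngle, dif_pos hex]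
  set l := hex.choose
  have hl : IsFrame L l := hex.choose_spec
  have hdl : (baseMat l).det ≠ 0 := by
    rw [ne_eq, det_baseMat_eq_zero_iff hl, ← det_baseMat_eq_zero_iff_of_map hΦ hl']
    exact hdet
  obtain ⟨A, C, hA, hC, hl'A, hCs⟩ := hΦ.exists_combination hl hl' isFrame_vertFrame
  have hJ' := hJ.transport hΦ
  have hmem : ∀ i, l i ∈ L := fun i => by
    rw [← hl.2]
    exact Submodule.subset_span (mem_range_self i)
  have hfr := isLagrangianFrame_of_isotropic hl.1 fun i j => hiso _ (hmem i) _ (hmem j)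
  have hσ : sigmaMat (transport Φ J) l' (vertFrame n)
      = (C⁻¹.map Complex.ofReal).transpose * sigmaMat J l (vertFrame n)
        * C⁻¹.map Complex.ofReal := by
    have e : sigmaMat (transport Φ J) (fun k => Φ (l k)) (fun k => Φ (vertFrame n k))
        = sigmaMat J l (vertFrame n) := by
      rw [sigmaMat, sigmaMat, hΦ.hermMat, hΦ.formMat]
      simp only [transport_apply]
      rw [hΦ.formMat (fun i => J (vertFrame n i))]
    rw [← e, ← sigmaMat_combination hA hC, ← hl'A, ← hCs]
  have hC' : (C⁻¹).det ≠ 0 := by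
    rw [Matrix.det_nonsing_inv, Ring.inverse_eq_inv']
    exact inv_ne_zero hC
  rw [frameAngle, frameAngle, ← sigmaMat_vertFrame hJ hdl, ← sigmaMat_vertFrame hJ' hdet, hσ,
    siegelAngle_congr hC']
  rw [sigmaMat_vertFrame hJ hdl]
  exact hfr.sub_mem_siegel hdl (siegelOf_mem hJ)

end Linear

/-! ### Changes of charts of the cotangent bundle -/

section ChartChange

variable {n : ℕ}

/-- The coordinate change of a cotangent bundle that is induced by a coordinate change `η` with
inverse `η'` is symplectic, because the second derivative of `η'` is symmetric. -/
theorem hasFDerivAt_cotangentChange {η η' : Eucl n → Eucl n} {u : PhaseSpace n}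
    (hη : DifferentiableAt ℝ η u.1) (hη' : ContDiffAt ℝ ∞ η' (η u.1))
    (hinv : ∀ᶠ x in 𝓝 u.1, η' (η x) = x) :
    ∃ T' : PhaseSpace n →L[ℝ] PhaseSpace n,
      HasFDerivAt (fun p : PhaseSpace n => (η p.1, p.2.comp (fderiv ℝ η' (η p.1)))) T' u ∧
      (∀ v w, stdForm (T' v) (T' w) = stdForm v w) ∧ ∀ v, v.1 = 0 → (T' v).1 = 0 := by
  have h1 : HasFDerivAt (fun p : PhaseSpace n => η p.1)
      ((fderiv ℝ η u.1).comp (ContinuousLinearMap.fst ℝ (Eucl n) (Eucl n →L[ℝ] ℝ))) u :=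
    hη.hasFDerivAt.comp u hasFDerivAt_fst
  have h2 : DifferentiableAt ℝ (fderiv ℝ η') (η u.1) :=
    (hη'.fderiv_right (m := 1) (by norm_cast)).differentiableAt one_ne_zero
  have h3 : HasFDerivAt (fun p : PhaseSpace n => fderiv ℝ η' (η p.1))
      ((fderiv ℝ (fderiv ℝ η') (η u.1)).comp
        ((fderiv ℝ η u.1).comp (ContinuousLinearMap.fst ℝ (Eucl n) (Eucl n →L[ℝ] ℝ)))) u :=
    h2.hasFDerivAt.comp u h1
  have h4 := (hasFDerivAt_snd (𝕜 := ℝ) (p := u)).clm_comp h3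
  refine ⟨_, h1.prodMk h4, fun v w => ?_, fun v hv => ?_⟩
  · have hsymm : ∀ a b, fderiv ℝ (fderiv ℝ η') (η u.1) a b = fderiv ℝ (fderiv ℝ η') (η u.1) b a :=
      fun a b => (hη'.isSymmSndFDerivAt (by simp; norm_cast)).eq a b
    have hid : ∀ a, fderiv ℝ η' (η u.1) (fderiv ℝ η u.1 a) = a := fun a => by
      have hc : HasFDerivAt (fun x => η' (η x)) ((fderiv ℝ η' (η u.1)).comp (fderiv ℝ η u.1)) u.1 :=
        (hη'.differentiableAt (by simp)).hasFDerivAt.comp u.1 hη.hasFDerivAt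
      have hi : HasFDerivAt (fun x => η' (η x)) (ContinuousLinearMap.id ℝ (Eucl n)) u.1 :=
        (hasFDerivAt_id u.1).congr_of_eventuallyEq hinv
      exact congrArg (fun T : Eucl n →L[ℝ] Eucl n => T a) (hc.unique hi)
    simp [stdForm, hid, hsymm (fderiv ℝ η u.1 v.1) (fderiv ℝ η u.1 w.1)]
  · simp [hv]

end ChartChange

theorem mem_extChartAt_base_source {n : ℕ} {Q : Type*} [TopologicalSpace Q]
    [ChartedSpace (Eucl n) Q] {q q' : Q} :
    q' ∈ (extChartAt (𝓡 n) q).source ↔ q' ∈ (chartAt (Eucl n) q).source := by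
  rw [extChartAt_source]

section Cotangent

variable {n : ℕ} {Q : Type*} [TopologicalSpace Q] [ChartedSpace (Eucl n) Q]
  [IsManifold (𝓡 n) ∞ Q]

/-- The preferred chart of `T^*Q` at `θ₀`, as a map to the model space. -/
abbrev cotangentChart (θ₀ : CotangentBundle n Q) : CotangentBundle n Q → PhaseSpace n :=
  extChartAt (cotangentModel n) θ₀

theorem mem_cotangentChart_source {θ₀ θ : CotangentBundle n Q} :
    θ ∈ (chartAt (ModelProd (Eucl n) (Eucl n →L[ℝ] ℝ)) θ₀).source ↔
      θ.proj ∈ (chartAt (Eucl n) θ₀.proj).source := by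
  rw [FiberBundle.chartedSpace_chartAt]
  simp only [OpenPartialHomeomorph.trans_source, OpenPartialHomeomorph.prod_source,
    OpenPartialHomeomorph.refl_source, mem_inter_iff, mem_preimage, mem_prod, mem_univ, and_true,
    Bundle.Trivialization.mem_source]
  constructor
  · rintro ⟨h, -⟩
    simpa using h
  · intro h
    exact ⟨by simpa using h, h⟩

theorem cotangentChart_fst (θ₀ θ : CotangentBundle n Q) :
    (cotangentChart θ₀ θ).1 = extChartAt (𝓡 n) θ₀.proj θ.proj := by
  rw [cotangentChart, FiberBundle.extChartAt]
  rfl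

theorem cotangentChart_snd_apply {θ₀ θ : CotangentBundle n Q} (v : Eucl n) :
    (cotangentChart θ₀ θ).2 v
      = θ.2 ((trivializationAt (Eucl n) (TangentSpace (𝓡 n)) θ₀.proj).symmL ℝ θ.proj v) := by
  rw [cotangentChart, FiberBundle.extChartAt]
  change (ContinuousLinearMap.inCoordinates _ _ _ _ _ _ _ _ θ.2) v = _
  rw [ContinuousLinearMap.inCoordinates]
  simp

theorem cotangentChart_eq {θ₀ θ₁ θ : CotangentBundle n Q}
    (h0 : θ.proj ∈ (chartAt (Eucl n) θ₀.proj).source)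
    (h1 : θ.proj ∈ (chartAt (Eucl n) θ₁.proj).source) :
    cotangentChart θ₀ θ = (extChartAt (𝓡 n) θ₀.proj θ.proj,
      (cotangentChart θ₁ θ).2.comp (fderiv ℝ (extChartAt (𝓡 n) θ₁.proj ∘
        (extChartAt (𝓡 n) θ₀.proj).symm) (extChartAt (𝓡 n) θ₀.proj θ.proj))) := by
  refine Prod.ext (cotangentChart_fst _ _) (ContinuousLinearMap.ext fun v => ?_)
  rw [cotangentChart_snd_apply, ContinuousLinearMap.comp_apply, cotangentChart_snd_apply]
  congr 1
  rw [TangentBundle.symmL_trivializationAt_eq_core h0, TangentBundle.symmL_trivializationAt_eq_core h1]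
  have h := tangentCoordChange_comp (I := 𝓡 n) (w := θ₀.proj) (x := θ₁.proj) (y := θ.proj)
    (z := θ.proj) (v := v) (by simpa using ⟨h0, h1⟩)
  refine h.symm.trans ?_
  rw [tangentCoordChange_def (x := θ₀.proj) (y := θ₁.proj), modelWithCornersSelf_coe, range_id,
    fderivWithin_univ]
  rfl

theorem contDiffAt_extChartAt_base {q₀ q q' : Q} (h0 : q' ∈ (chartAt (Eucl n) q₀).source)
    (h : q' ∈ (chartAt (Eucl n) q).source) :
    ContDiffAt ℝ ∞ (extChartAt (𝓡 n) q₀ ∘ (extChartAt (𝓡 n) q).symm) (extChartAt (𝓡 n) q q') := by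
  have h' := contDiffWithinAt_ext_coord_change (I := 𝓡 n) (n := ∞) q₀ q
    (y := extChartAt (𝓡 n) q q') (by
      rw [PartialEquiv.trans_source'', PartialEquiv.symm_symm, PartialEquiv.symm_target]
      exact mem_image_of_mem _
        ⟨mem_extChartAt_base_source.2 h, mem_extChartAt_base_source.2 h0⟩)
  rwa [modelWithCornersSelf_coe, range_id, contDiffWithinAt_univ] at h'

/-- In the coordinates of two charts of `T^*Q`, tangent vectors are related by a symplectic
isomorphism that preserves the vertical subspace. -/
theorem exists_isVerticalSymplectic {θ₀ θ : CotangentBundle n Q}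
    (h : θ.proj ∈ (chartAt (Eucl n) θ₀.proj).source) :
    ∃ Φ : PhaseSpace n ≃L[ℝ] PhaseSpace n, IsVerticalSymplectic Φ ∧
      (Φ : PhaseSpace n →L[ℝ] PhaseSpace n)
        = mfderiv (cotangentModel n) 𝓘(ℝ, PhaseSpace n) (cotangentChart θ₀) θ := by
  have hsrc : θ ∈ (chartAt (ModelProd (Eucl n) (Eucl n →L[ℝ] ℝ)) θ₀).source :=
    mem_cotangentChart_source.2 h
  have hmd := mdifferentiableAt_extChartAt (I := cotangentModel n) hsrc
  obtain ⟨Φ, hΦ⟩ : ∃ Φ : PhaseSpace n ≃L[ℝ] PhaseSpace n, (Φ : PhaseSpace n →L[ℝ] PhaseSpace n)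
      = mfderiv (cotangentModel n) 𝓘(ℝ, PhaseSpace n) (cotangentChart θ₀) θ :=
    isInvertible_mfderiv_extChartAt (I := cotangentModel n) (x := θ₀) (y := θ)
      (by rwa [extChartAt_source])
  refine ⟨Φ, ?_, hΦ⟩
  have hq : θ.proj ∈ (chartAt (Eucl n) θ.proj).source := mem_chart_source _ _
  have hu : (cotangentChart θ θ).1 = extChartAt (𝓡 n) θ.proj θ.proj := cotangentChart_fst _ _
  have hηq : (extChartAt (𝓡 n) θ₀.proj ∘ (extChartAt (𝓡 n) θ.proj).symm)
      (cotangentChart θ θ).1 = extChartAt (𝓡 n) θ₀.proj θ.proj := by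
    rw [hu, Function.comp_apply, extChartAt_to_inv]
  obtain ⟨T', hT', hform, hvert⟩ := hasFDerivAt_cotangentChange
    (η := extChartAt (𝓡 n) θ₀.proj ∘ (extChartAt (𝓡 n) θ.proj).symm)
    (η' := extChartAt (𝓡 n) θ.proj ∘ (extChartAt (𝓡 n) θ₀.proj).symm) (u := cotangentChart θ θ)
    (by
      rw [hu]
      exact (contDiffAt_extChartAt_base h hq).differentiableAt (by simp))
    (by
      rw [hηq]
      exact contDiffAt_extChartAt_base hq h)
    (by
      rw [hu]
      have h1 : ∀ᶠ x in 𝓝 (extChartAt (𝓡 n) θ.proj θ.proj),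
          (extChartAt (𝓡 n) θ.proj).symm x ∈ (extChartAt (𝓡 n) θ₀.proj).source := by
        refine (continuousAt_extChartAt_symm θ.proj).eventually_mem ?_
        rw [extChartAt_to_inv]
        exact extChartAt_source_mem_nhds' (mem_extChartAt_base_source.2 h)
      filter_upwards [h1, extChartAt_target_mem_nhds (I := 𝓡 n) θ.proj] with x hx1 hx2
      simp only [Function.comp_apply]
      rw [(extChartAt (𝓡 n) θ₀.proj).left_inv hx1, (extChartAt (𝓡 n) θ.proj).right_inv hx2])
  have hΦT : (Φ : PhaseSpace n →L[ℝ] PhaseSpace n) = T' := by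
    rw [hΦ]
    refine HasMFDerivAt.mfderiv ⟨hmd.continuousAt,
      (hT'.congr_of_eventuallyEq ?_).hasFDerivWithinAt⟩
    have hc := continuousAt_extChartAt_symm (I := cotangentModel n) θ
    have h0 : ∀ᶠ p in 𝓝 (cotangentChart θ θ), (extChartAt (cotangentModel n) θ).symm p
        ∈ (extChartAt (cotangentModel n) θ₀).source := by
      refine hc.eventually_mem ?_
      rw [extChartAt_to_inv]
      exact extChartAt_source_mem_nhds' (by rwa [extChartAt_source])
    filter_upwards [h0, extChartAt_target_mem_nhds (I := cotangentModel n) θ] with p hp0 hp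
    have hps := (extChartAt (cotangentModel n) θ).map_target hp
    have e : cotangentChart θ ((extChartAt (cotangentModel n) θ).symm p) = p :=
      (extChartAt (cotangentModel n) θ).right_inv hp
    rw [extChartAt_source] at hps hp0
    rw [mem_cotangentChart_source] at hps hp0
    change cotangentChart θ₀ ((extChartAt (cotangentModel n) θ).symm p) = _
    have e1 : p.1 = extChartAt (𝓡 n) θ.proj ((extChartAt (cotangentModel n) θ).symm p).proj := by
      rw [← cotangentChart_fst, e]
    have e2 : (extChartAt (𝓡 n) θ₀.proj ∘ (extChartAt (𝓡 n) θ.proj).symm) p.1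
        = extChartAt (𝓡 n) θ₀.proj ((extChartAt (cotangentModel n) θ).symm p).proj := by
      rw [e1, Function.comp_apply, (extChartAt (𝓡 n) θ.proj).left_inv
        (mem_extChartAt_base_source.2 hps)]
    rw [cotangentChart_eq hp0 hps, e, e2]
  refine ⟨fun v w => ?_, fun v hv => ?_⟩
  · have := hform v w
    rwa [← hΦT] at this
  · have := hvert v hv
    rwa [← hΦT] at this

/-- In the coordinates `(ẋ, ẏ)` of a tangent space of `T^*Q` the vertical space is `ẋ = 0`. -/
theorem verticalSpace_eq (θ : CotangentBundle n Q) : verticalSpace θ = vertical n := by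
  have hmd : MDifferentiableAt (cotangentModel n) (𝓡 n) (footpoint (n := n) (Q := Q)) θ :=
    (Bundle.contMDiffAt_proj (fun x : Q => TangentSpace (𝓡 n) x →L[ℝ] Bundle.Trivial Q ℝ x)
      (n := ∞)).mdifferentiableAt (by simp)
  have h : mfderiv (cotangentModel n) (𝓡 n) (footpoint (n := n) (Q := Q)) θ
      = ContinuousLinearMap.fst ℝ (Eucl n) (Eucl n →L[ℝ] ℝ) := by
    refine HasMFDerivAt.mfderiv ⟨hmd.continuousAt,
      (hasFDerivAt_fst.congr_of_eventuallyEq ?_).hasFDerivWithinAt⟩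
    filter_upwards [extChartAt_target_mem_nhds (I := cotangentModel n) θ] with p hp
    have e : cotangentChart θ ((extChartAt (cotangentModel n) θ).symm p) = p :=
      (extChartAt (cotangentModel n) θ).right_inv hp
    change extChartAt (𝓡 n) θ.proj ((extChartAt (cotangentModel n) θ).symm p).proj = p.1
    rw [← cotangentChart_fst, e]
  rw [verticalSpace, h]
  rfl

end Cotangent

/-! ### Immersions and submersions in charts -/

section Charts

variable {E E' H G M N : Type*} [NormedAddCommGroup E] [NormedSpace ℝ E]
  [NormedAddCommGroup E'] [NormedSpace ℝ E'] [TopologicalSpace H] [TopologicalSpace G]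
  {I : ModelWithCorners ℝ E H} {I' : ModelWithCorners ℝ E' G}
  [TopologicalSpace M] [ChartedSpace H M] [TopologicalSpace N] [ChartedSpace G N]

theorem mfderiv_bijective_of_mem_maximalAtlas [IsManifold I ∞ M] {e : OpenPartialHomeomorph M H}
    (he : e ∈ IsManifold.maximalAtlas I ∞ M) {x : M} (hx : x ∈ e.source) :
    Function.Bijective (mfderiv I I e x) := by
  have hmd : e.MDifferentiable I I :=
    ⟨(contMDiffOn_of_mem_maximalAtlas he).mdifferentiableOn (by simp),
      (contMDiffOn_symm_of_mem_maximalAtlas he).mdifferentiableOn (by simp)⟩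
  exact hmd.mfderiv_bijective hx

theorem hasMFDerivAt_of_mem_maximalAtlas {e : OpenPartialHomeomorph M H}
    (he : e ∈ IsManifold.maximalAtlas I ∞ M) {x : M} (hx : x ∈ e.source) :
    HasMFDerivAt I I e x (mfderiv I I e x) :=
  (((contMDiffOn_of_mem_maximalAtlas he).contMDiffAt
    (e.open_source.mem_nhds hx)).mdifferentiableAt (by simp)).hasMFDerivAt

theorem _root_.Manifold.IsImmersionAt.mfderiv_injective [IsManifold I ∞ M] [IsManifold I' ∞ N]
    {f : M → N} {x : M} (h : IsImmersionAt I I' ∞ f x) :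
    Function.Injective (mfderiv I I' f x) := by
  have hf : HasMFDerivAt I I' f x (mfderiv I I' f x) :=
    (h.contMDiffAt.mdifferentiableAt (by simp)).hasMFDerivAt
  have hd := hasMFDerivAt_of_mem_maximalAtlas h.domChart_mem_maximalAtlas h.mem_domChart_source
  have hc := hasMFDerivAt_of_mem_maximalAtlas h.codChart_mem_maximalAtlas h.mem_codChart_source
  have h1 := (I'.hasMFDerivAt (x := h.codChart (f x))).comp x (hc.comp x hf)
  have hL : HasFDerivAt (fun y : E => h.equiv (y, (0 : h.complement)))
      ((h.equiv : E × h.complement →L[ℝ] E').comp (ContinuousLinearMap.inl ℝ E h.complement))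
      (I (h.domChart x)) :=
    ((h.equiv : E × h.complement →L[ℝ] E').comp
      (ContinuousLinearMap.inl ℝ E h.complement)).hasFDerivAt
  have h2 := hL.hasMFDerivAt.comp x ((I.hasMFDerivAt (x := h.domChart x)).comp x hd)
  have heq : (I' ∘ h.codChart ∘ f)
      =ᶠ[𝓝 x] (fun y : E => h.equiv (y, (0 : h.complement))) ∘ I ∘ h.domChart := by
    filter_upwards [h.domChart.open_source.mem_nhds h.mem_domChart_source] with y hy
    have hw := h.writtenInCharts ((h.domChart.extend I).map_source
      (by rwa [OpenPartialHomeomorph.extend_source]))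
    simp only [Function.comp_apply] at hw
    rw [(h.domChart.extend I).left_inv (by rwa [OpenPartialHomeomorph.extend_source])] at hw
    exact hw
  have hu := hasMFDerivAt_unique h1 (h2.congr_of_eventuallyEq heq)
  intro v w hvw
  have hv := congrArg (fun T : E →L[ℝ] E' => T v) hu
  have hw := congrArg (fun T : E →L[ℝ] E' => T w) hu
  have key : h.equiv ((mfderiv I I h.domChart x v : E), (0 : h.complement))
      = h.equiv ((mfderiv I I h.domChart x w : E), (0 : h.complement)) := by
    refine hv.symm.trans (Eq.trans ?_ hw)
    change mfderiv I' I' h.codChart (f x) (mfderiv I I' f x v)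
      = mfderiv I' I' h.codChart (f x) (mfderiv I I' f x w)
    rw [hvw]
  exact (mfderiv_bijective_of_mem_maximalAtlas h.domChart_mem_maximalAtlas
    h.mem_domChart_source).1 (Prod.mk.inj (h.equiv.injective key)).1

end Charts

section Slices

variable {m k n : ℕ} {M : Type*} [TopologicalSpace M] [ChartedSpace (Eucl m) M]
  {B : Type*} [TopologicalSpace B] [ChartedSpace (Eucl k) B]
  [IsManifold (𝓡 k) ∞ B]

/-- In a chart followed by a linear isomorphism that straightens the submersion `f`, the kernel of
`df` is the second factor. -/
theorem mem_ker_mfderiv_iff {F : Type*} [NormedAddCommGroup F] [NormedSpace ℝ F] {f : M → B}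
    (hf : ContMDiff (𝓡 m) (𝓡 k) ∞ f) {e : OpenPartialHomeomorph M (Eucl m)}
    (he : e ∈ IsManifold.maximalAtlas (𝓡 m) ∞ M) {χ : OpenPartialHomeomorph B (Eucl k)}
    (hχ : χ ∈ IsManifold.maximalAtlas (𝓡 k) ∞ B) (hsrc : e.source ⊆ f ⁻¹' χ.source)
    {L : Eucl m ≃L[ℝ] Eucl k × F} (hL : ∀ z ∈ e.source, χ (f z) = (L (e z)).1) {z : M}
    (hz : z ∈ e.source) (v : TangentSpace (𝓡 m) z) :
    v ∈ (mfderiv (𝓡 m) (𝓡 k) f z).ker ↔ (L (mfderiv (𝓡 m) (𝓡 m) e z v : Eucl m)).1 = 0 := by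
  have hf' : HasMFDerivAt (𝓡 m) (𝓡 k) f z (mfderiv (𝓡 m) (𝓡 k) f z) :=
    (hf.contMDiffAt.mdifferentiableAt (by simp)).hasMFDerivAt
  have hd := hasMFDerivAt_of_mem_maximalAtlas he hz
  have hc := hasMFDerivAt_of_mem_maximalAtlas hχ (hsrc hz)
  have hL' : HasFDerivAt (fun y : Eucl m => (L y).1)
      ((ContinuousLinearMap.fst ℝ (Eucl k) F).comp (L : Eucl m →L[ℝ] Eucl k × F)) (e z) :=
    ((ContinuousLinearMap.fst ℝ (Eucl k) F).comp (L : Eucl m →L[ℝ] Eucl k × F)).hasFDerivAt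
  have h2 := hL'.hasMFDerivAt.comp z hd
  have heq : (χ ∘ f) =ᶠ[𝓝 z] (fun y : Eucl m => (L y).1) ∘ e := by
    filter_upwards [e.open_source.mem_nhds hz] with y hy
    exact hL y hy
  have hu := hasMFDerivAt_unique (hc.comp z hf') (h2.congr_of_eventuallyEq heq)
  have hv := congrArg (fun T : Eucl m →L[ℝ] Eucl k => T v) hu
  have hv' : (mfderiv (𝓡 k) (𝓡 k) χ (f z) (mfderiv (𝓡 m) (𝓡 k) f z v) : Eucl k)
      = (L (mfderiv (𝓡 m) (𝓡 m) e z v : Eucl m)).1 := hv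
  rw [← hv', LinearMap.mem_ker]
  constructor
  · intro h
    change mfderiv (𝓡 m) (𝓡 k) f z v = 0 at h
    rw [h, map_zero]
    rfl
  · intro h
    refine (mfderiv_bijective_of_mem_maximalAtlas hχ (hsrc hz)).1 ?_
    rw [map_zero]
    exact h

/-- Charts in which a submersion whose fibres have dimension `n` is the first projection of
`ℝᵏ × ℝⁿ`. -/
theorem exists_slice_chart [IsManifold (𝓡 m) ∞ M] {f : M → B} (hf : IsSubmersion (𝓡 m) (𝓡 k) ∞ f)
    (z₀ : M) (hn : Module.finrank ℝ (mfderiv (𝓡 m) (𝓡 k) f z₀).ker = n) :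
    ∃ (e : OpenPartialHomeomorph M (Eucl m)) (L : Eucl m ≃L[ℝ] Eucl k × Eucl n)
      (χ : OpenPartialHomeomorph B (Eucl k)), z₀ ∈ e.source ∧
      e ∈ IsManifold.maximalAtlas (𝓡 m) ∞ M ∧ χ ∈ IsManifold.maximalAtlas (𝓡 k) ∞ B ∧
      e.source ⊆ f ⁻¹' χ.source ∧ ∀ z ∈ e.source, χ (f z) = (L (e z)).1 := by
  have h := hf.isSubmersionAt z₀
  have hw : ∀ z ∈ h.domChart.source, h.codChart (f z) = (h.equiv (h.domChart z)).1 := by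
    intro z hz
    have hz' : z ∈ (h.domChart.extend (𝓡 m)).source := by
      rwa [OpenPartialHomeomorph.extend_source]
    have hw := h.writtenInCharts ((h.domChart.extend (𝓡 m)).map_source hz')
    simp only [Function.comp_apply] at hw
    rw [(h.domChart.extend (𝓡 m)).left_inv hz'] at hw
    exact hw
  have hfd : FiniteDimensional ℝ h.complement :=
    FiniteDimensional.of_injective (h.equiv.symm.toLinearMap ∘ₗ LinearMap.inr ℝ (Eucl k) h.complement)
      (h.equiv.symm.injective.comp LinearMap.inr_injective)
  -- The derivative of the chart identifies the kernel of `df` with the complement.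
  have hdim : Module.finrank ℝ h.complement = n := by
    rw [← hn]
    have hbij := mfderiv_bijective_of_mem_maximalAtlas h.domChart_mem_maximalAtlas
      h.mem_domChart_source
    let D : TangentSpace (𝓡 m) z₀ →ₗ[ℝ] Eucl m := (mfderiv (𝓡 m) (𝓡 m) h.domChart z₀).toLinearMap
    let T : TangentSpace (𝓡 m) z₀ ≃ₗ[ℝ] Eucl k × h.complement :=
      (LinearEquiv.ofBijective D hbij).trans h.equiv.toLinearEquiv
    have hT : (mfderiv (𝓡 m) (𝓡 k) f z₀).ker
        = (LinearMap.range (LinearMap.inr ℝ (Eucl k) h.complement)).comap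
          (T : TangentSpace (𝓡 m) z₀ →ₗ[ℝ] Eucl k × h.complement) := by
      ext v
      rw [mem_ker_mfderiv_iff hf.contMDiff h.domChart_mem_maximalAtlas h.codChart_mem_maximalAtlas
        h.source_subset_preimage_source hw h.mem_domChart_source, Submodule.mem_comap,
        LinearMap.range_inr, LinearMap.mem_ker]
      rfl
    rw [hT, Submodule.comap_equiv_eq_map_symm, LinearEquiv.finrank_map_eq,
      LinearMap.finrank_range_of_inj LinearMap.inr_injective]
  let σ : h.complement ≃L[ℝ] Eucl n := ContinuousLinearEquiv.ofFinrankEq (by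
    rw [hdim, finrank_euclideanSpace_fin])
  refine ⟨h.domChart, h.equiv.trans ((ContinuousLinearEquiv.refl ℝ (Eucl k)).prodCongr σ),
    h.codChart, h.mem_domChart_source, h.domChart_mem_maximalAtlas, h.codChart_mem_maximalAtlas,
    h.source_subset_preimage_source, fun z hz => ?_⟩
  rw [hw z hz]
  rfl

end Slices

section Adapted

variable {n m k : ℕ} {Q : Type*} [TopologicalSpace Q] [ChartedSpace (Eucl n) Q]
  [IsManifold (𝓡 n) ∞ Q] {M : Type*} [TopologicalSpace M] [ChartedSpace (Eucl m) M]
  {B : Type*} [TopologicalSpace B] [ChartedSpace (Eucl k) B]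

variable (m k) in
/-- Coordinates of `M` near `z₀` that are adapted to a lagrangian fibration: `Ψ` is a chart in which
the fibres of `f` are the slices `{x} × ℝⁿ` of `ℝᵏ × ℝⁿ`, and `g` is the inclusion `ι` with respect to `Ψ` and the
preferred chart of `T^*Q` at `ι z₀`. The last field says that the derivative of `g` along the slices
parametrizes the tangent spaces of the fibres. -/
structure IsAdapted (ι : M → CotangentBundle n Q) (f : M → B) (z₀ : M)
    (Ψ : OpenPartialHomeomorph M (Eucl k × Eucl n)) (g : Eucl k × Eucl n → PhaseSpace n) :
    Prop where
  mem : z₀ ∈ Ψ.source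
  proj_mem : ∀ z ∈ Ψ.source, (ι z).proj ∈ (chartAt (Eucl n) (ι z₀).proj).source
  smooth : ContDiffOn ℝ ∞ g Ψ.target
  eq : ∀ z ∈ Ψ.source, g (Ψ z) = cotangentChart (ι z₀) (ι z)
  injective : ∀ z ∈ Ψ.source, Function.Injective (fderiv ℝ g (Ψ z))
  fibre : ∀ z ∈ Ψ.source, ∀ z' ∈ Ψ.source, f z = f z' ↔ (Ψ z).1 = (Ψ z').1
  mem_map_iff : ∀ z ∈ Ψ.source, ∀ Φ : PhaseSpace n ≃L[ℝ] PhaseSpace n,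
    (Φ : PhaseSpace n →L[ℝ] PhaseSpace n)
      = mfderiv (cotangentModel n) 𝓘(ℝ, PhaseSpace n) (cotangentChart (ι z₀)) (ι z) →
    ∀ w : PhaseSpace n, w ∈ Submodule.map (Φ : PhaseSpace n →ₗ[ℝ] PhaseSpace n)
      (fibreSection m k ι f z : Submodule ℝ (PhaseSpace n)) ↔
      ∃ v : Eucl n, fderiv ℝ g (Ψ z) (0, v) = w

/-- The implicit function theorem for the submersion `f`, combined with the preferred chart of `T^*Q`. -/
theorem IsLagrangianFibration.exists_isAdapted [IsManifold (𝓡 m) ∞ M]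
    [IsManifold (𝓡 k) ∞ B] {ι : M → CotangentBundle n Q} {f : M → B}
    (hf : IsLagrangianFibration m k ι f) (z₀ : M) : ∃ Ψ g, IsAdapted m k ι f z₀ Ψ g := by
  have hι : ContMDiff (𝓡 m) (cotangentModel n) ∞ ι := hf.embedding.isImmersion.contMDiff
  have hinj : ∀ z, Function.Injective (mfderiv (𝓡 m) (cotangentModel n) ι z) := fun z =>
    (hf.embedding.isImmersion.isImmersionAt z).mfderiv_injective
  obtain ⟨e, L, χ, hz₀, he, hχ, hsrc, hL⟩ := exists_slice_chart (n := n) hf.submersion z₀ (by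
    rw [← (hf.lagrangian z₀).1, fibreSection]
    exact (Submodule.equivMapOfInjective _ (hinj z₀) _).finrank_eq)
  have hopen : IsOpen (ι ⁻¹' (chartAt (ModelProd (Eucl n) (Eucl n →L[ℝ] ℝ)) (ι z₀)).source) :=
    (chartAt (ModelProd (Eucl n) (Eucl n →L[ℝ] ℝ)) (ι z₀)).open_source.preimage hι.continuous
  set Ψ := (e.transHomeomorph L.toHomeomorph).restrOpen _ hopen with hΨ
  set g : Eucl k × Eucl n → PhaseSpace n := fun p =>
    cotangentChart (ι z₀) (ι (e.symm (L.symm p))) with hg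
  have hs : ∀ z, z ∈ Ψ.source ↔ z ∈ e.source ∧
      (ι z).proj ∈ (chartAt (Eucl n) (ι z₀).proj).source := fun z => by
    rw [hΨ, OpenPartialHomeomorph.restrOpen_source, mem_inter_iff, mem_preimage,
      mem_cotangentChart_source]
    rfl
  have hΨe : ∀ z, Ψ z = L (e z) := fun z => rfl
  have heq : ∀ z ∈ Ψ.source, g (Ψ z) = cotangentChart (ι z₀) (ι z) := fun z hz => by
    simp only [hg]
    rw [hΨe, L.symm_apply_apply, e.left_inv ((hs z).1 hz).1]
  have hsymm : ∀ p ∈ Ψ.target, Ψ.symm p = e.symm (L.symm p) := fun p hp => rfl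
  have hsm : ContDiffOn ℝ ∞ g Ψ.target := by
    rw [← contMDiffOn_iff_contDiffOn]
    have h1 : ContMDiffOn 𝓘(ℝ, Eucl k × Eucl n) (𝓡 m) ∞ (fun p => e.symm (L.symm p)) Ψ.target := by
      refine (contMDiffOn_symm_of_mem_maximalAtlas he).comp
        (L.symm.contDiff.contMDiff.contMDiffOn) fun p hp => ?_
      exact hp.1
    refine (contMDiffOn_extChartAt (I := cotangentModel n) (x := ι z₀)).comp
      (hι.comp_contMDiffOn h1) fun p hp => ?_
    have := ((hs _).1 (Ψ.map_target hp)).2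
    rw [hsymm p hp, ← mem_cotangentChart_source] at this
    exact this
  -- The chain rule for `g ∘ Ψ = (chart of T^*Q) ∘ ι`.
  have hder : ∀ z ∈ Ψ.source, ∀ v : TangentSpace (𝓡 m) z,
      fderiv ℝ g (Ψ z) (L (mfderiv (𝓡 m) (𝓡 m) e z v : Eucl m))
        = mfderiv (cotangentModel n) 𝓘(ℝ, PhaseSpace n) (cotangentChart (ι z₀)) (ι z)
          (mfderiv (𝓡 m) (cotangentModel n) ι z v) := by
    intro z hz v
    have hι' := (hι.contMDiffAt.mdifferentiableAt (x := z) (by simp)).hasMFDerivAt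
    have hχ' := (mdifferentiableAt_extChartAt (I := cotangentModel n)
      (mem_cotangentChart_source.2 ((hs z).1 hz).2)).hasMFDerivAt
    have hg' : HasFDerivAt g (fderiv ℝ g (Ψ z)) (Ψ z) :=
      ((hsm.contDiffAt (Ψ.open_target.mem_nhds (Ψ.map_source hz))).differentiableAt
        (by simp)).hasFDerivAt
    have hgL : HasFDerivAt (g ∘ L) ((fderiv ℝ g (Ψ z)).comp (L : Eucl m →L[ℝ] Eucl k × Eucl n))
      (e z) := HasFDerivAt.comp (e z) hg' L.hasFDerivAt
    have h2 := hgL.hasMFDerivAt.comp z (hasMFDerivAt_of_mem_maximalAtlas he ((hs z).1 hz).1)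
    have he' : (cotangentChart (ι z₀) ∘ ι) =ᶠ[𝓝 z] (g ∘ L) ∘ e := by
      filter_upwards [Ψ.open_source.mem_nhds hz] with y hy
      exact (heq y hy).symm
    have hu := hasMFDerivAt_unique (hχ'.comp z hι') (h2.congr_of_eventuallyEq he')
    exact (congrArg (fun T : Eucl m →L[ℝ] PhaseSpace n => T v) hu).symm
  have hbij : ∀ z ∈ Ψ.source, Function.Bijective (mfderiv (𝓡 m) (𝓡 m) e z) := fun z hz =>
    mfderiv_bijective_of_mem_maximalAtlas he ((hs z).1 hz).1
  have hsurj : ∀ z ∈ Ψ.source, ∀ p : Eucl k × Eucl n, ∃ v : TangentSpace (𝓡 m) z,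
      L (mfderiv (𝓡 m) (𝓡 m) e z v : Eucl m) = p := fun z hz p => by
    obtain ⟨v, hv⟩ := (hbij z hz).2 (L.symm p)
    exact ⟨v, by rw [hv]; exact L.apply_symm_apply p⟩
  refine ⟨Ψ, g, (hs z₀).2 ⟨hz₀, mem_chart_source _ _⟩, fun z hz => ((hs z).1 hz).2, hsm, heq,
    fun z hz p q hpq => ?_, fun z hz z' hz' => ?_, fun z hz Φ hΦ w => ?_⟩
  · obtain ⟨v, rfl⟩ := hsurj z hz p
    obtain ⟨w, rfl⟩ := hsurj z hz q
    rw [hder z hz, hder z hz] at hpq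
    obtain ⟨Φ, -, hΦ⟩ := exists_isVerticalSymplectic ((hs z).1 hz).2
    rw [← hΦ] at hpq
    rw [hinj z (Φ.injective hpq)]
  · rw [hΨe, hΨe, ← hL z ((hs z).1 hz).1, ← hL z' ((hs z').1 hz').1]
    exact ⟨fun h => by rw [h], fun h =>
      χ.injOn (hsrc ((hs z).1 hz).1) (hsrc ((hs z').1 hz').1) h⟩
  · have hker := mem_ker_mfderiv_iff hf.submersion.contMDiff he hχ hsrc hL ((hs z).1 hz).1
    constructor
    · rintro ⟨_, ⟨v, hv, rfl⟩, rfl⟩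
      have hv' := (hker v).1 hv
      refine ⟨(L (mfderiv (𝓡 m) (𝓡 m) e z v : Eucl m)).2, ?_⟩
      rw [← hv', Prod.mk.eta, hder z hz, ← hΦ]
      rfl
    · rintro ⟨v, rfl⟩
      obtain ⟨u, hu⟩ := hsurj z hz (0, v)
      refine ⟨_, ⟨u, (hker u).2 (by rw [hu]), rfl⟩, ?_⟩
      rw [← hu, hder z hz, ← hΦ]
      rfl

end Adapted

/-! ### The hamiltonian in the coordinates of a chart -/

section Hamiltonian

variable {n : ℕ}

/-- The second derivative along a line is the Hessian. -/
theorem iteratedDeriv_two_line {E : Type*} [NormedAddCommGroup E] [NormedSpace ℝ E] {h : E → ℝ}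
    {p v : E} (hh : ContDiffAt ℝ ∞ h p) :
    iteratedDeriv 2 (fun t : ℝ => h (p + t • v)) 0 = fderiv ℝ (fderiv ℝ h) p v v := by
  have hline : ∀ t : ℝ, HasDerivAt (fun t : ℝ => p + t • v) v t := fun t => by
    simpa using ((hasDerivAt_id t).smul_const v).const_add p
  have h0 : p + (0 : ℝ) • v = p := by simp
  have hd : ∀ᶠ q in 𝓝 p, DifferentiableAt ℝ h q := by
    filter_upwards [(hh.of_le (m := 1) (by norm_cast)).eventually (by simp)] with q hq
    exact hq.differentiableAt one_ne_zero
  have hd' : ∀ᶠ t in 𝓝 (0 : ℝ), deriv (fun t : ℝ => h (p + t • v)) t = fderiv ℝ h (p + t • v) v := by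
    have hc : Tendsto (fun t : ℝ => p + t • v) (𝓝 0) (𝓝 p) := by
      have := (hline 0).continuousAt.tendsto
      rwa [h0] at this
    filter_upwards [hc.eventually hd] with t ht
    exact (ht.hasFDerivAt.comp_hasDerivAt t (hline t)).deriv
  rw [iteratedDeriv_succ, iteratedDeriv_one, Filter.EventuallyEq.deriv_eq hd']
  have h2 : HasFDerivAt (fderiv ℝ h) (fderiv ℝ (fderiv ℝ h) p) (p + (0 : ℝ) • v) := by
    rw [h0]
    exact ((hh.fderiv_right (m := 1) (by norm_cast)).differentiableAt one_ne_zero).hasFDerivAt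
  have h3 : HasDerivAt (fun t : ℝ => fderiv ℝ h (p + t • v)) (fderiv ℝ (fderiv ℝ h) p v) 0 :=
    HasFDerivAt.comp_hasDerivAt (l := fderiv ℝ h) (f := fun t : ℝ => p + t • v) (0 : ℝ) h2 (hline 0)
  have h4 : HasDerivAt (fun t : ℝ => fderiv ℝ h (p + t • v) v) (fderiv ℝ (fderiv ℝ h) p v v) 0 := by
    have h5 := h3.clm_apply (hasDerivAt_const (0 : ℝ) v)
    rwa [map_zero, add_zero] at h5
  exact h4.deriv

variable {Q : Type*} [TopologicalSpace Q] [ChartedSpace (Eucl n) Q] [IsManifold (𝓡 n) ∞ Q]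

/-- The hamiltonian vector field is the symplectic gradient. -/
theorem stdForm_hamiltonianVectorField (H : CotangentBundle n Q → ℝ) (θ : CotangentBundle n Q)
    (v : PhaseSpace n) :
    stdForm v (hamiltonianVectorField H θ) = mfderiv (cotangentModel n) 𝓘(ℝ, ℝ) H θ v := by
  set D : PhaseSpace n →L[ℝ] ℝ := mfderiv (cotangentModel n) 𝓘(ℝ, ℝ) H θ with hD
  have h1 : stdForm v (hamiltonianVectorField H θ)
      = v.2 (WithLp.toLp 2 fun i => D (0, EuclideanSpace.proj i)) - -(D (v.1, 0)) := rfl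
  have h2 : v = (v.1, 0) + ∑ i, v.2 (EuclideanSpace.single i 1) •
      ((0, EuclideanSpace.proj i) : PhaseSpace n) := by
    have h3 : ∑ i, v.2 (EuclideanSpace.single i 1) • ((0, EuclideanSpace.proj i) : PhaseSpace n)
        = (0, v.2) := by
      refine phaseSpace_ext (fun j => ?_) fun j => ?_
      · simp [Prod.fst_sum]
      · simp [Prod.snd_sum]
    rw [h3]
    simp
  rw [h1, clm_apply_eq_sum]
  change _ = D v
  conv_rhs => rw [h2, map_add, map_sum]
  simp only [map_smul, smul_eq_mul]
  ring

/-- The hamiltonian in the coordinates of the preferred chart at `θ₀`. -/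
def chartHamiltonian (H : CotangentBundle n Q → ℝ) (θ₀ : CotangentBundle n Q) : PhaseSpace n → ℝ :=
  H ∘ (extChartAt (cotangentModel n) θ₀).symm

variable {H : CotangentBundle n Q → ℝ} {θ₀ θ : CotangentBundle n Q}

theorem contDiffAt_chartHamiltonian (hH : ContMDiff (cotangentModel n) 𝓘(ℝ, ℝ) ∞ H)
    (h : θ.proj ∈ (chartAt (Eucl n) θ₀.proj).source) :
    ContDiffAt ℝ ∞ (chartHamiltonian H θ₀) (cotangentChart θ₀ θ) := by
  rw [← contMDiffAt_iff_contDiffAt]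
  have hs : θ ∈ (extChartAt (cotangentModel n) θ₀).source := by
    rw [extChartAt_source]
    exact mem_cotangentChart_source.2 h
  have ht := (extChartAt (cotangentModel n) θ₀).map_source hs
  exact hH.contMDiffAt.comp _ ((contMDiffOn_extChartAt_symm θ₀).contMDiffAt
    (extChartAt_target_mem_nhds' ht))

theorem fderiv_chartHamiltonian (hH : ContMDiff (cotangentModel n) 𝓘(ℝ, ℝ) ∞ H)
    (h : θ.proj ∈ (chartAt (Eucl n) θ₀.proj).source) (v : PhaseSpace n) :
    fderiv ℝ (chartHamiltonian H θ₀) (cotangentChart θ₀ θ)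
        (mfderiv (cotangentModel n) 𝓘(ℝ, PhaseSpace n) (cotangentChart θ₀) θ v)
      = mfderiv (cotangentModel n) 𝓘(ℝ, ℝ) H θ v := by
  have hsrc := mem_cotangentChart_source.2 h
  have h1 := (mdifferentiableAt_extChartAt (I := cotangentModel n) hsrc).hasMFDerivAt
  have h2 := ((contDiffAt_chartHamiltonian hH h).differentiableAt
    (by simp)).hasFDerivAt.hasMFDerivAt.comp θ h1
  have h3 := (hH.contMDiffAt.mdifferentiableAt (x := θ) (by simp)).hasMFDerivAt
  have heq : H =ᶠ[𝓝 θ] chartHamiltonian H θ₀ ∘ cotangentChart θ₀ := by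
    filter_upwards [(chartAt (ModelProd (Eucl n) (Eucl n →L[ℝ] ℝ)) θ₀).open_source.mem_nhds hsrc]
      with x hx
    simp only [chartHamiltonian, Function.comp_apply]
    rw [(extChartAt (cotangentModel n) θ₀).left_inv (by rwa [extChartAt_source])]
  have hu := hasMFDerivAt_unique h3 (h2.congr_of_eventuallyEq heq)
  exact (congrArg (fun T : PhaseSpace n →L[ℝ] ℝ => T v) hu).symm

/-- In the preferred chart at `θ₀` the cotangent fibre through `θ₀` is an affine subspace, with its own
linear structure. -/
theorem cotangentChart_symm_add (θ₀ : CotangentBundle n Q)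
    (w : TangentSpace (𝓡 n) θ₀.proj →L[ℝ] Bundle.Trivial Q ℝ θ₀.proj) :
    (extChartAt (cotangentModel n) θ₀).symm (cotangentChart θ₀ θ₀ + ((0, w) : PhaseSpace n))
      = ⟨θ₀.proj, θ₀.2 + w⟩ := by
  have hq : θ₀.proj ∈ (chartAt (Eucl n) θ₀.proj).source := mem_chart_source _ _
  have hsymm : ∀ v : Eucl n,
      (trivializationAt (Eucl n) (TangentSpace (𝓡 n)) θ₀.proj).symmL ℝ θ₀.proj v = v := fun v => by
    rw [TangentBundle.symmL_trivializationAt_eq_core hq]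
    exact tangentCoordChange_self (I := 𝓡 n) (mem_extChartAt_base_source.2 hq)
  have h : cotangentChart θ₀ (⟨θ₀.proj, θ₀.2 + w⟩ : CotangentBundle n Q)
      = cotangentChart θ₀ θ₀ + ((0, w) : PhaseSpace n) := by
    refine Prod.ext ?_ (ContinuousLinearMap.ext fun v => ?_)
    · rw [Prod.fst_add, add_zero, cotangentChart_fst, cotangentChart_fst]
    · rw [Prod.snd_add, add_apply, cotangentChart_snd_apply,
        cotangentChart_snd_apply, hsymm]
      rfl
  rw [← h]
  refine (extChartAt (cotangentModel n) θ₀).left_inv ?_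
  rw [extChartAt_source]
  exact mem_cotangentChart_source.2 hq

/-- Convexity in the coordinates of a chart. -/
theorem IsConvexHamiltonian.fderiv_fderiv_pos (hH : IsConvexHamiltonian H)
    (θ₀ : CotangentBundle n Q) {w : Eucl n →L[ℝ] ℝ} (hw : w ≠ 0) :
    0 < fderiv ℝ (fderiv ℝ (chartHamiltonian H θ₀)) (cotangentChart θ₀ θ₀) (0, w) (0, w) := by
  rw [← iteratedDeriv_two_line (contDiffAt_chartHamiltonian hH.1 (mem_chart_source _ _))]
  have h := hH.2 θ₀.proj θ₀.2 w hw
  refine h.trans_eq (congrArg (fun F : ℝ → ℝ => iteratedDeriv 2 F 0) (funext fun t => ?_))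
  have e : t • ((0, w) : PhaseSpace n) = (0, t • w) := by rw [Prod.smul_mk, smul_zero]
  rw [e]
  exact congrArg H (cotangentChart_symm_add θ₀ (t • w)).symm

/-! ### Crossings of a family of lagrangian submanifolds along a flow -/

theorem _root_.HasDerivAt.stdForm {u v : ℝ → PhaseSpace n} {u' v' : PhaseSpace n} {t : ℝ}
    (hu : HasDerivAt u u' t) (hv : HasDerivAt v v' t) :
    HasDerivAt (fun s => stdForm (u s) (v s)) (stdForm u' (v t) + stdForm (u t) v') t := by
  have hu1 : HasDerivAt (fun s => (u s).1) u'.1 t :=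
    (ContinuousLinearMap.fst ℝ (Eucl n) (Eucl n →L[ℝ] ℝ)).hasFDerivAt.comp_hasDerivAt t hu
  have hu2 : HasDerivAt (fun s => (u s).2) u'.2 t :=
    (ContinuousLinearMap.snd ℝ (Eucl n) (Eucl n →L[ℝ] ℝ)).hasFDerivAt.comp_hasDerivAt t hu
  have hv1 : HasDerivAt (fun s => (v s).1) v'.1 t :=
    (ContinuousLinearMap.fst ℝ (Eucl n) (Eucl n →L[ℝ] ℝ)).hasFDerivAt.comp_hasDerivAt t hv
  have hv2 : HasDerivAt (fun s => (v s).2) v'.2 t :=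
    (ContinuousLinearMap.snd ℝ (Eucl n) (Eucl n →L[ℝ] ℝ)).hasFDerivAt.comp_hasDerivAt t hv
  refine ((hu2.clm_apply hv1).sub (hv2.clm_apply hu1)).congr_deriv ?_
  simp only [_root_.stdForm]
  ring

/-- If a convex hamiltonian is constant on the lagrangian slices of `g`, then the slices move
through the vertical space in the positive direction along the flow: this is the positivity that
`frameAngle_jump` asks for. Differentiating along the slice the equations
`d(h ∘ g)(e) = 0` and `ω(dg e, dg ξ) = 0`, where `dg ξ` is the hamiltonian vector field, shows that
the crossing form is the Hessian of `h`. -/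
theorem crossing_pos {E : Type*} [NormedAddCommGroup E] [NormedSpace ℝ E] {g : E → PhaseSpace n}
    {h : PhaseSpace n → ℝ} {p ξ e : E} {w : Eucl n →L[ℝ] ℝ} (hg : ContDiffAt ℝ ∞ g p)
    (hh : ContDiffAt ℝ ∞ h (g p))
    (hslice : ∀ᶠ t in 𝓝 (0 : ℝ), fderiv ℝ h (g (p + t • e)) (fderiv ℝ g (p + t • e) e) = 0)
    (hiso : ∀ᶠ t in 𝓝 (0 : ℝ),
      stdForm (fderiv ℝ g (p + t • e) e) (fderiv ℝ g (p + t • e) ξ) = 0)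
    (hξ : ∀ v, stdForm v (fderiv ℝ g p ξ) = fderiv ℝ h (g p) v) (he : fderiv ℝ g p e = (0, w))
    (hpos : 0 < fderiv ℝ (fderiv ℝ h) (g p) (0, w) (0, w)) :
    0 < w (fderiv ℝ (fderiv ℝ g) p ξ e).1 := by
  have hline : HasDerivAt (fun t : ℝ => p + t • e) e 0 := by
    simpa using ((hasDerivAt_id (0 : ℝ)).smul_const e).const_add p
  have h0 : p + (0 : ℝ) • e = p := by simp
  have hg1 : HasFDerivAt g (fderiv ℝ g p) (p + (0 : ℝ) • e) := by
    rw [h0]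
    exact (hg.differentiableAt (by simp)).hasFDerivAt
  have hg2 : HasFDerivAt (fderiv ℝ g) (fderiv ℝ (fderiv ℝ g) p) (p + (0 : ℝ) • e) := by
    rw [h0]
    exact ((hg.fderiv_right (m := 1) (by norm_cast)).differentiableAt one_ne_zero).hasFDerivAt
  have hh2 : HasFDerivAt (fderiv ℝ h) (fderiv ℝ (fderiv ℝ h) (g p)) (g (p + (0 : ℝ) • e)) := by
    rw [h0]
    exact ((hh.fderiv_right (m := 1) (by norm_cast)).differentiableAt one_ne_zero).hasFDerivAt
  have hG := HasFDerivAt.comp_hasDerivAt (l := fderiv ℝ g) (f := fun t : ℝ => p + t • e) (0 : ℝ)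
    hg2 hline
  have hGe := hG.clm_apply (hasDerivAt_const (0 : ℝ) e)
  have hGξ := hG.clm_apply (hasDerivAt_const (0 : ℝ) ξ)
  have hgl := HasFDerivAt.comp_hasDerivAt (l := g) (f := fun t : ℝ => p + t • e) (0 : ℝ) hg1 hline
  have hhg := HasFDerivAt.comp_hasDerivAt (l := fderiv ℝ h) (f := g ∘ fun t : ℝ => p + t • e)
    (0 : ℝ) hh2 hgl
  have e1 := (hhg.clm_apply hGe).congr_of_eventuallyEq
    (f₁ := fun _ => (0 : ℝ)) (hslice.mono fun t ht => ht.symm)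
  have e1' := (hasDerivAt_const (0 : ℝ) (0 : ℝ)).unique e1
  have e2 := (hGe.stdForm hGξ).congr_of_eventuallyEq
    (f₁ := fun _ => (0 : ℝ)) (hiso.mono fun t ht => ht.symm)
  have e2' := (hasDerivAt_const (0 : ℝ) (0 : ℝ)).unique e2
  have hsymm : fderiv ℝ (fderiv ℝ g) p e ξ = fderiv ℝ (fderiv ℝ g) p ξ e :=
    (hg.isSymmSndFDerivAt (by simp; norm_cast)).eq e ξ
  simp only [Function.comp_apply, h0, map_zero, add_zero, he] at e1' e2'
  rw [hξ, hsymm] at e2'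
  have h3 : stdForm (0, w) (fderiv ℝ (fderiv ℝ g) p ξ e)
      = w (fderiv ℝ (fderiv ℝ g) p ξ e).1 := by
    simp [stdForm]
  rw [h3] at e2'
  linarith

end Hamiltonian

/-! ### The relative Maslov cocycle in adapted coordinates -/

section Continuity

variable {n : ℕ}

theorem continuous_baseMat : Continuous (baseMat (n := n)) := by
  refine continuous_matrix fun i j => ?_
  exact (EuclideanSpace.proj (𝕜 := ℝ) j).continuous.comp (continuous_fst.comp (continuous_apply i))

theorem continuous_fibreMat : Continuous (fibreMat (n := n)) := by
  refine continuous_matrix fun i j => ?_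
  exact (ContinuousLinearMap.apply ℝ ℝ (EuclideanSpace.single j 1)).continuous.comp
    (continuous_snd.comp (continuous_apply i))

theorem hermMat_apply (J : PhaseSpace n →L[ℝ] PhaseSpace n) (l s : Fin n → PhaseSpace n)
    (i j : Fin n) : hermMat J l s i j = ⟨stdForm (J (l i)) (s j), stdForm (l i) (s j)⟩ :=
  complexMat_apply _ _ i j

theorem continuousOn_siegelOf :
    ContinuousOn (siegelOf (n := n)) {J | IsCompatibleLinear J} := by
  have hs : Continuous fun (J : PhaseSpace n →L[ℝ] PhaseSpace n) i => J (vertFrame n i) :=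
    continuous_pi fun i => (ContinuousLinearMap.apply ℝ (PhaseSpace n) (vertFrame n i)).continuous
  have hF := continuous_fibreMat.comp hs
  have hG : Continuous (vertGram (n := n)) := by
    have : (vertGram (n := n)) = fun J => -baseMat fun i => J (vertFrame n i) := by
      funext J
      rw [vertGram, formMat_vertFrame]
    rw [this]
    exact (continuous_baseMat.comp hs).neg
  have hI : ContinuousOn (fun J => (vertGram (n := n) J)⁻¹) {J | IsCompatibleLinear J} := by
    have : (fun J => (vertGram (n := n) J)⁻¹)
        = fun J => ((vertGram J).det)⁻¹ • (vertGram J).adjugate := by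
      funext J
      rw [Matrix.inv_def, Ring.inverse_eq_inv']
    rw [this]
    exact (hG.matrix_det.continuousOn.inv₀ fun J hJ => (posDef_vertGram hJ).det_pos.ne').smul
      hG.matrix_adjugate.continuousOn
  have hc : Continuous fun p : Matrix (Fin n) (Fin n) ℝ × Matrix (Fin n) (Fin n) ℝ =>
      complexMat p.1 p.2 := continuous_complexMat continuous_fst continuous_snd
  exact hc.comp_continuousOn (((continuous_fst.matrix_mul
    continuous_snd).comp_continuousOn (hI.prodMk hF.continuousOn)).neg.prodMk hI)

end Continuity

section Maslov

variable {n m k : ℕ} {Q : Type*} [TopologicalSpace Q] [ChartedSpace (Eucl n) Q]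
  [IsManifold (𝓡 n) ∞ Q] {M : Type*} [TopologicalSpace M] [ChartedSpace (Eucl m) M]
  {B : Type*} [TopologicalSpace B] [ChartedSpace (Eucl k) B]

/-- The derivative of the preferred chart at `θ₀`, as an isomorphism of the model space. -/
def chartEquiv (θ₀ θ : CotangentBundle n Q) : PhaseSpace n ≃L[ℝ] PhaseSpace n :=
  open Classical in
  if h : θ.proj ∈ (chartAt (Eucl n) θ₀.proj).source then (exists_isVerticalSymplectic h).choose
  else ContinuousLinearEquiv.refl ℝ _

variable {θ₀ θ : CotangentBundle n Q}

theorem isVerticalSymplectic_chartEquiv (h : θ.proj ∈ (chartAt (Eucl n) θ₀.proj).source) :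
    IsVerticalSymplectic (chartEquiv θ₀ θ) := by
  rw [chartEquiv, dif_pos h]
  exact (exists_isVerticalSymplectic h).choose_spec.1

theorem coe_chartEquiv (h : θ.proj ∈ (chartAt (Eucl n) θ₀.proj).source) :
    (chartEquiv θ₀ θ : PhaseSpace n →L[ℝ] PhaseSpace n)
      = mfderiv (cotangentModel n) 𝓘(ℝ, PhaseSpace n) (cotangentChart θ₀) θ := by
  rw [chartEquiv, dif_pos h]
  exact (exists_isVerticalSymplectic h).choose_spec.2

theorem chartEquiv_apply (h : θ.proj ∈ (chartAt (Eucl n) θ₀.proj).source) (v : PhaseSpace n) :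
    chartEquiv θ₀ θ v = (trivializationAt (PhaseSpace n) (TangentSpace (cotangentModel n))
      θ₀).continuousLinearMapAt ℝ θ v := by
  rw [TangentBundle.continuousLinearMapAt_trivializationAt (mem_cotangentChart_source.2 h),
    ← coe_chartEquiv h]
  rfl

theorem chartEquiv_symm_apply (h : θ.proj ∈ (chartAt (Eucl n) θ₀.proj).source)
    (v : PhaseSpace n) :
    (chartEquiv θ₀ θ).symm v = (trivializationAt (PhaseSpace n) (TangentSpace (cotangentModel n))
      θ₀).symmL ℝ θ v := by
  refine (chartEquiv θ₀ θ).injective (((chartEquiv θ₀ θ).apply_symm_apply v).trans ?_)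
  refine Eq.trans ?_ (chartEquiv_apply h _).symm
  exact ((trivializationAt (PhaseSpace n) (TangentSpace (cotangentModel n))
    θ₀).continuousLinearMapAt_symmL (mem_cotangentChart_source.2 h) v).symm

variable {ι : M → CotangentBundle n Q} {f : M → B}
  {J : ∀ z : M, TangentSpace (cotangentModel n) (ι z) →L[ℝ] TangentSpace (cotangentModel n) (ι z)}

/-- The complex structure at `z`, as an endomorphism of the model space. -/
abbrev linearStructure (J : ∀ z : M,
    TangentSpace (cotangentModel n) (ι z) →L[ℝ] TangentSpace (cotangentModel n) (ι z)) (z : M) :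
    PhaseSpace n →L[ℝ] PhaseSpace n := J z

theorem IsCompatibleComplexStructure.linear (hJ : IsCompatibleComplexStructure ι J) (z : M) :
    IsCompatibleLinear (linearStructure J z) :=
  ⟨hJ.sq z, hJ.symplectic z, hJ.positive z⟩

set_option synthInstance.maxHeartbeats 200000 in
/-- The complex structure in the coordinates of a chart is continuous. -/
theorem IsCompatibleComplexStructure.continuousOn_transport
    (hJ : IsCompatibleComplexStructure ι J) (θ₀ : CotangentBundle n Q) :
    ContinuousOn (fun z => transport (chartEquiv θ₀ (ι z)) (linearStructure J z))
      {z | (ι z).proj ∈ (chartAt (Eucl n) θ₀.proj).source} := by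
  set e := trivializationAt ((PhaseSpace n) →L[ℝ] (PhaseSpace n))
    (fun θ : CotangentBundle n Q =>
      TangentSpace (cotangentModel n) θ →L[ℝ] TangentSpace (cotangentModel n) θ) θ₀ with he
  have hmem : ∀ z, (ι z).proj ∈ (chartAt (Eucl n) θ₀.proj).source →
      ι z ∈ (chartAt (ModelProd (Eucl n) (Eucl n →L[ℝ] ℝ)) θ₀).source := fun z hz =>
    mem_cotangentChart_source.2 hz
  have hmaps : ∀ z ∈ {z | (ι z).proj ∈ (chartAt (Eucl n) θ₀.proj).source},
      (⟨ι z, J z⟩ : Bundle.TotalSpace ((PhaseSpace n) →L[ℝ] (PhaseSpace n))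
        (fun θ : CotangentBundle n Q =>
          TangentSpace (cotangentModel n) θ →L[ℝ] TangentSpace (cotangentModel n) θ))
        ∈ e.source := fun z hz => by
    rw [he, hom_trivializationAt_source]
    exact ⟨hmem z hz, hmem z hz⟩
  have hc := continuous_snd.comp_continuousOn
    (e.continuousOn_toFun.comp hJ.continuous.continuousOn hmaps)
  refine hc.congr fun z hz => ?_
  refine ContinuousLinearMap.ext fun v => ?_
  refine (chartEquiv_apply hz _).trans ?_
  exact congrArg (fun u : PhaseSpace n => (trivializationAt (PhaseSpace n)
    (TangentSpace (cotangentModel n)) θ₀).continuousLinearMapAt ℝ (ι z) (linearStructure J z u))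
    (chartEquiv_symm_apply hz v)

/-- The tangent space of the fibre, as a subspace of the model space. -/
abbrev linearFibre (m k : ℕ) {M : Type*} [TopologicalSpace M] [ChartedSpace (Eucl m) M]
    {B : Type*} [TopologicalSpace B] [ChartedSpace (Eucl k) B]
    (ι : M → CotangentBundle n Q) (f : M → B) (z : M) : Submodule ℝ (PhaseSpace n) :=
  fibreSection m k ι f z

/-- `det²` of the tangent space of the fibre relative to the vertical space. -/
def maslovPhase (m k : ℕ) {M : Type*} [TopologicalSpace M] [ChartedSpace (Eucl m) M]
    {B : Type*} [TopologicalSpace B] [ChartedSpace (Eucl k) B]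
    (ι : M → CotangentBundle n Q) (f : M → B) (J : ∀ z : M,
      TangentSpace (cotangentModel n) (ι z) →L[ℝ] TangentSpace (cotangentModel n) (ι z))
    (z : M) : ℂ :=
  detSq (J z) (fibreSection m k ι f z) (verticalSpace (ι z))

/-- `detSq` unfolded for the bases that its definition chooses. -/
theorem exists_detSq_eq {θ : CotangentBundle n Q}
    (J : TangentSpace (cotangentModel n) θ →L[ℝ] TangentSpace (cotangentModel n) θ)
    {L : Submodule ℝ (PhaseSpace n)} (hL : ∃ l : Fin n → PhaseSpace n, IsFrame L l) :
    ∃ l s : Fin n → PhaseSpace n, IsFrame L l ∧ IsFrame (vertical n) s ∧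
      detSq J L (verticalSpace θ) = phaseSq (hermMat J l s).det := by
  have hex : ∀ S : Submodule ℝ (PhaseSpace n), (∃ l : Fin n → PhaseSpace n, IsFrame S l) →
      Nonempty (Module.Basis (Fin n) ℝ S) := by
    rintro _ ⟨l, hl, rfl⟩
    exact ⟨Module.Basis.span hl⟩
  have hS : verticalSpace θ = vertical n := verticalSpace_eq θ
  have h : Nonempty (Module.Basis (Fin n) ℝ L) ∧ Nonempty (Module.Basis (Fin n) ℝ (vertical n)) :=
    ⟨hex L hL, hex _ ⟨_, isFrame_vertFrame⟩⟩
  refine ⟨_, _, isFrame_of_basis (Classical.choice h.1), isFrame_of_basis (Classical.choice h.2), ?_⟩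
  have hd : detSq J L (vertical n) = phaseSq (Matrix.of fun i j : Fin n =>
      hermitianForm J (Classical.choice h.1 i : PhaseSpace n)
        (Classical.choice h.2 j : PhaseSpace n)).det := by
    unfold detSq
    exact dif_pos h
  rw [hS]
  refine hd.trans (congrArg (fun A : Matrix (Fin n) (Fin n) ℂ => phaseSq A.det) (Matrix.ext fun i j => ?_))
  exact (hermMat_apply (n := n) J (fun i => (Classical.choice h.1 i : PhaseSpace n))
    (fun j => (Classical.choice h.2 j : PhaseSpace n)) i j).symm

/-- The moving frame of the fibres in adapted coordinates. -/
def sliceFrame (g : Eucl k × Eucl n → PhaseSpace n) (p : Eucl k × Eucl n) (i : Fin n) :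
    PhaseSpace n :=
  fderiv ℝ g p (0, EuclideanSpace.single i 1)

theorem fderiv_slice_eq_sum (g : Eucl k × Eucl n → PhaseSpace n) (p : Eucl k × Eucl n)
    (v : Eucl n) : fderiv ℝ g p (0, v) = ∑ i, v i • sliceFrame g p i := by
  have hv : ((0, v) : Eucl k × Eucl n) = ∑ i, v i • ((0, EuclideanSpace.single i 1) :
      Eucl k × Eucl n) := by
    refine Prod.ext ?_ (PiLp.ext fun j => ?_)
    · simp [Prod.fst_sum]
    · simp [Prod.snd_sum, Pi.single_apply]
  rw [hv, map_sum]
  simp only [map_smul]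
  rfl

theorem IsAdapted.isFrame {z₀ z : M} {Ψ : OpenPartialHomeomorph M (Eucl k × Eucl n)}
    {g : Eucl k × Eucl n → PhaseSpace n} (h : IsAdapted m k ι f z₀ Ψ g) (hz : z ∈ Ψ.source) :
    IsFrame ((linearFibre m k ι f z).map
      (chartEquiv (ι z₀) (ι z) : PhaseSpace n →ₗ[ℝ] PhaseSpace n)) (sliceFrame g (Ψ z)) := by
  refine ⟨Fintype.linearIndependent_iff.2 fun v hv i => ?_, ?_⟩
  · have h0 := fderiv_slice_eq_sum g (Ψ z) (WithLp.toLp 2 v)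
    rw [show ∑ i, (WithLp.toLp 2 v : Eucl n) i • sliceFrame g (Ψ z) i = 0 from hv,
      ← map_zero (fderiv ℝ g (Ψ z))] at h0
    have h1 := congrArg (fun p : Eucl k × Eucl n => p.2 i) (h.injective z hz h0)
    simpa using h1
  · ext w
    rw [h.mem_map_iff z hz _ (coe_chartEquiv (h.proj_mem z hz)),
      Submodule.mem_span_range_iff_exists_fun]
    constructor
    · rintro ⟨v, rfl⟩
      exact ⟨WithLp.toLp 2 v, fderiv_slice_eq_sum _ _ _⟩
    · rintro ⟨v, rfl⟩
      exact ⟨v, (fderiv_slice_eq_sum _ _ _).symm⟩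

theorem IsAdapted.continuousOn_sliceFrame {z₀ : M}
    {Ψ : OpenPartialHomeomorph M (Eucl k × Eucl n)} {g : Eucl k × Eucl n → PhaseSpace n}
    (h : IsAdapted m k ι f z₀ Ψ g) : ContinuousOn (fun z => sliceFrame g (Ψ z)) Ψ.source := by
  refine continuousOn_pi.2 fun i => ?_
  have hd : ContinuousOn (fderiv ℝ g) Ψ.target :=
    h.smooth.continuousOn_fderiv_of_isOpen Ψ.open_target (by simp)
  exact (hd.comp Ψ.continuousOn Ψ.mapsTo).clm_apply continuousOn_const

end Maslov

section MaslovAngle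

variable {n m k : ℕ} {Q : Type*} [TopologicalSpace Q] [ChartedSpace (Eucl n) Q]
  [IsManifold (𝓡 n) ∞ Q] {M : Type*} [TopologicalSpace M] [ChartedSpace (Eucl m) M]
  {B : Type*} [TopologicalSpace B] [ChartedSpace (Eucl k) B]
  {ι : M → CotangentBundle n Q} {f : M → B}
  {J : ∀ z : M, TangentSpace (cotangentModel n) (ι z) →L[ℝ] TangentSpace (cotangentModel n) (ι z)}

/-- The Siegel matrix of the complex structure in the chart at `θ₀`. -/
def chartSiegel (J : ∀ z : M,
    TangentSpace (cotangentModel n) (ι z) →L[ℝ] TangentSpace (cotangentModel n) (ι z))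
    (θ₀ : CotangentBundle n Q) (z : M) : Matrix (Fin n) (Fin n) ℂ :=
  siegelOf (transport (chartEquiv θ₀ (ι z)) (linearStructure J z))

/-- An angle of `det²` of the fibres relative to the vertical space. Off the relative Maslov cycle
it is the continuous one given by the Siegel upper half space, on the cycle it is arbitrary. -/
def maslovAngle (m k : ℕ) {M : Type*} [TopologicalSpace M] [ChartedSpace (Eucl m) M]
    {B : Type*} [TopologicalSpace B] [ChartedSpace (Eucl k) B]
    (ι : M → CotangentBundle n Q) (f : M → B) (J : ∀ z : M,
      TangentSpace (cotangentModel n) (ι z) →L[ℝ] TangentSpace (cotangentModel n) (ι z))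
    (z : M) : ℝ :=
  open Classical in
  if z ∈ relativeMaslovCycle m k ι f then
    (if h : ∃ x, turn x = maslovPhase m k ι f J z then h.choose else 0)
  else lagAngle (linearStructure J z) (linearFibre m k ι f z)

theorem chartSiegel_mem (hJ : IsCompatibleComplexStructure ι J) {θ₀ : CotangentBundle n Q} {z : M}
    (hz : (ι z).proj ∈ (chartAt (Eucl n) θ₀.proj).source) : chartSiegel J θ₀ z ∈ siegel n :=
  siegelOf_mem ((hJ.linear z).transport (isVerticalSymplectic_chartEquiv hz))

theorem continuousOn_chartSiegel (hJ : IsCompatibleComplexStructure ι J)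
    (θ₀ : CotangentBundle n Q) :
    ContinuousOn (chartSiegel J θ₀) {z | (ι z).proj ∈ (chartAt (Eucl n) θ₀.proj).source} :=
  continuousOn_siegelOf.comp (hJ.continuousOn_transport θ₀) fun z hz =>
    (hJ.linear z).transport (isVerticalSymplectic_chartEquiv hz)

theorem mem_relativeMaslovCycle_iff {z : M} :
    z ∈ relativeMaslovCycle m k ι f ↔ linearFibre m k ι f z ⊓ vertical n ≠ ⊥ := by
  have h := verticalSpace_eq (ι z)
  change fibreSection m k ι f z ⊓ verticalSpace (ι z) ≠ ⊥ ↔ _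
  rw [h]
  exact Iff.rfl

section Local

variable {z₀ z : M} {Ψ : OpenPartialHomeomorph M (Eucl k × Eucl n)}
  {g : Eucl k × Eucl n → PhaseSpace n}

theorem IsLagrangianFibration.isotropic (hf : IsLagrangianFibration m k ι f) (z : M) :
    ∀ u ∈ linearFibre m k ι f z, ∀ v ∈ linearFibre m k ι f z, stdForm u v = 0 :=
  (hf.lagrangian z).2

theorem IsAdapted.stdForm_eq_zero (hf : IsLagrangianFibration m k ι f) (h : IsAdapted m k ι f z₀ Ψ g)
    (hz : z ∈ Ψ.source) (v w : Eucl n) :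
    stdForm (fderiv ℝ g (Ψ z) (0, v)) (fderiv ℝ g (Ψ z) (0, w)) = 0 := by
  have hm := h.mem_map_iff z hz _ (coe_chartEquiv (h.proj_mem z hz))
  obtain ⟨a, ha, hav⟩ := (hm _).2 ⟨v, rfl⟩
  obtain ⟨b, hb, hbw⟩ := (hm _).2 ⟨w, rfl⟩
  rw [← hav, ← hbw]
  exact ((isVerticalSymplectic_chartEquiv (h.proj_mem z hz)).form a b).trans
    (hf.isotropic z a ha b hb)

theorem IsAdapted.isLagrangianFrame (hf : IsLagrangianFibration m k ι f)
    (h : IsAdapted m k ι f z₀ Ψ g) (hz : z ∈ Ψ.source) :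
    IsLagrangianFrame (baseMat (sliceFrame g (Ψ z))) (fibreMat (sliceFrame g (Ψ z))) :=
  isLagrangianFrame_of_isotropic (h.isFrame hz).1 fun _ _ => h.stdForm_eq_zero hf hz _ _

theorem IsAdapted.maslovPhase_eq (hJ : IsCompatibleComplexStructure ι J)
    (h : IsAdapted m k ι f z₀ Ψ g) (hz : z ∈ Ψ.source) :
    maslovPhase m k ι f J z = phaseSq (frameMat (baseMat (sliceFrame g (Ψ z)))
      (fibreMat (sliceFrame g (Ψ z))) (chartSiegel J (ι z₀) z)).det := by
  have hfr := h.isFrame hz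
  obtain ⟨l, s, hl, hs, e⟩ := exists_detSq_eq (J z) (L := linearFibre m k ι f z) ⟨_, hfr.of_map⟩
  exact e.trans (phaseSq_det_hermMat_eq (hJ.linear z)
    (isVerticalSymplectic_chartEquiv (h.proj_mem z hz)) hl hfr hs)

theorem IsAdapted.mem_cycle_iff (h : IsAdapted m k ι f z₀ Ψ g) (hz : z ∈ Ψ.source) :
    z ∈ relativeMaslovCycle m k ι f ↔ (baseMat (sliceFrame g (Ψ z))).det = 0 := by
  rw [mem_relativeMaslovCycle_iff, det_baseMat_eq_zero_iff_of_map
    (isVerticalSymplectic_chartEquiv (h.proj_mem z hz)) (h.isFrame hz)]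

theorem IsAdapted.maslovAngle_eq (hf : IsLagrangianFibration m k ι f)
    (hJ : IsCompatibleComplexStructure ι J) (h : IsAdapted m k ι f z₀ Ψ g) (hz : z ∈ Ψ.source)
    (hc : z ∉ relativeMaslovCycle m k ι f) :
    maslovAngle m k ι f J z = frameAngle (baseMat (sliceFrame g (Ψ z)))
      (fibreMat (sliceFrame g (Ψ z))) (chartSiegel J (ι z₀) z) := by
  rw [maslovAngle, if_neg hc]
  exact lagAngle_eq (hJ.linear z) (isVerticalSymplectic_chartEquiv (h.proj_mem z hz))
    (hf.isotropic z) (h.isFrame hz) fun h0 => hc ((h.mem_cycle_iff hz).2 h0)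

theorem IsAdapted.continuousOn_baseMat (h : IsAdapted m k ι f z₀ Ψ g) :
    ContinuousOn (fun z => baseMat (sliceFrame g (Ψ z))) Ψ.source :=
  continuous_baseMat.comp_continuousOn h.continuousOn_sliceFrame

theorem IsAdapted.continuousOn_fibreMat (h : IsAdapted m k ι f z₀ Ψ g) :
    ContinuousOn (fun z => fibreMat (sliceFrame g (Ψ z))) Ψ.source :=
  continuous_fibreMat.comp_continuousOn h.continuousOn_sliceFrame

theorem IsAdapted.continuousOn_chartSiegel (hJ : IsCompatibleComplexStructure ι J)
    (h : IsAdapted m k ι f z₀ Ψ g) : ContinuousOn (chartSiegel J (ι z₀)) Ψ.source :=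
  (_root_.continuousOn_chartSiegel hJ (ι z₀)).mono h.proj_mem

end Local

variable [IsManifold (𝓡 m) ∞ M] [IsManifold (𝓡 k) ∞ B]

theorem norm_maslovPhase (hf : IsLagrangianFibration m k ι f)
    (hJ : IsCompatibleComplexStructure ι J) (z : M) : ‖maslovPhase m k ι f J z‖ = 1 := by
  obtain ⟨Ψ, g, h⟩ := hf.exists_isAdapted z
  rw [h.maslovPhase_eq hJ h.mem]
  exact norm_phaseSq ((h.isLagrangianFrame hf h.mem).det_frameMat_ne_zero
    (chartSiegel_mem hJ (h.proj_mem z h.mem)))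

theorem continuous_maslovPhase (hf : IsLagrangianFibration m k ι f)
    (hJ : IsCompatibleComplexStructure ι J) : Continuous (maslovPhase m k ι f J) := by
  refine continuous_iff_continuousAt.2 fun z₀ => ?_
  obtain ⟨Ψ, g, h⟩ := hf.exists_isAdapted z₀
  have hs := Ψ.open_source.mem_nhds h.mem
  have hX := h.continuousOn_baseMat.continuousAt hs
  have hY := h.continuousOn_fibreMat.continuousAt hs
  have hZ := (h.continuousOn_chartSiegel hJ).continuousAt hs
  have hF : Continuous fun p : Matrix (Fin n) (Fin n) ℝ × Matrix (Fin n) (Fin n) ℝ ×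
      Matrix (Fin n) (Fin n) ℂ => (frameMat p.1 p.2.1 p.2.2).det :=
    Continuous.matrix_det (((continuous_fst.comp continuous_snd).matrix_map
      Complex.continuous_ofReal).sub ((continuous_fst.matrix_map
        Complex.continuous_ofReal).matrix_mul (continuous_snd.comp continuous_snd)))
  have hD : ContinuousAt (fun z => (frameMat (baseMat (sliceFrame g (Ψ z)))
      (fibreMat (sliceFrame g (Ψ z))) (chartSiegel J (ι z₀) z)).det) z₀ :=
    hF.continuousAt.comp (f := fun z => (baseMat (sliceFrame g (Ψ z)),
      fibreMat (sliceFrame g (Ψ z)), chartSiegel J (ι z₀) z)) (hX.prodMk (hY.prodMk hZ))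
  refine (hD.phaseSq ((h.isLagrangianFrame hf h.mem).det_frameMat_ne_zero
    (chartSiegel_mem hJ (h.proj_mem z₀ h.mem)))).congr ?_
  filter_upwards [hs] with z hz
  exact (h.maslovPhase_eq hJ hz).symm

theorem turn_maslovAngle (hf : IsLagrangianFibration m k ι f)
    (hJ : IsCompatibleComplexStructure ι J) (z : M) :
    turn (maslovAngle m k ι f J z) = maslovPhase m k ι f J z := by
  by_cases hc : z ∈ relativeMaslovCycle m k ι f
  · have hex := exists_turn_eq (norm_maslovPhase hf hJ z)
    rw [maslovAngle, if_pos hc, dif_pos hex]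
    exact hex.choose_spec
  · obtain ⟨Ψ, g, h⟩ := hf.exists_isAdapted z
    rw [h.maslovAngle_eq hf hJ h.mem hc, h.maslovPhase_eq hJ h.mem]
    exact (h.isLagrangianFrame hf h.mem).turn_frameAngle
      (fun h0 => hc ((h.mem_cycle_iff h.mem).2 h0)) (chartSiegel_mem hJ (h.proj_mem z h.mem))

theorem isClosed_relativeMaslovCycle (hf : IsLagrangianFibration m k ι f) :
    IsClosed (relativeMaslovCycle m k ι f) := by
  rw [← isOpen_compl_iff, isOpen_iff_mem_nhds]
  intro z₀ hz₀
  obtain ⟨Ψ, g, h⟩ := hf.exists_isAdapted z₀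
  have hs := Ψ.open_source.mem_nhds h.mem
  have hd : ContinuousAt (fun z => (baseMat (sliceFrame g (Ψ z))).det) z₀ :=
    (continuous_id.matrix_det.comp_continuousOn h.continuousOn_baseMat).continuousAt hs
  have hne := hd.eventually_ne fun h0 => hz₀ ((h.mem_cycle_iff h.mem).2 h0)
  filter_upwards [hs, hne] with z hz hz' hc
  exact hz' ((h.mem_cycle_iff hz).1 hc)

/-- In adapted coordinates the angle off the cycle is `frameAngle` of a continuous moving frame. -/
theorem continuousOn_maslovAngle (hf : IsLagrangianFibration m k ι f)
    (hJ : IsCompatibleComplexStructure ι J) :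
    ContinuousOn (maslovAngle m k ι f J) (relativeMaslovCycle m k ι f)ᶜ := by
  intro z₀ hz₀
  refine ContinuousAt.continuousWithinAt ?_
  obtain ⟨Ψ, g, h⟩ := hf.exists_isAdapted z₀
  have hs := Ψ.open_source.mem_nhds h.mem
  have hX := h.continuousOn_baseMat.continuousAt hs
  have hY := h.continuousOn_fibreMat.continuousAt hs
  have hZ := (h.continuousOn_chartSiegel hJ).continuousAt hs
  have hd : (baseMat (sliceFrame g (Ψ z₀))).det ≠ 0 := fun h0 => hz₀ ((h.mem_cycle_iff h.mem).2 h0)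
  have hI : ContinuousAt (fun z => (baseMat (sliceFrame g (Ψ z)))⁻¹) z₀ := by
    simp only [Matrix.inv_def, Ring.inverse_eq_inv']
    exact ((continuous_id.matrix_det.continuousAt.comp (f := fun z =>
      baseMat (sliceFrame g (Ψ z))) hX).inv₀ hd).smul
      (continuous_id.matrix_adjugate.continuousAt.comp (f := fun z =>
        baseMat (sliceFrame g (Ψ z))) hX)
  have hF : Continuous fun p : Matrix (Fin n) (Fin n) ℝ × Matrix (Fin n) (Fin n) ℝ ×
      Matrix (Fin n) (Fin n) ℂ => p.2.2 - (p.1 * p.2.1).map Complex.ofReal :=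
    (continuous_snd.comp continuous_snd).sub ((continuous_fst.matrix_mul
      (continuous_fst.comp continuous_snd)).matrix_map Complex.continuous_ofReal)
  have hσ : ContinuousAt (fun z => chartSiegel J (ι z₀) z - ((baseMat (sliceFrame g (Ψ z)))⁻¹
      * fibreMat (sliceFrame g (Ψ z))).map Complex.ofReal) z₀ :=
    hF.continuousAt.comp (f := fun z => ((baseMat (sliceFrame g (Ψ z)))⁻¹,
      fibreMat (sliceFrame g (Ψ z)), chartSiegel J (ι z₀) z)) (hI.prodMk (hY.prodMk hZ))
  have hnear : ∀ᶠ z in 𝓝 z₀, z ∈ Ψ.source ∧ z ∉ relativeMaslovCycle m k ι f :=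
    (eventually_mem_set.2 hs).and
      ((isClosed_relativeMaslovCycle hf).isOpen_compl.mem_nhds hz₀)
  have hc : ContinuousWithinAt (fun z => frameAngle (baseMat (sliceFrame g (Ψ z)))
      (fibreMat (sliceFrame g (Ψ z))) (chartSiegel J (ι z₀) z))
      (Ψ.source ∩ (relativeMaslovCycle m k ι f)ᶜ) z₀ := by
    refine (continuousOn_siegelAngle _ ?_).comp hσ.continuousWithinAt fun z hz => ?_
    · exact (h.isLagrangianFrame hf h.mem).sub_mem_siegel hd
        (chartSiegel_mem hJ (h.proj_mem z₀ h.mem))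
    · exact (h.isLagrangianFrame hf hz.1).sub_mem_siegel
        (fun h0 => hz.2 ((h.mem_cycle_iff hz.1).2 h0)) (chartSiegel_mem hJ (h.proj_mem z hz.1))
  refine (hc.continuousAt hnear).congr ?_
  filter_upwards [hnear] with z hz
  exact (h.maslovAngle_eq hf hJ hz.1 hz.2).symm

end MaslovAngle

/-! ### Orbits in adapted coordinates -/

/-- A continuous curve that becomes differentiable after composition with an immersion is
differentiable. -/
theorem exists_hasDerivAt_of_comp {E F : Type*} [NormedAddCommGroup E] [NormedSpace ℝ E]
    [FiniteDimensional ℝ E] [NormedAddCommGroup F] [NormedSpace ℝ F] [FiniteDimensional ℝ F]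
    {g : E → F} {e : ℝ → E} {g' : E →L[ℝ] F} {c' : F} {t₀ : ℝ}
    (hg : HasStrictFDerivAt g g' (e t₀)) (hinj : Function.Injective g') (he : ContinuousAt e t₀)
    (hc : HasDerivAt (fun t => g (e t)) c' t₀) : ∃ ξ, HasDerivAt e ξ t₀ ∧ g' ξ = c' := by
  have : CompleteSpace E := FiniteDimensional.complete ℝ E
  obtain ⟨l, hl⟩ := (g' : E →ₗ[ℝ] F).exists_leftInverse_of_injective (LinearMap.ker_eq_bot.2 hinj)
  set L : F →L[ℝ] E := LinearMap.toContinuousLinearMap l with hL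
  have hLg : L.comp g' = ((ContinuousLinearEquiv.refl ℝ E : E ≃L[ℝ] E) : E →L[ℝ] E) :=
    ContinuousLinearMap.ext fun x => LinearMap.congr_fun hl x
  have hs : HasStrictFDerivAt (fun x => L (g x))
      ((ContinuousLinearEquiv.refl ℝ E : E ≃L[ℝ] E) : E →L[ℝ] E) (e t₀) := by
    rw [← hLg]
    exact L.hasStrictFDerivAt.comp (e t₀) hg
  have hcL : HasDerivAt (fun t => L (g (e t))) (L c') t₀ := L.hasFDerivAt.comp_hasDerivAt t₀ hc
  have hinv := hs.to_localInverse.hasFDerivAt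
  have he' : HasDerivAt e (L c') t₀ := by
    have h1 := HasFDerivAt.comp_hasDerivAt (l := hs.localInverse _ _ _)
      (f := fun t => L (g (e t))) t₀ hinv hcL
    refine h1.congr_of_eventuallyEq ?_
    filter_upwards [he.eventually hs.eventually_left_inverse] with t ht
    exact ht.symm
  exact ⟨_, he', (HasFDerivAt.comp_hasDerivAt (l := g) (f := e) t₀ hg.hasFDerivAt he').unique hc⟩

theorem continuous_orbit {M B : Type*} [TopologicalSpace M] {f : M → B} {b : B}
    (φ : Flow ℝ (f ⁻¹' {b} : Set M)) (z : (f ⁻¹' {b} : Set M)) :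
    Continuous fun t : ℝ => (φ t z : M) :=
  continuous_subtype_val.comp (φ.cont'.comp (Continuous.prodMk_left z))

section Orbits

variable {n m k : ℕ} {Q : Type*} [TopologicalSpace Q] [ChartedSpace (Eucl n) Q]
  [IsManifold (𝓡 n) ∞ Q] {M : Type*} [TopologicalSpace M] [ChartedSpace (Eucl m) M]
  {B : Type*} [TopologicalSpace B] [ChartedSpace (Eucl k) B]
  {ι : M → CotangentBundle n Q} {f : M → B} {H : CotangentBundle n Q → ℝ} {b : B}
  {φ : Flow ℝ (f ⁻¹' {b} : Set M)} {z₀ : M} {Ψ : OpenPartialHomeomorph M (Eucl k × Eucl n)}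
  {g : Eucl k × Eucl n → PhaseSpace n}

/-- The hamiltonian vector field at `z`, as a vector of the model space. -/
abbrev linearField (H : CotangentBundle n Q → ℝ) (θ : CotangentBundle n Q) : PhaseSpace n :=
  hamiltonianVectorField H θ

theorem IsAdapted.hasDerivAt_orbit (h : IsAdapted m k ι f z₀ Ψ g)
    (hφ : IsRestrictedHamiltonianFlow H ι f b φ) {z : (f ⁻¹' {b} : Set M)} {t₀ : ℝ}
    (hz : (φ t₀ z : M) ∈ Ψ.source) :
    ∃ ξ : Eucl n, HasDerivAt (fun t => Ψ (φ t z : M)) (0, ξ) t₀ ∧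
      fderiv ℝ g (Ψ (φ t₀ z : M)) (0, ξ)
        = chartEquiv (ι z₀) (ι (φ t₀ z : M)) (linearField H (ι (φ t₀ z : M))) := by
  have hs : ∀ᶠ t in 𝓝 t₀, (φ t z : M) ∈ Ψ.source :=
    (continuous_orbit φ z).continuousAt.eventually (Ψ.open_source.mem_nhds hz)
  have hg := (h.smooth.contDiffAt (Ψ.open_target.mem_nhds (Ψ.map_source hz))).hasStrictFDerivAt
    (by simp)
  have he : ContinuousAt (fun t => Ψ (φ t z : M)) t₀ :=
    (Ψ.continuousAt hz).comp (f := fun t => (φ t z : M)) (continuous_orbit φ z).continuousAt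
  have hsrc := mem_cotangentChart_source.2 (h.proj_mem _ hz)
  have hχ : HasMFDerivAt (cotangentModel n) 𝓘(ℝ, PhaseSpace n) (cotangentChart (ι z₀))
      (ι (φ t₀ z : M))
      (chartEquiv (ι z₀) (ι (φ t₀ z : M)) : PhaseSpace n →L[ℝ] PhaseSpace n) := by
    rw [coe_chartEquiv (h.proj_mem _ hz)]
    exact (mdifferentiableAt_extChartAt (I := cotangentModel n) hsrc).hasMFDerivAt
  have hc : HasDerivAt (fun t => g (Ψ (φ t z : M)))
      (chartEquiv (ι z₀) (ι (φ t₀ z : M)) (linearField H (ι (φ t₀ z : M)))) t₀ := by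
    have h1 : HasFDerivAt (fun t => cotangentChart (ι z₀) (ι (φ t z : M)))
        ((chartEquiv (ι z₀) (ι (φ t₀ z : M)) : PhaseSpace n →L[ℝ] PhaseSpace n).comp
          (ContinuousLinearMap.smulRight (1 : ℝ →L[ℝ] ℝ) (linearField H (ι (φ t₀ z : M))))) t₀ :=
      hasMFDerivAt_iff_hasFDerivAt.1 (hχ.comp t₀ (hφ z t₀))
    refine (h1.hasDerivAt.congr_of_eventuallyEq ?_).congr_deriv ?_
    · filter_upwards [hs] with t ht
      exact h.eq _ ht
    · simp
  obtain ⟨ξ, hξ, hξ'⟩ := exists_hasDerivAt_of_comp (e := fun t => Ψ (φ t z : M)) hg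
    (h.injective _ hz) he hc
  have h0 : ξ.1 = 0 := by
    have h1 : HasDerivAt (fun t => (Ψ (φ t z : M)).1) ξ.1 t₀ :=
      (ContinuousLinearMap.fst ℝ (Eucl k) (Eucl n)).hasFDerivAt.comp_hasDerivAt t₀ hξ
    refine h1.unique ((hasDerivAt_const t₀ (Ψ (φ t₀ z : M)).1).congr_of_eventuallyEq ?_)
    filter_upwards [hs] with t ht
    refine (h.fibre _ ht _ hz).1 ?_
    rw [show f (φ t z : M) = b from (φ t z).2, show f (φ t₀ z : M) = b from (φ t₀ z).2]
  refine ⟨ξ.2, ?_, ?_⟩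
  · rwa [← h0, Prod.mk.eta]
  · rwa [← h0, Prod.mk.eta]

theorem IsAdapted.stdForm_orbit (h : IsAdapted m k ι f z₀ Ψ g)
    (hH : ContMDiff (cotangentModel n) 𝓘(ℝ, ℝ) ∞ H) {z : M} (hz : z ∈ Ψ.source)
    (v : PhaseSpace n) :
    stdForm v (chartEquiv (ι z₀) (ι z) (linearField H (ι z)))
      = fderiv ℝ (chartHamiltonian H (ι z₀)) (g (Ψ z)) v := by
  have hp := h.proj_mem z hz
  obtain ⟨u, rfl⟩ := (chartEquiv (ι z₀) (ι z)).surjective v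
  rw [(isVerticalSymplectic_chartEquiv hp).form, stdForm_hamiltonianVectorField, h.eq z hz,
    ← fderiv_chartHamiltonian hH hp, ← coe_chartEquiv hp]
  rfl

/-- The hamiltonian is constant on the invariant fibre, infinitesimally. -/
theorem IsAdapted.fderiv_slice_eq_zero (hf : IsLagrangianFibration m k ι f)
    (h : IsAdapted m k ι f z₀ Ψ g) (hH : ContMDiff (cotangentModel n) 𝓘(ℝ, ℝ) ∞ H)
    (hφ : IsRestrictedHamiltonianFlow H ι f b φ) {z : M} (hz : z ∈ Ψ.source) (hb : f z = b)
    (v : Eucl n) :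
    fderiv ℝ (chartHamiltonian H (ι z₀)) (g (Ψ z)) (fderiv ℝ g (Ψ z) (0, v)) = 0 := by
  have h0 : φ 0 ⟨z, hb⟩ = ⟨z, hb⟩ := φ.map_zero_apply _
  obtain ⟨ξ, -, hξ⟩ := h.hasDerivAt_orbit hφ (z := ⟨z, hb⟩) (t₀ := 0) (by rwa [h0])
  rw [h0] at hξ
  rw [← h.stdForm_orbit hH hz, ← hξ]
  exact h.stdForm_eq_zero hf hz v ξ

/-! ### Crossings along an orbit -/

/-- Along an orbit through the relative Maslov cycle, the difference of the continuous angle of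
`det²` and the angle of the Siegel upper half space drops. -/
theorem orbit_jump [IsManifold (𝓡 m) ∞ M] [IsManifold (𝓡 k) ∞ B]
    (hf : IsLagrangianFibration m k ι f) (hH : IsConvexHamiltonian H)
    (hφ : IsRestrictedHamiltonianFlow H ι f b φ)
    {J : ∀ z : M, TangentSpace (cotangentModel n) (ι z) →L[ℝ] TangentSpace (cotangentModel n) (ι z)}
    (hJ : IsCompatibleComplexStructure ι J) (z : (f ⁻¹' {b} : Set M)) {a : ℝ → ℝ}
    (ha : Continuous a) (hau : ∀ t, turn (a t) = maslovPhase m k ι f J (φ t z : M)) {t₀ : ℝ}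
    (hcross : (φ t₀ z : M) ∈ relativeMaslovCycle m k ι f) :
    ∃ c, (∀ᶠ t in 𝓝[>] t₀, (φ t z : M) ∉ relativeMaslovCycle m k ι f ∧
        a t - maslovAngle m k ι f J (φ t z : M) = c) ∧
      ∀ᶠ t in 𝓝[<] t₀, (φ t z : M) ∉ relativeMaslovCycle m k ι f ∧
        c < a t - maslovAngle m k ι f J (φ t z : M) := by
  obtain ⟨Ψ, g, h⟩ := hf.exists_isAdapted (φ t₀ z : M)
  set θ₀ := ι (φ t₀ z : M) with hθ₀
  set p := Ψ (φ t₀ z : M) with hp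
  have hg : ContDiffAt ℝ ∞ g p := h.smooth.contDiffAt (Ψ.open_target.mem_nhds (Ψ.map_source h.mem))
  have hgp : g p = cotangentChart θ₀ θ₀ := h.eq _ h.mem
  obtain ⟨ξ, hξ, hξ'⟩ := h.hasDerivAt_orbit hφ h.mem
  have hcont := continuous_orbit φ z
  have hs : (fun t => (φ t z : M)) ⁻¹' Ψ.source ∈ 𝓝 t₀ :=
    hcont.continuousAt.preimage_mem_nhds (Ψ.open_source.mem_nhds h.mem)
  have hmaps : MapsTo (fun t => (φ t z : M)) ((fun t => (φ t z : M)) ⁻¹' Ψ.source) Ψ.source :=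
    fun t ht => ht
  -- The derivatives of the moving frame.
  have hfr : ∀ i, HasDerivAt (fun t => sliceFrame g (Ψ (φ t z : M)) i)
      (fderiv ℝ (fderiv ℝ g) p (0, ξ) (0, EuclideanSpace.single i 1)) t₀ := fun i => by
    have h2 : HasFDerivAt (fderiv ℝ g) (fderiv ℝ (fderiv ℝ g) p) (Ψ (φ t₀ z : M)) :=
      ((hg.fderiv_right (m := 1) (by norm_cast)).differentiableAt one_ne_zero).hasFDerivAt
    have h3 := (HasFDerivAt.comp_hasDerivAt (l := fderiv ℝ g) (f := fun t => Ψ (φ t z : M)) t₀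
      h2 hξ).clm_apply (hasDerivAt_const t₀ ((0, EuclideanSpace.single i 1) : Eucl k × Eucl n))
    refine h3.congr_deriv ?_
    rw [map_zero, add_zero]
  have hX' : ∀ i j, HasDerivAt (fun t => baseMat (sliceFrame g (Ψ (φ t z : M))) i j)
      (baseMat (fun i => fderiv ℝ (fderiv ℝ g) p (0, ξ) (0, EuclideanSpace.single i 1)) i j) t₀ :=
    fun i j => ((EuclideanSpace.proj (𝕜 := ℝ) j).comp
      (ContinuousLinearMap.fst ℝ (Eucl n) (Eucl n →L[ℝ] ℝ))).hasFDerivAt.comp_hasDerivAt t₀ (hfr i)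
  have hY' : ∀ i j, HasDerivAt (fun t => fibreMat (sliceFrame g (Ψ (φ t z : M))) i j)
      (fibreMat (fun i => fderiv ℝ (fderiv ℝ g) p (0, ξ) (0, EuclideanSpace.single i 1)) i j) t₀ :=
    fun i j => ((ContinuousLinearMap.apply ℝ ℝ (EuclideanSpace.single j (1 : ℝ))).comp
      (ContinuousLinearMap.snd ℝ (Eucl n) (Eucl n →L[ℝ] ℝ))).hasFDerivAt.comp_hasDerivAt t₀ (hfr i)
  -- Near `p`, the points of the slice through `p` come from the invariant fibre.
  have hnear : ∀ v : Eucl n, ∀ᶠ t in 𝓝 (0 : ℝ), ∃ y ∈ Ψ.source, Ψ y = p + t • ((0, v) :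
      Eucl k × Eucl n) ∧ f y = b := fun v => by
    have hl : Continuous fun t : ℝ => p + t • ((0, v) : Eucl k × Eucl n) := by fun_prop
    have hpt : p + (0 : ℝ) • ((0, v) : Eucl k × Eucl n) ∈ Ψ.target := by
      rw [zero_smul, add_zero]
      exact Ψ.map_source h.mem
    filter_upwards [hl.continuousAt.preimage_mem_nhds (Ψ.open_target.mem_nhds hpt)] with t ht
    refine ⟨Ψ.symm (p + t • (0, v)), Ψ.map_target ht, Ψ.right_inv ht, ?_⟩
    have : f (φ t₀ z : M) = b := (φ t₀ z).2
    rw [← this]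
    refine (h.fibre _ (Ψ.map_target ht) _ h.mem).2 ?_
    rw [Ψ.right_inv ht, Prod.fst_add, Prod.smul_fst, smul_zero, add_zero]
  have hpos : ∀ v ≠ 0, Matrix.vecMul v (baseMat (sliceFrame g (Ψ (φ t₀ z : M)))) = 0 →
      0 < dotProduct (Matrix.vecMul v (baseMat
        (fun i => fderiv ℝ (fderiv ℝ g) p (0, ξ) (0, EuclideanSpace.single i 1))))
        (Matrix.vecMul v (fibreMat (sliceFrame g (Ψ (φ t₀ z : M))))) := by
    intro v hv hvX
    set v' : Eucl n := WithLp.toLp 2 v with hv'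
    have he := fderiv_slice_eq_sum g p v'
    set w : Eucl n →L[ℝ] ℝ := (fderiv ℝ g p (0, v')).2 with hw
    have he' : fderiv ℝ g p (0, v') = (0, w) := by
      refine Prod.ext (PiLp.ext fun j => ?_) rfl
      rw [he]
      exact (baseMat_sum (sliceFrame g p) v j).trans (congrFun hvX j)
    have hw0 : w ≠ 0 := fun h0 => hv (by
      rw [h0] at he'
      have h1 : fderiv ℝ g p (0, v') = fderiv ℝ g p 0 := by
        rw [he', map_zero]
        rfl
      have h2 := congrArg (fun q : Eucl k × Eucl n => q.2) (h.injective _ h.mem h1)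
      exact funext fun i => congrArg (fun x : Eucl n => x i) h2)
    have key := crossing_pos (h := chartHamiltonian H θ₀) (ξ := (0, ξ)) hg
      (by
        rw [hgp]
        exact contDiffAt_chartHamiltonian hH.1 (mem_chart_source _ _))
      (by
        filter_upwards [hnear v'] with t ht
        obtain ⟨y, hy, hyp, hyb⟩ := ht
        rw [← hyp]
        exact h.fderiv_slice_eq_zero hf hH.1 hφ hy hyb v')
      (by
        filter_upwards [hnear v'] with t ht
        obtain ⟨y, hy, hyp, hyb⟩ := ht
        rw [← hyp]
        exact h.stdForm_eq_zero hf hy v' ξ)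
      (fun u => by
        rw [hξ']
        exact h.stdForm_orbit hH.1 h.mem u) he' (by
        rw [hgp]
        exact hH.fderiv_fderiv_pos θ₀ hw0)
    rw [clm_apply_eq_sum] at key
    refine key.trans_eq (Finset.sum_congr rfl fun j _ => ?_)
    have hv2 : ((0, v') : Eucl k × Eucl n) = ∑ i, v i • ((0, EuclideanSpace.single i 1) :
        Eucl k × Eucl n) := by
      refine Prod.ext ?_ (PiLp.ext fun j => ?_)
      · simp [Prod.fst_sum]
      · simp [Prod.snd_sum, Pi.single_apply, hv']
    have e1 : w (EuclideanSpace.single j 1)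
        = Matrix.vecMul v (fibreMat (sliceFrame g (Ψ (φ t₀ z : M)))) j := by
      rw [hw, he]
      exact fibreMat_sum (sliceFrame g p) v j
    have e2 : (fderiv ℝ (fderiv ℝ g) p (0, ξ) (0, v')).1 j = Matrix.vecMul v (baseMat
        (fun i => fderiv ℝ (fderiv ℝ g) p (0, ξ) (0, EuclideanSpace.single i 1))) j := by
      rw [hv2, map_sum]
      simp only [map_smul]
      exact baseMat_sum _ v j
    rw [e1, e2, mul_comm]
  have hjump := frameAngle_jump hs (h.continuousOn_baseMat.comp hcont.continuousOn hmaps)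
    (h.continuousOn_fibreMat.comp hcont.continuousOn hmaps)
    ((h.continuousOn_chartSiegel hJ).comp hcont.continuousOn hmaps) ha.continuousOn
    (fun t ht => h.isLagrangianFrame hf ht) (fun t ht => chartSiegel_mem hJ (h.proj_mem _ ht))
    (fun t ht => (hau t).trans (h.maslovPhase_eq hJ ht)) hX' hY' hpos
    ((h.mem_cycle_iff h.mem).1 hcross)
  obtain ⟨c, hc1, hc2⟩ := hjump
  refine ⟨c, ?_, ?_⟩
  · filter_upwards [hc1, mem_nhdsWithin_of_mem_nhds hs] with t ht hts
    have hn : (φ t z : M) ∉ relativeMaslovCycle m k ι f := fun hm =>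
      ht.1 ((h.mem_cycle_iff hts).1 hm)
    refine ⟨hn, ?_⟩
    rw [h.maslovAngle_eq hf hJ hts hn]
    exact ht.2
  · filter_upwards [hc2, mem_nhdsWithin_of_mem_nhds hs] with t ht hts
    have hn : (φ t z : M) ∉ relativeMaslovCycle m k ι f := fun hm =>
      ht.1 ((h.mem_cycle_iff hts).1 hm)
    refine ⟨hn, ?_⟩
    rw [h.maslovAngle_eq hf hJ hts hn]
    exact ht.2

end Orbits

/-! ### Recurrence and the relative Maslov cycle -/

/-- A function on `ℝ` that is locally constant off `K` and drops at the points of `K` is antitone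
off `K`, strictly across the points of `K`. -/
theorem antitone_of_drop {K : Set ℝ} {G : ℝ → ℝ}
    (hG : ∀ t ∉ K, ∀ᶠ s in 𝓝 t, s ∉ K ∧ G s = G t)
    (hK : ∀ t ∈ K, ∃ c, (∀ᶠ s in 𝓝[>] t, s ∉ K ∧ G s = c) ∧ ∀ᶠ s in 𝓝[<] t, s ∉ K ∧ c < G s)
    {t₁ t₂ : ℝ} (h₁ : t₁ ∉ K) (h₂ : t₂ ∉ K) (h : t₁ ≤ t₂) :
    G t₂ ≤ G t₁ ∧ ∀ t ∈ K, t₁ < t → t < t₂ → G t₂ < G t₁ := by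
  classical
  choose! c hcr hcl using hK
  -- make `G` right continuous at the points of `K`
  let g : ℝ → ℝ := fun t => if t ∈ K then c t else G t
  have hgK : ∀ t ∈ K, g t = c t := fun t ht => if_pos ht
  have hgG : ∀ t ∉ K, g t = G t := fun t ht => if_neg ht
  have hg : Antitone g := by
    refine antitone_of_locally_antitone fun t => ?_
    by_cases ht : t ∈ K
    · obtain ⟨r, hr, hr'⟩ := mem_nhdsGT_iff_exists_Ioo_subset.1 (hcr t ht)
      obtain ⟨l, hl, hl'⟩ := mem_nhdsLT_iff_exists_Ioo_subset.1 (hcl t ht)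
      -- `G` is constant on the interval to the left of `t`
      have hconst : ∀ x ∈ Ioo l t, ∀ y ∈ Ioo l t, G x = G y := by
        have : PreconnectedSpace (Ioo l t) :=
          isPreconnected_iff_preconnectedSpace.1 isPreconnected_Ioo
        have hloc : IsLocallyConstant fun x : Ioo l t => G x :=
          (IsLocallyConstant.iff_eventually_eq _).2 fun x =>
            continuousAt_subtype_val.eventually
              ((hG x (hl' x.2).1).mono fun s hs => hs.2)
        exact fun x hx y hy => hloc.apply_eq_of_preconnectedSpace ⟨x, hx⟩ ⟨y, hy⟩
      refine ⟨Ioo l r, Ioo_mem_nhds hl hr, fun x hx y hy hxy => ?_⟩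
      have hright : ∀ s ∈ Ioo t r, g s = c t := fun s hs =>
        (hgG s (hr' hs).1).trans (hr' hs).2
      have hleft : ∀ s ∈ Ioo l t, g s = G s := fun s hs => hgG s (hl' hs).1
      rcases lt_trichotomy x t with hxt | rfl | hxt
      · rw [hleft x ⟨hx.1, hxt⟩]
        rcases lt_trichotomy y t with hyt | rfl | hyt
        · rw [hleft y ⟨hy.1, hyt⟩]
          exact (hconst _ ⟨hy.1, hyt⟩ _ ⟨hx.1, hxt⟩).le
        · rw [hgK y ht]
          exact (hl' ⟨hx.1, hxt⟩).2.le
        · rw [hright y ⟨hyt, hy.2⟩]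
          exact (hl' ⟨hx.1, hxt⟩).2.le
      · rcases hxy.eq_or_lt with rfl | hyt
        · exact le_rfl
        · rw [hright y ⟨hyt, hy.2⟩, hgK x ht]
      · rw [hright x ⟨hxt, hx.2⟩, hright y ⟨hxt.trans_le hxy, hy.2⟩]
    · refine ⟨_, hG t ht, fun x hx y hy _ => ?_⟩
      rw [hgG x hx.1, hgG y hy.1, hx.2, hy.2]
  refine ⟨?_, fun t ht h1 h2 => ?_⟩
  · rw [← hgG _ h₁, ← hgG _ h₂]
    exact hg h
  · obtain ⟨s, ⟨hs, hcs⟩, hs'⟩ := ((hcl t ht).and (Ioo_mem_nhdsLT h1)).exists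
    calc G t₂ = g t₂ := (hgG _ h₂).symm
      _ ≤ g t := hg h2.le
      _ = c t := hgK t ht
      _ < G s := hcs
      _ = g s := (hgG s hs).symm
      _ ≤ g t₁ := hg hs'.1.le
      _ = G t₁ := hgG _ h₁

/-- The non-wandering set is invariant. -/
theorem map_mem_nonWanderingSet {X : Type*} [TopologicalSpace X] {φ : Flow ℝ X} {x : X}
    (hx : x ∈ nonWanderingSet φ) (s : ℝ) : φ s x ∈ nonWanderingSet φ := by
  intro U hU
  have hc : Continuous (φ s) := φ.continuous continuous_const continuous_id
  obtain ⟨t, ht, _, ⟨y, hy, rfl⟩, hy'⟩ := hx _ (hc.continuousAt.preimage_mem_nhds hU)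
  refine ⟨t, ht, _, ⟨φ s y, hy, rfl⟩, ?_⟩
  have : φ t (φ s y) = φ s (φ t y) := by
    rw [← φ.map_add, ← φ.map_add, add_comm]
  rw [this]
  exact hy'

section Recurrence

variable {n m k : ℕ} {Q : Type*} [TopologicalSpace Q] [ChartedSpace (Eucl n) Q]
  [IsManifold (𝓡 n) ∞ Q] {M : Type*} [TopologicalSpace M] [ChartedSpace (Eucl m) M]
  [IsManifold (𝓡 m) ∞ M]
  {B : Type*} [TopologicalSpace B] [ChartedSpace (Eucl k) B] [IsManifold (𝓡 k) ∞ B]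
  {ι : M → CotangentBundle n Q} {f : M → B} {H : CotangentBundle n Q → ℝ} {b : B}
  {φ : Flow ℝ (f ⁻¹' {b} : Set M)}
  {J : ∀ z : M, TangentSpace (cotangentModel n) (ι z) →L[ℝ] TangentSpace (cotangentModel n) (ι z)}

theorem exists_orbit_angle (hf : IsLagrangianFibration m k ι f)
    (hJ : IsCompatibleComplexStructure ι J) (φ : Flow ℝ (f ⁻¹' {b} : Set M))
    (z : (f ⁻¹' {b} : Set M)) :
    ∃ a : ℝ → ℝ, Continuous a ∧ ∀ t, turn (a t) = maslovPhase m k ι f J (φ t z : M) := by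
  obtain ⟨r, hr⟩ := exists_turn_eq (norm_maslovPhase hf hJ (φ 0 z : M))
  obtain ⟨a, ha, -, hau⟩ := exists_angle_of_convex (convex_univ : Convex ℝ (univ : Set ℝ))
    (u := fun t => maslovPhase m k ι f J (φ t z : M))
    ((continuous_maslovPhase hf hJ).comp ((continuous_orbit φ z).comp continuous_subtype_val))
    (fun t => norm_maslovPhase hf hJ _) ⟨0, mem_univ _⟩ hr
  exact ⟨fun t => a ⟨t, mem_univ _⟩, by fun_prop, fun t => hau _⟩

/-- The difference of the continuous angle of `det²` along an orbit and the angle of the Siegel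
upper half space does not increase, and it drops whenever the orbit meets the cycle. -/
theorem orbit_antitone (hf : IsLagrangianFibration m k ι f) (hH : IsConvexHamiltonian H)
    (hφ : IsRestrictedHamiltonianFlow H ι f b φ) (hJ : IsCompatibleComplexStructure ι J)
    (z : (f ⁻¹' {b} : Set M)) {a : ℝ → ℝ} (ha : Continuous a)
    (hau : ∀ t, turn (a t) = maslovPhase m k ι f J (φ t z : M)) {t₁ t₂ : ℝ}
    (h₁ : (φ t₁ z : M) ∉ relativeMaslovCycle m k ι f)
    (h₂ : (φ t₂ z : M) ∉ relativeMaslovCycle m k ι f) (h : t₁ ≤ t₂) :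
    a t₂ - maslovAngle m k ι f J (φ t₂ z : M) ≤ a t₁ - maslovAngle m k ι f J (φ t₁ z : M) ∧
      ∀ t, (φ t z : M) ∈ relativeMaslovCycle m k ι f → t₁ < t → t < t₂ →
        a t₂ - maslovAngle m k ι f J (φ t₂ z : M)
          < a t₁ - maslovAngle m k ι f J (φ t₁ z : M) := by
  refine antitone_of_drop (K := {t | (φ t z : M) ∈ relativeMaslovCycle m k ι f})
    (G := fun t => a t - maslovAngle m k ι f J (φ t z : M)) (fun t ht => ?_)
    (fun t ht => orbit_jump hf hH hφ hJ z ha hau ht) h₁ h₂ h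
  have hopen : (relativeMaslovCycle m k ι f)ᶜ ∈ 𝓝 (φ t z : M) :=
    (isClosed_relativeMaslovCycle hf).isOpen_compl.mem_nhds ht
  have hcont := continuous_orbit φ z
  have hG : ContinuousAt (fun t => a t - maslovAngle m k ι f J (φ t z : M)) t :=
    ha.continuousAt.sub (((continuousOn_maslovAngle hf hJ).continuousAt hopen).comp
      (f := fun t => (φ t z : M)) hcont.continuousAt)
  have hint : ∀ s, ∃ j : ℤ, a s - maslovAngle m k ι f J (φ s z : M) = j := fun s =>
    turn_eq_turn_iff.1 ((hau s).trans (turn_maslovAngle hf hJ _).symm)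
  filter_upwards [hcont.continuousAt.preimage_mem_nhds hopen,
    hG.eventually (Metric.ball_mem_nhds _ one_pos)] with s hs hs'
  refine ⟨hs, ?_⟩
  obtain ⟨i, hi⟩ := hint s
  obtain ⟨j, hj⟩ := hint t
  have hd : dist (a s - maslovAngle m k ι f J (φ s z : M))
      (a t - maslovAngle m k ι f J (φ t z : M)) < 1 := hs'
  rw [hi, hj, Real.dist_eq] at hd
  rw [hi, hj]
  have : |i - j| < 1 := by exact_mod_cast hd
  rw [sub_eq_zero.1 (Int.abs_lt_one_iff.1 this)]

/-- If the orbit of `z` crosses the cycle before the time `T`, then all orbits that start near `z`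
have lost at least one turn at all later times. -/
theorem eventually_orbit_lt (hf : IsLagrangianFibration m k ι f) (hH : IsConvexHamiltonian H)
    (hφ : IsRestrictedHamiltonianFlow H ι f b φ) (hJ : IsCompatibleComplexStructure ι J)
    {z : (f ⁻¹' {b} : Set M)} {t₀ T : ℝ} (h0 : 0 < t₀) (hT : t₀ < T)
    (hz : (z : M) ∉ relativeMaslovCycle m k ι f)
    (hzT : (φ T z : M) ∉ relativeMaslovCycle m k ι f)
    (hz₀ : (φ t₀ z : M) ∈ relativeMaslovCycle m k ι f) :
    ∀ᶠ x : (f ⁻¹' {b} : Set M) in 𝓝 z, (x : M) ∉ relativeMaslovCycle m k ι f ∧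
      ∀ t, T ≤ t → (φ t x : M) ∉ relativeMaslovCycle m k ι f →
        ∀ a : ℝ → ℝ, Continuous a → (∀ t, turn (a t) = maslovPhase m k ι f J (φ t x : M)) →
          a t - a 0 - (maslovAngle m k ι f J (φ t x : M) - maslovAngle m k ι f J (x : M)) < 0 := by
  have hopen := (isClosed_relativeMaslovCycle hf).isOpen_compl
  set A : Set (f ⁻¹' {b} : Set M) := {x | (x : M) ∉ relativeMaslovCycle m k ι f} with hA
  have hAo : IsOpen A := hopen.preimage continuous_subtype_val
  have hφc : Continuous fun p : ℝ × (f ⁻¹' {b} : Set M) => φ p.1 p.2 := φ.cont'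
  -- the angles along the orbit segments of length `T` that start off the cycle
  obtain ⟨a, hac, ha0, hau⟩ := exists_angle_homotopy
    (u := fun p : unitInterval × A => maslovPhase m k ι f J (φ (T * p.1) p.2 : M))
    ((continuous_maslovPhase hf hJ).comp (continuous_subtype_val.comp
      (hφc.comp (by fun_prop : Continuous fun p : unitInterval × A =>
        ((T * p.1 : ℝ), (p.2 : (f ⁻¹' {b} : Set M)))))))
    (fun p => norm_maslovPhase hf hJ _)
    (a₀ := fun x => maslovAngle m k ι f J (x : (f ⁻¹' {b} : Set M)))
    ((continuousOn_maslovAngle hf hJ).comp_continuous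
      (continuous_subtype_val.comp continuous_subtype_val) fun x => x.2)
    (fun x => by
      rw [turn_maslovAngle hf hJ]
      simp [φ.map_zero_apply])
  have hangle : ∀ (x : A) (a' : ℝ → ℝ), Continuous a' →
      (∀ t, turn (a' t) = maslovPhase m k ι f J (φ t x : M)) →
      a' T - a' 0 = a (1, x) - maslovAngle m k ι f J (x : (f ⁻¹' {b} : Set M)) := by
    intro x a' ha' hau'
    have h := sub_eq_sub_of_turn_eq (X := unitInterval) (a := fun t => a' (T * t))
      (b := fun t => a (t, x)) (by fun_prop) (by fun_prop) (fun t => by rw [hau', hau]) 1 0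
    simp only [Set.Icc.coe_one, Set.Icc.coe_zero, mul_one, mul_zero, ha0] at h
    linarith
  have hφT : Continuous (φ T) := φ.continuous continuous_const continuous_id
  have hE : ContinuousAt (fun x : A => a (1, x) - maslovAngle m k ι f J (φ T x : M)) ⟨z, hz⟩ :=
    (by fun_prop : Continuous fun x : A => a (1, x)).continuousAt.sub
      (ContinuousAt.comp (g := maslovAngle m k ι f J) (f := fun x : A => (φ T x : M))
        (x := ⟨z, hz⟩) ((continuousOn_maslovAngle hf hJ).continuousAt (hopen.mem_nhds hzT))
        (continuous_subtype_val.comp (hφT.comp continuous_subtype_val)).continuousAt)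
  have hEz : a (1, ⟨z, hz⟩) - maslovAngle m k ι f J (φ T z : M) < 0 := by
    obtain ⟨a', ha', hau'⟩ := exists_orbit_angle hf hJ φ z
    have h := (orbit_antitone hf hH hφ hJ z ha' hau' (t₁ := 0) (t₂ := T)
      (by rwa [φ.map_zero_apply]) hzT (h0.trans hT).le).2 t₀ hz₀ h0 hT
    have h' := hangle ⟨z, hz⟩ a' ha' hau'
    rw [φ.map_zero_apply] at h
    simp only at h'
    linarith
  have hev : ∀ᶠ x : A in 𝓝 ⟨z, hz⟩, a (1, x) - maslovAngle m k ι f J (φ T x : M) < 0 :=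
    hE.eventually (gt_mem_nhds hEz)
  rw [nhds_subtype_eq_comap, eventually_comap] at hev
  filter_upwards [hev, hAo.mem_nhds hz,
    hφT.continuousAt.preimage_mem_nhds (hAo.mem_nhds hzT)] with x hx hxA hxT
  refine ⟨hxA, fun t ht hxt a' ha' hau' => ?_⟩
  have h1 := hx ⟨x, hxA⟩ rfl
  have h2 := hangle ⟨x, hxA⟩ a' ha' hau'
  have h3 := (orbit_antitone hf hH hφ hJ x ha' hau' hxT hxt ht).1
  simp only at h1 h2
  linarith

/-- Points of a fibre that are close to each other are joined by short paths in the fibre. -/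
theorem exists_short_path (hf : IsLagrangianFibration m k ι f) {z : (f ⁻¹' {b} : Set M)}
    {W : Set (f ⁻¹' {b} : Set M)} (hW : W ∈ 𝓝 z) :
    ∃ U ∈ 𝓝 z, ∀ x ∈ U, ∀ y ∈ U, ∃ σ : SingularSimplex 1 (f ⁻¹' {b} : Set M),
      σ (stdSimplex.vertex 0) = x ∧ σ (stdSimplex.vertex 1) = y ∧ ∀ s, σ s ∈ W := by
  obtain ⟨Ψ, g, h⟩ := hf.exists_isAdapted (z : M)
  rw [nhds_subtype_eq_comap] at hW
  obtain ⟨O, hO, hOW⟩ := hW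
  -- a ball of the chart whose points lie in `O`
  have hsymm : Ψ.symm ⁻¹' O ∈ 𝓝 (Ψ z) := by
    refine (Ψ.continuousAt_symm (Ψ.map_source h.mem)).preimage_mem_nhds ?_
    rwa [Ψ.left_inv h.mem]
  obtain ⟨r, hr, hball⟩ := Metric.mem_nhds_iff.1
    (inter_mem (Ψ.open_target.mem_nhds (Ψ.map_source h.mem)) hsymm)
  refine ⟨(↑) ⁻¹' (Ψ.source ∩ Ψ ⁻¹' Metric.ball (Ψ z) r),
    continuous_subtype_val.continuousAt.preimage_mem_nhds
      (inter_mem (Ψ.open_source.mem_nhds h.mem)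
        ((Ψ.continuousAt h.mem).preimage_mem_nhds (Metric.ball_mem_nhds _ hr))), ?_⟩
  rintro x ⟨hxs, hx⟩ y ⟨hys, hy⟩
  let p : stdSimplex ℝ (Fin 2) → Eucl k × Eucl n := fun s => s 0 • Ψ x + s 1 • Ψ y
  have hp : ∀ s, p s ∈ Metric.ball (Ψ z) r := fun s =>
    (convex_ball _ _) hx hy (s.2.1 0) (s.2.1 1) (stdSimplex.add_eq_one s)
  have hpc : Continuous p := by
    have h0 : Continuous fun s : stdSimplex ℝ (Fin 2) => s 0 :=
      (continuous_apply 0).comp continuous_subtype_val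
    have h1 : Continuous fun s : stdSimplex ℝ (Fin 2) => s 1 :=
      (continuous_apply 1).comp continuous_subtype_val
    exact (h0.smul continuous_const).add (h1.smul continuous_const)
  have hfib : ∀ s, f (Ψ.symm (p s)) = b := fun s => by
    have hxb : f x = b := x.2
    have hyb : f y = b := y.2
    rw [← hxb]
    refine (h.fibre _ (Ψ.map_target (hball (hp s)).1) _ hxs).2 ?_
    have e : (Ψ y).1 = (Ψ x).1 := (h.fibre _ hys _ hxs).1 (hyb.trans hxb.symm)
    rw [Ψ.right_inv (hball (hp s)).1]
    simp only [p, Prod.fst_add, Prod.smul_fst, e]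
    rw [← add_smul, stdSimplex.add_eq_one, one_smul]
  refine ⟨⟨fun s => ⟨Ψ.symm (p s), hfib s⟩, Continuous.subtype_mk ?_ _⟩, ?_, ?_, fun s => ?_⟩
  · exact Ψ.continuousOn_symm.comp_continuous hpc fun s => (hball (hp s)).1
  · exact Subtype.ext (by simp [p, Ψ.left_inv hxs])
  · exact Subtype.ext (by simp [p, Ψ.left_inv hys])
  · exact hOW (hball (hp s)).2

/-- A non-wandering orbit through the cycle gives a closed curve in the fibre, an orbit segment
followed by a short arc off the cycle, along which `det²` has negative degree. -/
theorem exists_windingCochain_lt (hf : IsLagrangianFibration m k ι f) (hH : IsConvexHamiltonian H)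
    (hφ : IsRestrictedHamiltonianFlow H ι f b φ) (hJ : IsCompatibleComplexStructure ι J)
    {θ : (f ⁻¹' {b} : Set M)} (hθ : (θ : M) ∈ relativeMaslovCycle m k ι f)
    (hθΩ : θ ∈ nonWanderingSet φ) :
    ∃ σ₁ σ₂ : SingularSimplex 1 (f ⁻¹' {b} : Set M),
      σ₁ (stdSimplex.vertex 1) = σ₂ (stdSimplex.vertex 0) ∧
      σ₂ (stdSimplex.vertex 1) = σ₁ (stdSimplex.vertex 0) ∧
      windingCochain (fun x : (f ⁻¹' {b} : Set M) => maslovPhase m k ι f J x)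
        (fun x => maslovAngle m k ι f J x) σ₁ < 0 ∧
      ∀ s, (σ₂ s : M) ∉ relativeMaslovCycle m k ι f := by
  -- crossings are isolated: go back along the orbit by a short time `ε` to leave the cycle
  obtain ⟨ε, hε, hε1, hεp, hεm⟩ : ∃ ε : ℝ, 0 < ε ∧ ε < 1 / 2 ∧
      (φ ε θ : M) ∉ relativeMaslovCycle m k ι f ∧
      (φ (-ε) θ : M) ∉ relativeMaslovCycle m k ι f := by
    obtain ⟨a, ha, hau⟩ := exists_orbit_angle hf hJ φ θ
    obtain ⟨c, hr, hl⟩ := orbit_jump hf hH hφ hJ θ ha hau (t₀ := 0) (by rwa [φ.map_zero_apply])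
    have hneg : Tendsto (fun t : ℝ => -t) (𝓝[>] 0) (𝓝[<] 0) := by
      simpa using tendsto_neg_nhdsGT (a := (0 : ℝ))
    obtain ⟨ε, ⟨h1, h2⟩, h3⟩ := ((hr.and (hneg.eventually hl)).and
      (Ioo_mem_nhdsGT (show (0 : ℝ) < 1 / 2 by norm_num))).exists
    exact ⟨ε, h3.1, h3.2, h1.1, h2.1⟩
  have hback : φ ε (φ (-ε) θ) = θ := by
    rw [← φ.map_add, add_neg_cancel, φ.map_zero_apply]
  have hfwd : φ (2 * ε) (φ (-ε) θ) = φ ε θ := by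
    rw [← φ.map_add]
    congr 1
    ring
  have hev := eventually_orbit_lt hf hH hφ hJ (z := φ (-ε) θ) (t₀ := ε) (T := 2 * ε) hε
    (by linarith) hεm (by rwa [hfwd]) (by rwa [hback])
  obtain ⟨U, hU, hpath⟩ := exists_short_path hf hev
  obtain ⟨t, ht, _, ⟨y, hy, rfl⟩, hty⟩ := map_mem_nonWanderingSet hθΩ (-ε) U hU
  obtain ⟨σ₂, hσ0, hσ1, hσ⟩ := hpath _ hty _ hy
  have hlt := (hσ (stdSimplex.vertex 1)).2 t (by linarith)
  rw [hσ1] at hlt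
  have hoff : (φ t y : M) ∉ relativeMaslovCycle m k ι f := by
    rw [← hσ0]
    exact (hσ _).1
  obtain ⟨a, ha, hau⟩ := exists_orbit_angle hf hJ φ y
  have hs : Continuous fun s : stdSimplex ℝ (Fin 2) => t * s 1 :=
    continuous_const.mul ((continuous_apply 1).comp continuous_subtype_val)
  let σ₁ : SingularSimplex 1 (f ⁻¹' {b} : Set M) :=
    ⟨fun s => φ (t * s 1) y, φ.cont'.comp (hs.prodMk continuous_const)⟩
  have h0 : σ₁ (stdSimplex.vertex 0) = y := by
    change φ (t * stdSimplex.vertex (S := ℝ) (0 : Fin 2) 1) y = y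
    simp [φ.map_zero_apply]
  have h1 : σ₁ (stdSimplex.vertex 1) = φ t y := by
    change φ (t * stdSimplex.vertex (S := ℝ) (1 : Fin 2) 1) y = φ t y
    simp
  refine ⟨σ₁, σ₂, h1.trans hσ0.symm, hσ1.trans h0.symm, ?_, fun s => (hσ s).1⟩
  have h := windingCochain_eq (u := fun x : (f ⁻¹' {b} : Set M) => maslovPhase m k ι f J x)
    (α := fun x => maslovAngle m k ι f J x) (fun x => turn_maslovAngle hf hJ _) (σ := σ₁)
    (a := fun s => a (t * s 1)) (ha.comp hs) (fun s => hau _)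
  have h' := hlt hoff a ha hau
  rw [h0, h1] at h
  have hneg : (windingCochain (fun x : (f ⁻¹' {b} : Set M) => maslovPhase m k ι f J x)
      (fun x => maslovAngle m k ι f J x) σ₁ : ℝ) < 0 := by
    rw [h]
    simpa using h'
  exact_mod_cast hneg

end Recurrence

end

theorem mainTheorem7 {n m k : ℕ}
    {Q : Type*} [TopologicalSpace Q] [T2Space Q] [SecondCountableTopology Q]
    [ChartedSpace (Eucl n) Q] [IsManifold (𝓡 n) ∞ Q]
    {M : Type*} [TopologicalSpace M] [T2Space M] [SecondCountableTopology M]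
    [ChartedSpace (Eucl m) M] [IsManifold (𝓡 m) ∞ M]
    {B : Type*} [TopologicalSpace B] [T2Space B] [SecondCountableTopology B]
    [ChartedSpace (Eucl k) B] [IsManifold (𝓡 k) ∞ B]
    (H : CotangentBundle n Q → ℝ) (hH : IsConvexHamiltonian H)
    (ι : M → CotangentBundle n Q) (f : M → B) (hf : IsLagrangianFibration m k ι f)
    (b : B) (φ : Flow ℝ (f ⁻¹' {b} : Set M)) (hφ : IsRestrictedHamiltonianFlow H ι f b φ)
    (hmeet : (((↑) : (f ⁻¹' {b} : Set M) → M) ⁻¹' relativeMaslovCycle m k ι f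
      ∩ nonWanderingSet φ).Nonempty)
    (J : ∀ z : M, TangentSpace (cotangentModel n) (ι z) →L[ℝ] TangentSpace (cotangentModel n) (ι z))
    (hJ : IsCompatibleComplexStructure ι J) :
    ∃ d : SingularH1 M, IsPrimaryDifference m k ι f J d ∧
      (∀ d' : SingularH1 M, IsPrimaryDifference m k ι f J d' → d' = d) ∧
      (d.pullback ⟨((↑) : (f ⁻¹' {b} : Set M) → M), continuous_subtype_val⟩).IsCarriedBy
        (((↑) : (f ⁻¹' {b} : Set M) → M) ⁻¹' relativeMaslovCycle m k ι f) ∧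
      ¬ IsOfFinAddOrder
        (d.pullback ⟨((↑) : (f ⁻¹' {b} : Set M) → M), continuous_subtype_val⟩) := by
  have hδ := continuous_maslovPhase hf hJ
  have hδ1 := norm_maslovPhase hf hJ
  have hα := turn_maslovAngle hf hJ
  let c : SingularCocycle M := windingCocycle hδ hδ1 hα
  have hdeg : IsPrimaryDifference m k ι f J (QuotientAddGroup.mk c) := fun σ hσ =>
    ⟨_, ⟨c, rfl, rfl⟩, hasDegree_windingCochain hσ hδ hδ1 hα⟩
  refine ⟨QuotientAddGroup.mk c, hdeg, fun d' hd' => ?_, ⟨cocyclePullback _ c, rfl, fun σ hσ => ?_⟩,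
    ?_⟩
  · refine SingularH1.ext_of_hasValue fun σ hσ => ?_
    obtain ⟨i, hi, hi'⟩ := hdeg σ hσ
    obtain ⟨j, hj, hj'⟩ := hd' σ hσ
    obtain rfl := hi'.unique hj'
    exact ⟨i, hi, hj⟩
  · exact windingCochain_eq_zero hα (continuousOn_maslovAngle hf hJ) hσ
  · obtain ⟨θ, hθ, hθΩ⟩ := hmeet
    obtain ⟨σ₁, σ₂, h1, h2, hneg, hoff⟩ := exists_windingCochain_lt hf hH hφ hJ hθ hθΩ
    have h0 : windingCochain (maslovPhase m k ι f J) (maslovAngle m k ι f J)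
        ((⟨_, continuous_subtype_val⟩ : C((f ⁻¹' {b} : Set M), M)).comp σ₂) = 0 :=
      windingCochain_eq_zero hα (continuousOn_maslovAngle hf hJ) hoff
    refine SingularH1.not_isOfFinAddOrder (cocyclePullback _ c) h1 h2 (ne_of_lt ?_)
    exact (add_eq_left.2 h0).trans_lt hneg
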